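/- **Setting.** Let $p\ge 1$, let $(\varepsilon_k)_{k\in\mathbb Z}$ be i.i.d. random elements of a measurable space $S$, and for every $t\in\mathbb Z$ let $(\varepsilon^{(t)}_k)_{k\in\mathbb Z}$ be a copy of $(\varepsilon_k)_k$, all these sequences being independent and defined on one probability space. Let $Y_t=f(\varepsilon_t,\varepsilon_{t-1},\dots)$ with $f:S^{\mathbb N}\to\mathbb R$ measurable, and write $\boldsymbol X_t=(Y_t,\dots,Y_{t-p+1})$. Assume $(Y_t)$ is a Markov process of order $p$: the conditional law of $Y_t$ given $(Y_s)_{s<t}$ is $\kappa(\boldsymbol X_{t-1},\cdot)$; put $F(y|\boldsymbol x)=\kappa(\boldsymbol x,(-\infty,y])$. **Assumptions.** - (A1′) $(Y_t)$ is $L^2$-$m$-approximable: $\mathbb E Y_t^2<\infty$ and $\sum_{m\ge1}\delta(m)<\infty$, where $\delta(m)=(\mathbb E|Y_m-Y_m^{(m)}|^2)^{1/2}$ and $Y_t^{(m)}=f(\varepsilon_t,\dots,\varepsilon_{t-m+1},\varepsilon^{(t)}_{t-m},\varepsilon^{(t)}_{t-m-1},\dots)$. - (A4) The domain $D$ of $Y_t$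 is an interval contained in $[-C_M,C_M]$ for some $C_M>0$, and $Y_t\in D$ almost surely. - (A2) $\boldsymbol X_t$ has a positive density on $D^p$ that is $C^2$ there. For every $y$, $F(y|\boldsymbol x)$ is $C^2$ in $\boldsymbol x\in D^p$; $F$ is Lipschitz in $y$ uniformly in $\boldsymbol x\in D^p$; for $\boldsymbol x\in D^p$ the law $\kappa(\boldsymbol x,\cdot)$ has a density on $D$ that is positive at every $y\in D$. - (A3) With $N=n-p+1$, the bandwidths $h=h_n>0$, $h_0=h_{0,n}>0$ satisfy $h_0\asymp h\to0$ and $Nh^p\to\infty$ as $n\to\infty$. - (A5) $w$ is a bounded symmetric probability density on $\mathbb R$ with $\int v\,w(v)\,dv=0$ and $\int v^2w(v)\,dv<\infty$, and $\boldsymbol v\mapsto\prod_{s=1}^p w(v_s)$ is Lipschitz. $K$ is a differentiable Lipschitz distribution function with $\int K'=1$, $\int zK'(z)\,dz=0$, $\int z^2K'(z)\,dz<\infty$. - (A6) There are integers $m=m(n)$ with $p<m$ for large $n$, $m=o(n)$ and $\delta(m)=o(h^{p+1})$. **Prediction set.** Given a candidate $c$ for the unobserved $Y_{n+1}$, put $Y_{n+1}:=c$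 and, with $W_h(\boldsymbol u,\boldsymbol v)=\prod_{s=1}^p\frac1h w\big(\frac{u_s-v_s}{h}\big)$, let $$\hat F^{(c)}(y|\boldsymbol x)=\frac{\frac1N\sum_{i=p+1}^{n+1}W_h(\boldsymbol X_{i-1},\boldsymbol x)K\big(\frac{y-Y_i}{h_0}\big)}{\frac1N\sum_{i=p+1}^{n+1}W_h(\boldsymbol X_{i-1},\boldsymbol x)},\qquad \hat V^{(c)}_t=\big|\hat F^{(c)}(Y_t|\boldsymbol X_{t-1})-\tfrac12\big|\quad(p+1\le t\le n+1),$$ $$\hat p(c)=\frac1N\sum_{t=p+1}^{n+1}\mathbf 1\{\hat V^{(c)}_t\ge\hat V^{(c)}_{n+1}\},\qquad \hat C^{\mathrm{MDCP}}_{1-\alpha}(\boldsymbol X_n)=\{c\in\mathcal Y_{\mathrm{trial}}:\hat p(c)>\alpha\},$$ where the set $\mathcal Y_{\mathrm{trial}}\subseteq\mathbb R$ of candidates contains $D$. **Theorem.** For every $\alpha\in(0,1)$, $$\big|\mathbb P\big(Y_{n+1}\in\hat C^{\mathrm{MDCP}}_{1-\alpha}(\boldsymbol X_n)\,\big|\,\boldsymbol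 X_n\big)-(1-\alpha)\big|\xrightarrow{\ p\ }0\qquad(n\to\infty).$$ -/

import Mathlib

open MeasureTheory ProbabilityTheory Filter Asymptotics Topology
open scoped ENNReal NNReal BigOperators

noncomputable section

namespace MDCP

variable {Ω S : Type*} [MeasurableSpace Ω] [MeasurableSpace S]

/-! ### The estimator and the prediction set -/

/-- The vector of the latest `p` values `X_t = (Y_t, Y_{t-1}, …, Y_{t-p+1})` of a real sequence. -/
def lagVec (p : ℕ) (y : ℤ → ℝ) (t : ℤ) : Fin p → ℝ :=
  fun s => y (t - (s : ℕ))

/-- The product kernel weight `W_h(u, v) = ∏_s h⁻¹ w((u_s - v_s) / h)`. -/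
def prodWeight {p : ℕ} (w : ℝ → ℝ) (h : ℝ) (u v : Fin p → ℝ) : ℝ :=
  ∏ s, (1 / h) * w ((u s - v s) / h)

/-- The number `N = n - p + 1` of (augmented) data pairs, as a real number. -/
def sampleSize (p n : ℕ) : ℝ := (n : ℝ) - p + 1

/-- The sequence in which the (unobserved) value at time `n + 1` is replaced by the
candidate `c`. -/
def augment (n : ℕ) (y : ℤ → ℝ) (c : ℝ) : ℤ → ℝ :=
  Function.update y ((n : ℤ) + 1) c

/-- The kernel estimator `F̂^{(c)}(a | x)` of the conditional distribution function, built from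
the pairs `(X_{i-1}, Y_i)`, `p + 1 ≤ i ≤ n`, and the candidate pair `(X_n, c)`. -/
def condCDFEst (p n : ℕ) (w K : ℝ → ℝ) (h h₀ : ℝ) (y : ℤ → ℝ) (c : ℝ)
    (a : ℝ) (x : Fin p → ℝ) : ℝ :=
  ((1 / sampleSize p n) * ∑ i ∈ Finset.Icc ((p : ℤ) + 1) ((n : ℤ) + 1),
      prodWeight w h (lagVec p (augment n y c) (i - 1)) x *
        K ((a - augment n y c i) / h₀)) /
    ((1 / sampleSize p n) * ∑ i ∈ Finset.Icc ((p : ℤ) + 1) ((n : ℤ) + 1),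
      prodWeight w h (lagVec p (augment n y c) (i - 1)) x)

/-- The rank `Û_t^{(c)} = F̂^{(c)}(Y_t | X_{t-1})`, where `Y_{n+1}` is the candidate `c`. -/
def rankEst (p n : ℕ) (w K : ℝ → ℝ) (h h₀ : ℝ) (y : ℤ → ℝ) (c : ℝ) (t : ℤ) : ℝ :=
  condCDFEst p n w K h h₀ y c (augment n y c t) (lagVec p (augment n y c) (t - 1))

/-- The conformity score `V̂_t^{(c)} = |Û_t^{(c)} - 1/2|`. -/
def score (p n : ℕ) (w K : ℝ → ℝ) (h h₀ : ℝ) (y : ℤ → ℝ) (c : ℝ) (t : ℤ) : ℝ :=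
  |rankEst p n w K h h₀ y c t - 1 / 2|

open Classical in
/-- The conformal p-value `p̂(c) = N⁻¹ ∑_{t=p+1}^{n+1} 1{V̂_t^{(c)} ≥ V̂_{n+1}^{(c)}}`. -/
def pValue (p n : ℕ) (w K : ℝ → ℝ) (h h₀ : ℝ) (y : ℤ → ℝ) (c : ℝ) : ℝ :=
  (1 / sampleSize p n) * ∑ t ∈ Finset.Icc ((p : ℤ) + 1) ((n : ℤ) + 1),
    if score p n w K h h₀ y c ((n : ℤ) + 1) ≤ score p n w K h h₀ y c t then (1 : ℝ) else 0

/-- The MDCP prediction set `{c ∈ 𝒴_trial : p̂(c) > α}`. -/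
def predSet (p n : ℕ) (w K : ℝ → ℝ) (h h₀ α : ℝ) (trial : Set ℝ) (y : ℤ → ℝ) : Set ℝ :=
  {c | c ∈ trial ∧ α < pValue p n w K h h₀ y c}

/-! ### `L²`-`m`-approximability -/

/-- The `m`-approximator
`Y_t^{(m)} = f(ε_t, …, ε_{t-m+1}, ε^{(t)}_{t-m}, ε^{(t)}_{t-m-1}, …)`. -/
def approximator (f : (ℕ → S) → ℝ) (ε : ℤ → Ω → S) (ε' : ℤ → ℤ → Ω → S)
    (m : ℕ) (t : ℤ) (ω : Ω) : ℝ :=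
  f fun j => if j < m then ε (t - j) ω else ε' t (t - j) ω

/-- `δ(m) = (E |Y_m - Y_m^{(m)}|²)^{1/2}`. -/
def approxError (P : Measure Ω) (f : (ℕ → S) → ℝ) (ε : ℤ → Ω → S) (ε' : ℤ → ℤ → Ω → S)
    (Y : ℤ → Ω → ℝ) (m : ℕ) : ℝ≥0∞ :=
  eLpNorm (fun ω => Y m ω - approximator f ε ε' m m ω) 2 P

/-- `Y` is an `L²`-`m`-approximable series with the representation
`Y_t = f(ε_t, ε_{t-1}, …)`, where `(ε_k)` are i.i.d. and `(ε' t k)_k`, `t ∈ ℤ`, are independent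
copies of `(ε_k)_k`. -/
structure IsL2MApproximable (P : Measure Ω) (f : (ℕ → S) → ℝ) (ε : ℤ → Ω → S)
    (ε' : ℤ → ℤ → Ω → S) (Y : ℤ → Ω → ℝ) : Prop where
  measurable_fun : Measurable f
  measurable_innov : ∀ k, Measurable (ε k)
  measurable_copy : ∀ t k, Measurable (ε' t k)
  indep : iIndepFun (Sum.elim ε fun q : ℤ × ℤ => ε' q.1 q.2) P
  identDistrib_innov : ∀ k, IdentDistrib (ε k) (ε 0) P P
  identDistrib_copy : ∀ t k, IdentDistrib (ε' t k) (ε 0) P P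
  repr : ∀ t ω, Y t ω = f fun j => ε (t - j) ω
  memLp : ∀ t, MemLp (Y t) 2 P
  summable : ∑' m : ℕ, approxError P f ε ε' Y (m + 1) ≠ ∞

/-! ### The Markov property and the regularity conditions -/

/-- `Y` is a (time-homogeneous) Markov process of order `p`: the conditional law of `Y_t` given
the whole past is `κ(X_{t-1})`. Thus `F(y | x) = κ(x)((-∞, y])`. -/
def IsMarkovOfOrder (p : ℕ) (P : Measure Ω) (κ : Kernel (Fin p → ℝ) ℝ)
    (Y : ℤ → Ω → ℝ) : Prop :=
  ∀ (t : ℤ) (y : ℝ),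
    P⟦{ω | Y t ω ≤ y} | ⨆ s : Set.Iio t, MeasurableSpace.comap (Y s) inferInstance⟧
      =ᵐ[P] fun ω => (κ (lagVec p (fun s => Y s ω) (t - 1))).real (Set.Iic y)

/-- The cube `D^p`. -/
def cube (p : ℕ) (D : Set ℝ) : Set (Fin p → ℝ) := Set.univ.pi fun _ => D

/-- Smoothness and positivity of the laws: `X_t` has on `D^p` a positive `C²` density; the
conditional distribution function `F(y | x) = κ(x)((-∞, y])` is `C²` in `x ∈ D^p`, is Lipschitz
in `y` uniformly in `x`, and has a density that is positive for all `y ∈ D`, `x ∈ D^p`. -/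
structure RegularLaws (p : ℕ) (P : Measure Ω) (D : Set ℝ) (κ : Kernel (Fin p → ℝ) ℝ)
    (Y : ℤ → Ω → ℝ) : Prop where
  marginal_density : ∃ g : (Fin p → ℝ) → ℝ,
    (∀ x ∈ cube p D, 0 < g x) ∧ ContDiffOn ℝ 2 g (cube p D) ∧
      ∀ t : ℤ, P.map (fun ω => lagVec p (fun s => Y s ω) t) =
        (volume.restrict (cube p D)).withDensity fun x => ENNReal.ofReal (g x)
  contDiff_cdf : ∀ y : ℝ, ContDiffOn ℝ 2 (fun x => (κ x).real (Set.Iic y)) (cube p D)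
  lipschitz_cdf : ∃ L : ℝ≥0, ∀ x ∈ cube p D, LipschitzWith L fun y => (κ x).real (Set.Iic y)
  cond_density : ∃ f : (Fin p → ℝ) → ℝ → ℝ, ∀ x ∈ cube p D,
    Measurable (f x) ∧ (∀ y ∈ D, 0 < f x y) ∧
      κ x = (volume.restrict D).withDensity fun y => ENNReal.ofReal (f x y)

/-- The conditions on the kernels: `w` is a symmetric, bounded probability density and `K` is a
differentiable distribution function, with the usual moment conditions, and `∏_s w` and `K` are
Lipschitz. -/
structure KernelConditions (p : ℕ) (w K : ℝ → ℝ) : Prop where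
  w_nonneg : ∀ v, 0 ≤ w v
  w_symm : ∀ v, w (-v) = w v
  w_bounded : ∃ B, ∀ v, w v ≤ B
  w_integrable : Integrable w
  w_integral : ∫ v, w v = 1
  w_integrable_mom1 : Integrable fun v => v * w v
  w_mom1 : ∫ v, v * w v = 0
  w_integrable_mom2 : Integrable fun v => v ^ 2 * w v
  w_lipschitz : ∃ L : ℝ≥0, LipschitzWith L fun v : Fin p → ℝ => ∏ s, w (v s)
  K_mono : Monotone K
  K_atBot : Tendsto K atBot (𝓝 0)
  K_atTop : Tendsto K atTop (𝓝 1)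
  K_differentiable : Differentiable ℝ K
  K_integrable : Integrable (deriv K)
  K_integral : ∫ z, deriv K z = 1
  K_integrable_mom1 : Integrable fun z => z * deriv K z
  K_mom1 : ∫ z, z * deriv K z = 0
  K_integrable_mom2 : Integrable fun z => z ^ 2 * deriv K z
  K_lipschitz : ∃ L : ℝ≥0, LipschitzWith L K

/-- The conditions on the bandwidths: `h₀ ≍ h → 0` and `N h^p → ∞`. -/
structure BandwidthConditions (p : ℕ) (h h₀ : ℕ → ℝ) : Prop where
  h_pos : ∀ n, 0 < h n
  h₀_pos : ∀ n, 0 < h₀ n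
  comparable : h₀ =Θ[atTop] h
  tendsto_zero : Tendsto h atTop (𝓝 0)
  tendsto_infty : Tendsto (fun n => sampleSize p n * h n ^ p) atTop atTop

/-- The approximation order `m = m(n)` satisfies `p < m` for large `n`, `m = o(n)` and
`δ(m) = o(h^{p+1})`. -/
structure ApproximationRate (p : ℕ) (h : ℕ → ℝ) (δ : ℕ → ℝ≥0∞) (m : ℕ → ℕ) : Prop where
  order_lt : ∀ᶠ n in atTop, p < m n
  sublinear : (fun n => (m n : ℝ)) =o[atTop] fun n => (n : ℝ)
  rate : (fun n => (δ (m n)).toReal) =o[atTop] fun n => h n ^ (p + 1)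

end MDCP

end

/-! If the conditional distribution function F were known, the ranks U_t = F(Y_t | X_{t-1}) would be
uniform given the past, because F is continuous in y (`measureReal_abs_cdf_sub_half_lt`,
`PathLaw.integral_mul_lowScore`). With the scores V_t = |U_t - 1/2|, a law of large numbers shows
that the p-value exceeds α essentially when V_{n+1} < (1-α)/2, and this event has conditional
probability exactly 1-α given X_n (`condExp_lowScore`). So it suffices that each estimated rank is
close to the true one in probability, uniformly in t. `lt_pValue_iff` is the deterministic
comparison, and since conditional expectation contracts L¹, the mean error in coverage is at most
the probability of the symmetric difference of the two events.

For the ranks, uniform convergence of the kernel estimator in x is avoided. The estimator is first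
studied at a point x independent of the data, in L¹ of (law of the series) × (Lebesgue measure on
D^p). The numerator centred at F(v | x) splits into a martingale of variance O(1/(N h^p)), the
smoothing bias of K, and the oscillation of F(v | ·) near the data
(`PathLaw.eventually_numerator_le`). The denominator splits into weights minus their conditional
means given the values p steps earlier, which are orthogonal at lag p, and averages of these
conditional means; the latter are smoothings of averages of conditional densities, which converge in
L¹ by the ergodic theorem for the Bernoulli shift (`avgTendsto_shiftSeq`,
`PathLaw.eventually_denominator_le`).

The independent point is then replaced by X_t. Terms near t are at most 2p and negligible; the
others are functions of the values before the block X_t, or of values after it. The joint law of X_t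
and such a past is absolutely continuous with respect to the product of the law of the past with
Lebesgue measure, and the Markov property gives the analogous domination for the future. Hence
smallness in L¹ at an independent point implies smallness in probability at X_t
(`PathLaw.past_transfer`, `PathLaw.future_transfer`, `PathLaw.exists_transfer`). A grid argument for
monotone functions gives uniformity in y. -/

noncomputable section

namespace MDCP

/-! ### General facts on measures -/

/-- Absolute continuity in quantitative form: up to a small error, integrals of functions bounded
by `1` against `μ` are dominated by a multiple of those against `ν`. -/
lemma exists_lintegral_le_mul_add {α : Type*} [MeasurableSpace α] {μ ν : Measure α}
    [IsFiniteMeasure μ] [IsFiniteMeasure ν] (h : μ ≪ ν) {ε : ℝ≥0∞} (hε : ε ≠ 0) :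
    ∃ A : ℝ≥0, ∀ φ : α → ℝ≥0∞, Measurable φ → (∀ a, φ a ≤ 1) →
      ∫⁻ a, φ a ∂μ ≤ A * ∫⁻ a, φ a ∂ν + ε := by
  set r := μ.rnDeriv ν with hr
  have hrm : Measurable r := Measure.measurable_rnDeriv μ ν
  have hμ : ν.withDensity r = μ := Measure.withDensity_rnDeriv_eq μ ν h
  have hfin : ∫⁻ a, r a ∂ν ≠ ∞ := (Measure.lintegral_rnDeriv_lt_top μ ν).ne
  obtain ⟨δ, hδ, hδ'⟩ := exists_pos_setLIntegral_lt_of_measure_lt hfin hε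
  -- `n` is a truncation level for the density: by Markov's inequality `{r ≥ n}` has `ν`-measure
  -- below `δ`, hence `μ`-mass below `ε`; off this set the density is at most `n`, which serves as
  -- the constant `A`.
  obtain ⟨n, hn⟩ : ∃ n : ℕ, (∫⁻ a, r a ∂ν) / δ < n := by
    refine ENNReal.exists_nat_gt (ENNReal.div_ne_top hfin hδ.ne')
  have hn0 : (n : ℝ≥0∞) ≠ 0 := by
    rintro h0; rw [h0] at hn; exact not_lt_zero hn
  refine ⟨n, fun φ hφ hφ1 => ?_⟩
  set s := {a | (n : ℝ≥0∞) ≤ r a} with hs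
  have hsm : MeasurableSet s := measurableSet_le measurable_const hrm
  have hνs : ν s < δ := by
    refine (meas_ge_le_lintegral_div hrm.aemeasurable hn0 (ENNReal.natCast_ne_top n)).trans_lt ?_
    rw [ENNReal.div_lt_iff (Or.inl hn0) (Or.inl (ENNReal.natCast_ne_top n))]
    rcases eq_or_ne δ ∞ with h' | h'
    · rw [h', ENNReal.top_mul hn0]; exact hfin.lt_top
    · rw [mul_comm]
      exact (ENNReal.div_lt_iff (Or.inl hδ.ne') (Or.inl h')).1 hn
  have h1 : ∫⁻ a, φ a ∂μ = ∫⁻ a, r a * φ a ∂ν := by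
    rw [← hμ, lintegral_withDensity_eq_lintegral_mul _ hrm hφ]; rfl
  rw [h1, ← lintegral_add_compl _ hsm, add_comm]
  gcongr
  · rw [show ((n : ℝ≥0) : ℝ≥0∞) = n by simp, ← lintegral_const_mul _ hφ]
    refine (setLIntegral_mono' hsm.compl fun a ha => ?_).trans (setLIntegral_le_lintegral _ _)
    gcongr
    exact (not_le.1 (show ¬ (n : ℝ≥0∞) ≤ r a from ha)).le
  · refine (setLIntegral_mono' hsm fun a _ => ?_).trans (hδ' s hνs).le
    exact mul_le_of_le_one_right' (hφ1 a)

/-- The second moment of a sum of variables that are orthogonal at distance at least `q`. -/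
lemma integral_sum_sq_le {α : Type*} [MeasurableSpace α] {μ : Measure α} {a : ℕ → α → ℝ}
    (hmem : ∀ i, MemLp (a i) 2 μ) {q : ℕ} {v : ℝ} (hv0 : 0 ≤ v)
    (hv : ∀ i, ∫ x, a i x ^ 2 ∂μ ≤ v)
    (horth : ∀ i j, i + q ≤ j → ∫ x, a i x * a j x ∂μ = 0) (l : ℕ) :
    ∫ x, (∑ i ∈ Finset.range l, a i x) ^ 2 ∂μ ≤ 2 * q * l * v := by
  have hint : ∀ i j, Integrable (fun x => a i x * a j x) μ := fun i j =>
    (hmem i).integrable_mul (hmem j)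
  have hsq : ∀ i, Integrable (fun x => a i x ^ 2) μ := fun i => (hmem i).integrable_sq
  -- Only pairs at distance less than `q` contribute, each at most `v` by the inequality ab ≤ (a² +
  -- b²)/2; for fixed `i` there are at most `2 * q` such `j`.
  have key : ∀ i j, ∫ x, a i x * a j x ∂μ ≤
      if j ∈ Finset.Ico (i + 1 - q) (i + q) then v else 0 := by
    intro i j
    split_ifs with hij
    · have : ∫ x, a i x * a j x ∂μ ≤ ∫ x, (a i x ^ 2 + a j x ^ 2) / 2 ∂μ := by
        refine integral_mono (hint i j) (((hsq i).add (hsq j)).div_const 2) fun x => ?_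
        have := sq_nonneg (a i x - a j x)
        simp only; nlinarith
      rw [integral_div, integral_add (hsq i) (hsq j)] at this
      linarith [hv i, hv j]
    · rw [Finset.mem_Ico, not_and_or, not_le, not_lt] at hij
      rcases hij with hij | hij
      · have := horth j i (by omega)
        simp_rw [mul_comm (a i _)]
        exact this.le
      · exact (horth i j hij).le
  calc ∫ x, (∑ i ∈ Finset.range l, a i x) ^ 2 ∂μ
      = ∑ i ∈ Finset.range l, ∑ j ∈ Finset.range l, ∫ x, a i x * a j x ∂μ := by
        simp_rw [sq, Finset.sum_mul_sum]
        rw [integral_finsetSum _ fun i _ => integrable_finsetSum _ fun j _ => hint i j]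
        exact Finset.sum_congr rfl fun i _ => integral_finsetSum _ fun j _ => hint i j
    _ ≤ ∑ i ∈ Finset.range l, ∑ j ∈ Finset.range l,
          if j ∈ Finset.Ico (i + 1 - q) (i + q) then v else 0 :=
        Finset.sum_le_sum fun i _ => Finset.sum_le_sum fun j _ => key i j
    _ ≤ ∑ i ∈ Finset.range l, 2 * q * v := by
        refine Finset.sum_le_sum fun i _ => ?_
        rw [← Finset.sum_filter, Finset.sum_const, nsmul_eq_mul]
        gcongr
        have : ((Finset.range l).filter fun j => j ∈ Finset.Ico (i + 1 - q) (i + q)).card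
            ≤ 2 * q := by
          refine (Finset.card_le_card (t := Finset.Ico (i + 1 - q) (i + q)) ?_).trans ?_
          · intro j hj; exact (Finset.mem_filter.1 hj).2
          · rw [Nat.card_Ico]; omega
        exact_mod_cast this
    _ = 2 * q * l * v := by rw [Finset.sum_const, Finset.card_range, nsmul_eq_mul]; ring

/-- Translations act continuously on integrable functions. -/
lemma tendsto_lintegral_enorm_translate_sub {p : ℕ} {g : (Fin p → ℝ) → ℝ} (hg : Integrable g) :
    Tendsto (fun z : Fin p → ℝ => ∫⁻ x, ‖g (x + z) - g x‖ₑ) (𝓝 0) (𝓝 0) := by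
  have hgm : MemLp g 1 := memLp_one_iff_integrable.2 hg
  -- Translations form a continuous family of measure preserving maps, and composition with such a
  -- family is continuous in L¹.
  let T : (Fin p → ℝ) → C(Fin p → ℝ, Fin p → ℝ) := fun z => ⟨fun x => x + z, by fun_prop⟩
  have hTm : ∀ z, MeasurePreserving (T z) volume volume := fun z =>
    measurePreserving_add_right volume z
  have hTc : Continuous T := by
    refine ContinuousMap.continuous_of_continuous_uncurry _ ?_
    simp only [T, Function.uncurry_def, ContinuousMap.coe_mk]
    fun_prop
  have hcont : Continuous fun z => Lp.compMeasurePreserving (T z) (hTm z) (hgm.toLp g) :=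
    continuous_const.compMeasurePreservingLp hTc hTm ENNReal.one_ne_top
  have h1 := (hcont.tendsto 0)
  rw [tendsto_iff_edist_tendsto_0] at h1
  refine h1.congr fun z => ?_
  have hz : ∀ z, (Lp.compMeasurePreserving (T z) (hTm z) (hgm.toLp g) : (Fin p → ℝ) → ℝ)
      =ᵐ[volume] fun x => g (x + z) := fun z =>
    (Lp.coeFn_compMeasurePreserving _ (hTm z)).trans
      ((hTm z).quasiMeasurePreserving.ae_eq_comp hgm.coeFn_toLp)
  rw [Lp.edist_def, eLpNorm_one_eq_lintegral_enorm]
  refine lintegral_congr_ae ?_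
  filter_upwards [hz z, hz 0] with x hx hx0
  simp only [Pi.sub_apply, hx, hx0, add_zero]

end MDCP

end

noncomputable section

namespace MDCP

/-! ### Kernel weights -/

section Kernel

variable {p : ℕ} {w K : ℝ → ℝ}

/-- Only the product kernel is assumed Lipschitz. Freezing all but one coordinate at a point `v₀`
where `w` does not vanish recovers `w` up to a nonzero constant; such a point exists since `w`
integrates to one, and a coordinate to vary exists since `p ≥ 1`. -/
lemma KernelConditions.continuous_w (hwK : KernelConditions p w K) (hp : 1 ≤ p) :
    Continuous w := by
  obtain ⟨L, hL⟩ := hwK.w_lipschitz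
  obtain ⟨v₀, hv₀⟩ : ∃ v, w v ≠ 0 := by
    by_contra! hcon
    have := hwK.w_integral
    simp [hcon] at this
  have hcont := hL.continuous
  let s₀ : Fin p := ⟨0, hp⟩
  have h1 : Continuous fun t : ℝ => ∏ s, w (Function.update (fun _ : Fin p => v₀) s₀ t s) :=
    hcont.comp (continuous_const.update s₀ continuous_id)
  have h2 : (fun t : ℝ => ∏ s, w (Function.update (fun _ : Fin p => v₀) s₀ t s)) =
      fun t => w t * w v₀ ^ (p - 1) := by
    funext t
    rw [← Finset.mul_prod_erase Finset.univ _ (Finset.mem_univ s₀)]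
    simp only [Function.update_self]
    congr 1
    rw [Finset.prod_congr rfl (g := fun _ => w v₀), Finset.prod_const,
      Finset.card_erase_of_mem (Finset.mem_univ _), Finset.card_univ, Fintype.card_fin]
    intro s hs
    rw [Function.update_of_ne (Finset.ne_of_mem_erase hs)]
  rw [h2] at h1
  have hne : w v₀ ^ (p - 1) ≠ 0 := pow_ne_zero _ hv₀
  have h3 := h1.div_const (w v₀ ^ (p - 1))
  simpa [mul_div_assoc, div_self hne] using h3

lemma KernelConditions.exists_bound (hwK : KernelConditions p w K) :
    ∃ B, 0 < B ∧ ∀ v, w v ≤ B := by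
  obtain ⟨B, hB⟩ := hwK.w_bounded
  exact ⟨max B 1, by positivity, fun v => (hB v).trans (le_max_left _ _)⟩

lemma KernelConditions.K_nonneg (hwK : KernelConditions p w K) (z : ℝ) : 0 ≤ K z :=
  hwK.K_mono.le_of_tendsto hwK.K_atBot z

lemma KernelConditions.K_le_one (hwK : KernelConditions p w K) (z : ℝ) : K z ≤ 1 :=
  hwK.K_mono.ge_of_tendsto hwK.K_atTop z

lemma prodWeight_nonneg (hw : ∀ v, 0 ≤ w v) {h : ℝ} (hh : 0 < h) (u v : Fin p → ℝ) :
    0 ≤ prodWeight w h u v :=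
  Finset.prod_nonneg fun _ _ => mul_nonneg (by positivity) (hw _)

lemma prodWeight_le (hw : ∀ v, 0 ≤ w v) {B : ℝ} (hB : ∀ v, w v ≤ B) {h : ℝ} (hh : 0 < h)
    (u v : Fin p → ℝ) : prodWeight w h u v ≤ (B / h) ^ p := by
  calc prodWeight w h u v ≤ ∏ _s : Fin p, (B / h) := by
        refine Finset.prod_le_prod (fun _ _ => mul_nonneg (by positivity) (hw _)) fun s _ => ?_
        rw [one_div, inv_mul_eq_div]
        gcongr
        exact hB _
    _ = (B / h) ^ p := by rw [Finset.prod_const, Finset.card_univ, Fintype.card_fin]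

lemma prodWeight_comm (hw : ∀ v, w (-v) = w v) (h : ℝ) (u v : Fin p → ℝ) :
    prodWeight w h u v = prodWeight w h v u := by
  refine Finset.prod_congr rfl fun s _ => ?_
  rw [← hw, ← neg_div, neg_sub]

lemma measurable_prodWeight (hw : Measurable w) (h : ℝ) :
    Measurable fun z : (Fin p → ℝ) × (Fin p → ℝ) => prodWeight w h z.1 z.2 := by
  unfold prodWeight
  fun_prop

lemma measurable_prodWeight_left (hw : Measurable w) (h : ℝ) (x : Fin p → ℝ) :
    Measurable fun u : Fin p → ℝ => prodWeight w h u x :=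
  (measurable_prodWeight hw h).comp measurable_prodMk_right

lemma lintegral_prod_kernel (hwK : KernelConditions p w K) :
    ∫⁻ v : Fin p → ℝ, ENNReal.ofReal (∏ s, w (v s)) = 1 := by
  rw [← ofReal_integral_eq_lintegral_ofReal]
  · rw [integral_fintype_prod_volume_eq_prod (fun _ => w)]
    simp [hwK.w_integral]
  · exact Integrable.fintype_prod fun _ => hwK.w_integrable
  · exact Eventually.of_forall fun v => Finset.prod_nonneg fun _ _ => hwK.w_nonneg _

lemma lintegral_comp_smul {f : (Fin p → ℝ) → ℝ≥0∞} (hf : Measurable f) {h : ℝ} (hh : 0 < h) :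
    ∫⁻ v, f (h • v) = ENNReal.ofReal ((1 / h) ^ p) * ∫⁻ v, f v := by
  have := Measure.map_addHaar_smul (volume : Measure (Fin p → ℝ)) hh.ne'
  rw [← lintegral_map hf (measurable_const_smul h), this, lintegral_smul_measure, smul_eq_mul]
  simp [abs_of_pos hh]

/-- The substitution `x = u - h v`. -/
lemma lintegral_prodWeight_mul (hw : Measurable w) {h : ℝ} (hh : 0 < h)
    (u : Fin p → ℝ) {G : (Fin p → ℝ) → ℝ≥0∞} (hG : Measurable G) :
    ∫⁻ x, ENNReal.ofReal (prodWeight w h u x) * G x =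
      ∫⁻ v : Fin p → ℝ, ENNReal.ofReal (∏ s, w (v s)) * G (u - h • v) := by
  have hm : Measurable fun z : Fin p → ℝ => ENNReal.ofReal (∏ s, w (z s / h)) * G (u - z) := by
    refine Measurable.mul ?_ (hG.comp (by fun_prop))
    fun_prop
  have h1 := lintegral_comp_smul hm hh
  simp only [Pi.smul_apply, smul_eq_mul, mul_div_cancel_left₀ _ hh.ne'] at h1
  rw [h1, ← lintegral_const_mul _ hm, ← lintegral_sub_left_eq_self _ u]
  refine lintegral_congr fun z => ?_
  rw [← mul_assoc, ← ENNReal.ofReal_mul (by positivity)]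
  congr 3
  · simp [prodWeight, Finset.prod_mul_distrib]

lemma lintegral_prodWeight (hwK : KernelConditions p w K) (hp : 1 ≤ p) {h : ℝ} (hh : 0 < h)
    (u : Fin p → ℝ) : ∫⁻ x, ENNReal.ofReal (prodWeight w h u x) = 1 := by
  have := lintegral_prodWeight_mul (hwK.continuous_w hp).measurable hh u
    (G := fun _ => 1) measurable_const
  simpa [lintegral_prod_kernel hwK] using this

lemma integrable_prodWeight_left (hwK : KernelConditions p w K) (hp : 1 ≤ p) {h : ℝ}
    (hh : 0 < h) (x : Fin p → ℝ) : Integrable fun u => prodWeight w h u x := by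
  have hm : Measurable fun u : Fin p → ℝ => prodWeight w h u x :=
    measurable_prodWeight_left (hwK.continuous_w hp).measurable h x
  refine ⟨hm.aestronglyMeasurable, ?_⟩
  rw [hasFiniteIntegral_iff_ofReal
    (Eventually.of_forall fun u => prodWeight_nonneg hwK.w_nonneg hh u x)]
  simp_rw [prodWeight_comm hwK.w_symm h _ x]
  rw [lintegral_prodWeight hwK hp hh]
  exact ENNReal.one_lt_top

lemma integral_prodWeight_left (hwK : KernelConditions p w K) (hp : 1 ≤ p) {h : ℝ}
    (hh : 0 < h) (x : Fin p → ℝ) : ∫ u, prodWeight w h u x = 1 := by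
  rw [integral_eq_lintegral_of_nonneg_ae
    (Eventually.of_forall fun u => prodWeight_nonneg hwK.w_nonneg hh u x)
    (integrable_prodWeight_left hwK hp hh x).1]
  simp_rw [prodWeight_comm hwK.w_symm h _ x]
  rw [lintegral_prodWeight hwK hp hh, ENNReal.toReal_one]

/-- The kernel weights are an approximate identity in `L¹`. -/
lemma tendsto_lintegral_smoothing_sub (hwK : KernelConditions p w K) (hp : 1 ≤ p) {h : ℕ → ℝ}
    (hh : ∀ n, 0 < h n) (hh0 : Tendsto h atTop (𝓝 0)) {g : (Fin p → ℝ) → ℝ}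
    (hgm : Measurable g) (hg : Integrable g) :
    Tendsto (fun n => ∫⁻ x, ‖(∫ u, prodWeight w (h n) u x * g u) - g x‖ₑ) atTop (𝓝 0) := by
  have hwm := (hwK.continuous_w hp).measurable
  obtain ⟨B, -, hB⟩ := hwK.exists_bound
  have hWm : Measurable fun v : Fin p → ℝ => ENNReal.ofReal (∏ s, w (v s)) := by fun_prop
  have hm2 : ∀ n, Measurable fun z : (Fin p → ℝ) × (Fin p → ℝ) =>
      ‖g (z.2 - h n • z.1) - g z.2‖ₑ := fun n =>
    ((hgm.comp (by fun_prop)).sub (hgm.comp (by fun_prop))).enorm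
  -- The kernel has mass one, so `g x` can be taken inside the integral; Tonelli then bounds the
  -- error by a kernel average of L¹ translation errors.
  have hle : ∀ n, ∫⁻ x, ‖(∫ u, prodWeight w (h n) u x * g u) - g x‖ₑ ≤
      ∫⁻ v : Fin p → ℝ, ENNReal.ofReal (∏ s, w (v s)) *
        ∫⁻ x, ‖g (x - h n • v) - g x‖ₑ := by
    intro n
    calc ∫⁻ x, ‖(∫ u, prodWeight w (h n) u x * g u) - g x‖ₑ
        ≤ ∫⁻ x, ∫⁻ v : Fin p → ℝ,
            ENNReal.ofReal (∏ s, w (v s)) * ‖g (x - h n • v) - g x‖ₑ := by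
          refine lintegral_mono fun x => ?_
          have hWx : Measurable fun u : Fin p → ℝ => prodWeight w (h n) u x :=
            measurable_prodWeight_left hwm (h n) x
          have hi : Integrable fun u => prodWeight w (h n) u x * g u := by
            refine hg.bdd_mul hWx.aestronglyMeasurable (c := (B / h n) ^ p)
              (Eventually.of_forall fun u => ?_)
            rw [Real.norm_of_nonneg (prodWeight_nonneg hwK.w_nonneg (hh n) _ _)]
            exact prodWeight_le hwK.w_nonneg hB (hh n) _ _
          have h1 : (∫ u, prodWeight w (h n) u x * g u) - g x =
              ∫ u, prodWeight w (h n) u x * (g u - g x) := by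
            simp_rw [mul_sub]
            rw [integral_sub hi ((integrable_prodWeight_left hwK hp (hh n) x).mul_const _),
              integral_mul_const, integral_prodWeight_left hwK hp (hh n), one_mul]
          rw [h1]
          refine (enorm_integral_le_lintegral_enorm _).trans ?_
          rw [← lintegral_prodWeight_mul hwm (hh n) x
            (G := fun u => ‖g u - g x‖ₑ) (by fun_prop)]
          refine lintegral_mono fun u => ?_
          rw [enorm_mul, Real.enorm_of_nonneg (prodWeight_nonneg hwK.w_nonneg (hh n) _ _),
            prodWeight_comm hwK.w_symm]
      _ = _ := by
          rw [lintegral_lintegral_swap]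
          · refine lintegral_congr fun v => ?_
            rw [lintegral_const_mul]
            exact (hm2 n).comp measurable_prodMk_left
          · refine Measurable.aemeasurable ?_
            exact (hWm.comp measurable_snd).mul ((hm2 n).comp measurable_swap)
  refine tendsto_of_tendsto_of_tendsto_of_le_of_le tendsto_const_nhds ?_
    (fun _ => zero_le) hle
  have h0 : ∫⁻ _v : Fin p → ℝ, (0 : ℝ≥0∞) = 0 := lintegral_zero
  rw [← h0]
  -- For fixed `v` the translation error tends to zero, and it never exceeds twice the L¹ norm of
  -- `g`.
  refine tendsto_lintegral_filter_of_dominated_convergence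
    (fun v => ENNReal.ofReal (∏ s, w (v s)) * (2 * ∫⁻ x, ‖g x‖ₑ)) ?_ ?_ ?_ ?_
  · exact Eventually.of_forall fun n => hWm.mul (hm2 n).lintegral_prod_right'
  · refine Eventually.of_forall fun n => Eventually.of_forall fun v => ?_
    gcongr
    calc ∫⁻ x, ‖g (x - h n • v) - g x‖ₑ ≤ ∫⁻ x, (‖g (x - h n • v)‖ₑ + ‖g x‖ₑ) :=
          lintegral_mono fun x => enorm_sub_le
      _ = 2 * ∫⁻ x, ‖g x‖ₑ := by
          rw [lintegral_add_right _ hgm.enorm,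
            lintegral_sub_right_eq_self (fun x => ‖g x‖ₑ), two_mul]
  · rw [lintegral_mul_const _ hWm, lintegral_prod_kernel hwK, one_mul]
    exact ENNReal.mul_ne_top ENNReal.ofNat_ne_top hg.2.ne
  · refine Eventually.of_forall fun v => ?_
    have hz : Tendsto (fun n => -(h n • v)) atTop (𝓝 0) := by
      have := (hh0.smul_const v).neg
      simpa using this
    have := (tendsto_lintegral_enorm_translate_sub hg).comp hz
    have h2 := ENNReal.Tendsto.const_mul (a := ENNReal.ofReal (∏ s, w (v s))) this
      (Or.inr ENNReal.ofReal_ne_top)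
    simpa [Function.comp_def, ← sub_eq_add_neg] using h2

/-- Kernel averages of a function vanishing at the centre tend to zero, on average over the
centre. -/
lemma tendsto_lintegral_prodWeight_mul (hwK : KernelConditions p w K) (hp : 1 ≤ p) {h : ℕ → ℝ}
    (hh : ∀ n, 0 < h n) (hh0 : Tendsto h atTop (𝓝 0)) (μ : Measure (Fin p → ℝ))
    [IsFiniteMeasure μ] {H : (Fin p → ℝ) → (Fin p → ℝ) → ℝ≥0∞}
    (hHm : Measurable (Function.uncurry H)) (hH1 : ∀ u x, H u x ≤ 1)
    (hH : ∀ᵐ u ∂μ, Tendsto (H u) (𝓝 u) (𝓝 0)) :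
    Tendsto (fun n => ∫⁻ u, (∫⁻ x, ENNReal.ofReal (prodWeight w (h n) u x) * H u x) ∂μ)
      atTop (𝓝 0) := by
  have hwm := (hwK.continuous_w hp).measurable
  have hWm : Measurable fun v : Fin p → ℝ => ENNReal.ofReal (∏ s, w (v s)) := by fun_prop
  have h0 : ∫⁻ _u : Fin p → ℝ, (0 : ℝ≥0∞) ∂μ = 0 := lintegral_zero
  rw [← h0]
  -- Dominated convergence is used twice: here in the centre `u`, with bound `1` because the kernel
  -- has mass one, and below in the rescaled displacement `v`.
  refine tendsto_lintegral_filter_of_dominated_convergence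
    (fun _ => 1) ?_ ?_ ?_ ?_
  · refine Eventually.of_forall fun n => Measurable.lintegral_prod_right'
      (f := fun z : (Fin p → ℝ) × (Fin p → ℝ) =>
        ENNReal.ofReal (prodWeight w (h n) z.1 z.2) * H z.1 z.2) ?_
    exact (measurable_prodWeight hwm (h n)).ennreal_ofReal.mul hHm
  · refine Eventually.of_forall fun n => Eventually.of_forall fun u => ?_
    rw [← lintegral_prodWeight hwK hp (hh n) u]
    exact lintegral_mono fun x => mul_le_of_le_one_right' (hH1 u x)
  · simp
  · filter_upwards [hH] with u hu
    have hHu : Measurable (H u) := hHm.comp measurable_prodMk_left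
    simp_rw [lintegral_prodWeight_mul hwm (hh _) u hHu]
    have h0 : ∫⁻ _v : Fin p → ℝ, (0 : ℝ≥0∞) = 0 := lintegral_zero
    rw [← h0]
    refine tendsto_lintegral_filter_of_dominated_convergence
      (fun v => ENNReal.ofReal (∏ s, w (v s))) ?_ ?_ ?_ ?_
    · exact Eventually.of_forall fun n => hWm.mul (hHu.comp (by fun_prop))
    · exact Eventually.of_forall fun n => Eventually.of_forall fun v =>
        mul_le_of_le_one_right' (hH1 _ _)
    · rw [lintegral_prod_kernel hwK]; exact ENNReal.one_ne_top
    · refine Eventually.of_forall fun v => ?_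
      have hz : Tendsto (fun n => u - h n • v) atTop (𝓝 u) := by
        have := (hh0.smul_const v).const_sub u
        simpa using this
      have h2 := ENNReal.Tendsto.const_mul (a := ENNReal.ofReal (∏ s, w (v s))) (hu.comp hz)
        (Or.inr ENNReal.ofReal_ne_top)
      simpa [Function.comp_def] using h2

end Kernel

end MDCP

end

noncomputable section

namespace MDCP

/-! ### Ergodic averages -/

/-- The first moment in terms of the second. -/
lemma lintegral_enorm_le_of_integral_sq {α : Type*} [MeasurableSpace α] {μ : Measure α}
    [IsProbabilityMeasure μ] {f : α → ℝ} (hf : MemLp f 2 μ) {η v : ℝ} (hη : 0 < η)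
    (hv : ∫ x, f x ^ 2 ∂μ ≤ v) : ∫⁻ x, ‖f x‖ₑ ∂μ ≤ ENNReal.ofReal (η + v / η) := by
  -- The bound rests on |f| ≤ η + f²/η; the free `η` is later balanced against the variance.
  have h1 : Integrable (fun x => η + f x ^ 2 / η) μ :=
    (integrable_const η).add (hf.integrable_sq.div_const η)
  calc ∫⁻ x, ‖f x‖ₑ ∂μ ≤ ∫⁻ x, ENNReal.ofReal (η + f x ^ 2 / η) ∂μ := by
        refine lintegral_mono fun x => ?_
        rw [Real.enorm_eq_ofReal_abs]
        refine ENNReal.ofReal_le_ofReal ?_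
        rw [← sub_nonneg, show η + f x ^ 2 / η - |f x| = (η ^ 2 + |f x| ^ 2 - η * |f x|) / η by
          rw [sq_abs]; field_simp]
        refine div_nonneg ?_ hη.le
        nlinarith [sq_nonneg (η - |f x|), abs_nonneg (f x)]
    _ = ENNReal.ofReal (∫ x, (η + f x ^ 2 / η) ∂μ) := by
        rw [ofReal_integral_eq_lintegral_ofReal h1 (Eventually.of_forall fun x => by positivity)]
    _ ≤ _ := by
        refine ENNReal.ofReal_le_ofReal ?_
        rw [integral_add (integrable_const η) (hf.integrable_sq.div_const η), integral_div]
        simp only [integral_const, probReal_univ, smul_eq_mul, one_mul]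
        gcongr

section Averages

variable {E X : Type*} [MeasurableSpace E] [MeasurableSpace X]

/-- The deviation at `(e, x)` of the average of `u (·, x)` along the first `N` of the maps `T i`
from its mean. -/
def avgDev (π : Measure E) (T : ℕ → E → E) (u : E × X → ℝ) (N : ℕ) (z : E × X) : ℝ :=
  (1 / (N : ℝ)) * ∑ i ∈ Finset.range N, u (T i z.1, z.2) - ∫ e, u (e, z.2) ∂π

variable {π : Measure E} {lam : Measure X} {T : ℕ → E → E}

/-- Equality holds only almost everywhere: additivity of the mean requires integrable sections,
which Fubini provides for almost every parameter. -/
lemma avgDev_add [IsProbabilityMeasure π] [IsFiniteMeasure lam] {u v : E × X → ℝ}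
    (hu : Integrable u (π.prod lam)) (hv : Integrable v (π.prod lam)) (N : ℕ) :
    avgDev π T (u + v) N =ᵐ[π.prod lam] fun z => avgDev π T u N z + avgDev π T v N z := by
  have h := (Measure.quasiMeasurePreserving_snd (μ := π) (ν := lam)).ae
    (hu.prod_left_ae.and hv.prod_left_ae)
  filter_upwards [h] with z hz
  simp only [avgDev, Pi.add_apply, Finset.sum_add_distrib]
  rw [integral_add hz.1 hz.2]
  ring

/-- Each map preserves the measure, so the average and the mean are both L¹ contractions. The
uniformity in `N` is what makes approximation arguments possible. -/
lemma lintegral_avgDev_le [IsProbabilityMeasure π] [IsFiniteMeasure lam]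
    (hT : ∀ i, MeasurePreserving (T i) π π) {u : E × X → ℝ}
    (hu : Integrable u (π.prod lam)) (N : ℕ) :
    ∫⁻ z, ‖avgDev π T u N z‖ₑ ∂(π.prod lam) ≤ 2 * ∫⁻ z, ‖u z‖ₑ ∂(π.prod lam) := by
  have hTp : ∀ i, MeasurePreserving (Prod.map (T i) (id : X → X)) (π.prod lam) (π.prod lam) :=
    fun i => (hT i).prod (MeasurePreserving.id lam)
  have hTu : ∀ i, ∫⁻ z : E × X, ‖u (T i z.1, z.2)‖ₑ ∂(π.prod lam) =
      ∫⁻ z, ‖u z‖ₑ ∂(π.prod lam) := by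
    intro i
    have h := lintegral_map' (f := fun z => ‖u z‖ₑ) (g := Prod.map (T i) (id : X → X))
      (μ := π.prod lam) (by rw [(hTp i).map_eq]; exact hu.1.enorm) (hTp i).measurable.aemeasurable
    rw [(hTp i).map_eq] at h
    exact h.symm
  have hTm : ∀ i, AEStronglyMeasurable (fun z : E × X => u (T i z.1, z.2)) (π.prod lam) :=
    fun i => hu.1.comp_measurePreserving (hTp i)
  have h1 : ∫⁻ z, ‖(1 / (N : ℝ)) * ∑ i ∈ Finset.range N, u (T i z.1, z.2)‖ₑ ∂(π.prod lam) ≤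
      ∫⁻ z, ‖u z‖ₑ ∂(π.prod lam) := by
    rcases Nat.eq_zero_or_pos N with rfl | hN
    · simp
    calc ∫⁻ z, ‖(1 / (N : ℝ)) * ∑ i ∈ Finset.range N, u (T i z.1, z.2)‖ₑ ∂(π.prod lam)
        ≤ ∫⁻ z, ‖(1 / (N : ℝ))‖ₑ * ∑ i ∈ Finset.range N, ‖u (T i z.1, z.2)‖ₑ ∂(π.prod lam) := by
          refine lintegral_mono fun z => ?_
          rw [enorm_mul]
          gcongr
          exact enorm_sum_le _ _
      _ = ‖(1 / (N : ℝ))‖ₑ * (N * ∫⁻ z, ‖u z‖ₑ ∂(π.prod lam)) := by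
          rw [lintegral_const_mul' _ _ enorm_ne_top, lintegral_finsetSum' _ fun i _ =>
            (hTm i).enorm]
          simp [hTu]
      _ = _ := by
          rw [← mul_assoc, Real.enorm_of_nonneg (by positivity), one_div,
            ENNReal.ofReal_inv_of_pos (by positivity), ENNReal.ofReal_natCast,
            ENNReal.inv_mul_cancel (by simpa using hN.ne') (ENNReal.natCast_ne_top N), one_mul]
  have h2 : ∫⁻ z : E × X, ‖∫ e, u (e, z.2) ∂π‖ₑ ∂(π.prod lam) ≤ ∫⁻ z, ‖u z‖ₑ ∂(π.prod lam) := by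
    have hm : AEStronglyMeasurable (fun x => ∫ e, u (e, x) ∂π) lam :=
      hu.1.prod_swap.integral_prod_right'
    rw [lintegral_prod _ (by exact hm.comp_snd.enorm)]
    simp only [lintegral_const, measure_univ, mul_one]
    rw [lintegral_prod_symm _ hu.1.enorm]
    exact lintegral_mono fun x => enorm_integral_le_lintegral_enorm _
  calc ∫⁻ z, ‖avgDev π T u N z‖ₑ ∂(π.prod lam)
      ≤ ∫⁻ z, (‖(1 / (N : ℝ)) * ∑ i ∈ Finset.range N, u (T i z.1, z.2)‖ₑ +
          ‖∫ e, u (e, z.2) ∂π‖ₑ) ∂(π.prod lam) := lintegral_mono fun z => enorm_sub_le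
    _ ≤ _ := by
        rw [lintegral_add_left' , two_mul]
        · gcongr
        · exact ((Finset.aestronglyMeasurable_fun_sum _ fun i _ => hTm i).const_mul _).enorm

/-- The averages of `u` converge to its mean in `L¹`. -/
def AvgTendsto (π : Measure E) (lam : Measure X) (T : ℕ → E → E) (u : E × X → ℝ) : Prop :=
  Tendsto (fun N => ∫⁻ z, ‖avgDev π T u N z‖ₑ ∂(π.prod lam)) atTop (𝓝 0)

lemma AvgTendsto.const_mul (c : ℝ) {u : E × X → ℝ} (hu : AvgTendsto π lam T u) :
    AvgTendsto π lam T fun z => c * u z := by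
  have h : ∀ N z, avgDev π T (fun z => c * u z) N z = c * avgDev π T u N z := by
    intro N z
    simp only [avgDev, integral_const_mul, ← Finset.mul_sum]
    ring
  unfold AvgTendsto
  simp_rw [h, enorm_mul, lintegral_const_mul' _ _ enorm_ne_top]
  simpa using ENNReal.Tendsto.const_mul (a := ‖c‖ₑ) hu (Or.inr enorm_ne_top)

lemma avgTendsto_const_one [IsProbabilityMeasure π] : AvgTendsto π lam T fun _ => (1 : ℝ) := by
  refine tendsto_const_nhds.congr' ?_
  -- At `N = 0` the average is `0` by the convention on division, so the deviation is not zero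
  -- there.
  filter_upwards [eventually_gt_atTop 0] with N hN
  have : (N : ℝ) ≠ 0 := by exact_mod_cast hN.ne'
  simp [avgDev, this]

variable [IsProbabilityMeasure π] [IsFiniteMeasure lam]

lemma aestronglyMeasurable_avgDev (hT : ∀ i, MeasurePreserving (T i) π π) {u : E × X → ℝ}
    (hu : Integrable u (π.prod lam)) (N : ℕ) :
    AEStronglyMeasurable (avgDev π T u N) (π.prod lam) := by
  have hTm : ∀ i, AEStronglyMeasurable (fun z : E × X => u (T i z.1, z.2)) (π.prod lam) :=
    fun i => hu.1.comp_measurePreserving ((hT i).prod (MeasurePreserving.id lam))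
  have hm : AEStronglyMeasurable (fun x => ∫ e, u (e, x) ∂π) lam :=
    hu.1.prod_swap.integral_prod_right'
  exact ((Finset.aestronglyMeasurable_fun_sum _ fun i _ => hTm i).const_mul _).sub hm.comp_snd

lemma lintegral_avgDev_add_le (hT : ∀ i, MeasurePreserving (T i) π π) {u v : E × X → ℝ}
    (hu : Integrable u (π.prod lam)) (hv : Integrable v (π.prod lam)) (N : ℕ) :
    ∫⁻ z, ‖avgDev π T (u + v) N z‖ₑ ∂(π.prod lam) ≤
      ∫⁻ z, ‖avgDev π T u N z‖ₑ ∂(π.prod lam) + ∫⁻ z, ‖avgDev π T v N z‖ₑ ∂(π.prod lam) := by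
  rw [← lintegral_add_left' (aestronglyMeasurable_avgDev hT hu N).enorm]
  refine lintegral_mono_ae ?_
  filter_upwards [avgDev_add (T := T) hu hv N] with z hz
  rw [hz]; exact enorm_add_le _ _

lemma lintegral_avgDev_le_add (hT : ∀ i, MeasurePreserving (T i) π π) {u v : E × X → ℝ}
    (hu : Integrable u (π.prod lam)) (hv : Integrable v (π.prod lam)) (N : ℕ) :
    ∫⁻ z, ‖avgDev π T v N z‖ₑ ∂(π.prod lam) ≤
      ∫⁻ z, ‖avgDev π T u N z‖ₑ ∂(π.prod lam) + 2 * ∫⁻ z, ‖v z - u z‖ₑ ∂(π.prod lam) := by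
  have h := lintegral_avgDev_add_le hT hu (hv.sub hu) N
  rw [add_sub_cancel] at h
  exact h.trans (add_le_add le_rfl (lintegral_avgDev_le hT (hv.sub hu) N))

/-- The functions whose averages converge are closed in L¹, because replacing `u` by `v` changes
every deviation by at most twice the L¹ distance. -/
lemma AvgTendsto.of_approx (hT : ∀ i, MeasurePreserving (T i) π π) {u : E × X → ℝ}
    (hu : Integrable u (π.prod lam))
    (h : ∀ ε : ℝ≥0∞, 0 < ε → ∃ v, Integrable v (π.prod lam) ∧ AvgTendsto π lam T v ∧
      ∫⁻ z, ‖u z - v z‖ₑ ∂(π.prod lam) ≤ ε) : AvgTendsto π lam T u := by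
  rw [AvgTendsto, ENNReal.tendsto_nhds_zero]
  intro ε hε
  have hε3 : 0 < ε / 3 := ENNReal.div_pos hε.ne' ENNReal.ofNat_ne_top
  obtain ⟨v, hv, hvT, huv⟩ := h (ε / 3) hε3
  filter_upwards [ENNReal.tendsto_nhds_zero.1 hvT (ε / 3) hε3] with N hN
  calc _ ≤ _ := lintegral_avgDev_le_add hT hv hu N
    _ ≤ ε / 3 + 2 * (ε / 3) := by gcongr
    _ = ε / 3 + ε / 3 + ε / 3 := by ring
    _ = ε := ENNReal.add_thirds ε

lemma AvgTendsto.add (hT : ∀ i, MeasurePreserving (T i) π π) {u v : E × X → ℝ}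
    (hu : Integrable u (π.prod lam)) (hv : Integrable v (π.prod lam))
    (hu' : AvgTendsto π lam T u) (hv' : AvgTendsto π lam T v) : AvgTendsto π lam T (u + v) := by
  refine tendsto_of_tendsto_of_tendsto_of_le_of_le tendsto_const_nhds ?_ (fun _ => zero_le)
    fun N => lintegral_avgDev_add_le hT hu hv N
  simpa using Tendsto.add hu' hv'

/-- A π-λ argument: complements and finite disjoint unions follow by linearity, countable disjoint
unions because the finite ones approximate them in L¹. -/
lemma avgTendsto_indicator_of_generateFrom (hT : ∀ i, MeasurePreserving (T i) π π)
    {C : Set (Set (E × X))} (hgen : Prod.instMeasurableSpace = MeasurableSpace.generateFrom C)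
    (hpi : IsPiSystem C)
    (hC : ∀ s ∈ C, AvgTendsto π lam T (s.indicator fun _ => (1 : ℝ))) (s : Set (E × X))
    (hs : MeasurableSet s) : AvgTendsto π lam T (s.indicator fun _ => (1 : ℝ)) := by
  have hint : ∀ s : Set (E × X), MeasurableSet s →
      Integrable (s.indicator fun _ => (1 : ℝ)) (π.prod lam) := fun s hs =>
    (integrable_const (1 : ℝ)).indicator hs
  induction s, hs using MeasurableSpace.induction_on_inter hgen hpi with
  | empty => simp [AvgTendsto, avgDev]
  | basic s hs => exact hC s hs
  | compl s hs ih =>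
    have h : (sᶜ.indicator fun _ => (1 : ℝ)) =
        (fun _ => (1 : ℝ)) + fun z => (-1) * s.indicator (fun _ => (1 : ℝ)) z := by
      funext z
      by_cases hz : z ∈ s <;> simp [hz]
    rw [h]
    exact avgTendsto_const_one.add hT (integrable_const _) ((hint s hs).const_mul _)
      (ih.const_mul _)
  | iUnion f hd hf ih =>
    have hfin : ∀ n, AvgTendsto π lam T
        ((⋃ i ∈ Finset.range n, f i).indicator fun _ => (1 : ℝ)) := by
      intro n
      induction n with
      | zero => simp [AvgTendsto, avgDev]
      | succ n hn =>
        have hdis : Disjoint (⋃ i ∈ Finset.range n, f i) (f n) := by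
          rw [Set.disjoint_iUnion₂_left]
          intro i hi
          exact hd (Finset.mem_range.1 hi).ne
        have h : ((⋃ i ∈ Finset.range (n + 1), f i).indicator fun _ => (1 : ℝ)) =
            ((⋃ i ∈ Finset.range n, f i).indicator fun _ => (1 : ℝ)) +
              (f n).indicator fun _ => (1 : ℝ) := by
          rw [Finset.range_add_one, Finset.set_biUnion_insert, Set.union_comm,
            Set.indicator_union_of_disjoint hdis]
          rfl
        rw [h]
        exact hn.add hT (hint _ (Finset.measurableSet_biUnion _ fun i _ => hf i))
          (hint _ (hf n)) (ih n)
    refine AvgTendsto.of_approx hT (hint _ (MeasurableSet.iUnion hf)) fun ε hε => ?_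
    have hsum : ∑' i, (π.prod lam) (f i) ≠ ∞ := by
      rw [← measure_iUnion hd hf]; exact measure_ne_top _ _
    obtain ⟨n, hn⟩ := ((ENNReal.tendsto_nhds_zero.1
      (ENNReal.tendsto_sum_nat_add (fun i => (π.prod lam) (f i)) hsum)) ε hε).exists
    refine ⟨_, hint _ (Finset.measurableSet_biUnion (Finset.range n) fun i _ => hf i),
      hfin n, ?_⟩
    have hsub : ∀ z, ‖(⋃ i, f i).indicator (fun _ => (1 : ℝ)) z -
        (⋃ i ∈ Finset.range n, f i).indicator (fun _ => (1 : ℝ)) z‖ₑ ≤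
        (⋃ i, f (i + n)).indicator 1 z := by
      intro z
      by_cases h1 : z ∈ ⋃ i ∈ Finset.range n, f i
      · have h2 : z ∈ ⋃ i, f i := by
          simp only [Set.mem_iUnion] at h1 ⊢
          obtain ⟨i, -, hi⟩ := h1; exact ⟨i, hi⟩
        rw [Set.indicator_of_mem h2, Set.indicator_of_mem h1]
        simp
      · by_cases h2 : z ∈ ⋃ i, f i
        · have h3 : z ∈ ⋃ i, f (i + n) := by
            simp only [Set.mem_iUnion, Finset.mem_range, not_exists] at h1 h2 ⊢
            obtain ⟨i, hi⟩ := h2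
            have hin : n ≤ i := by
              by_contra hlt
              exact h1 i (not_le.1 hlt) hi
            exact ⟨i - n, by rwa [Nat.sub_add_cancel hin]⟩
          rw [Set.indicator_of_mem h2, Set.indicator_of_notMem h1, Set.indicator_of_mem h3]
          simp
        · rw [Set.indicator_of_notMem h2, Set.indicator_of_notMem h1]
          simp
    calc _ ≤ ∫⁻ z, (⋃ i, f (i + n)).indicator 1 z ∂(π.prod lam) := lintegral_mono hsub
      _ = (π.prod lam) (⋃ i, f (i + n)) :=
          lintegral_indicator_one (MeasurableSet.iUnion fun i => hf _)
      _ ≤ ∑' i, (π.prod lam) (f (i + n)) := measure_iUnion_le _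
      _ ≤ ε := hn

/-- Convergence of averages extends from a generating `π`-system to all integrable functions. -/
lemma avgTendsto_of_generateFrom (hT : ∀ i, MeasurePreserving (T i) π π)
    {C : Set (Set (E × X))} (hgen : Prod.instMeasurableSpace = MeasurableSpace.generateFrom C)
    (hpi : IsPiSystem C)
    (hC : ∀ s ∈ C, AvgTendsto π lam T (s.indicator fun _ => (1 : ℝ)))
    {u : E × X → ℝ} (hu : Integrable u (π.prod lam)) : AvgTendsto π lam T u := by
  refine Integrable.induction (fun u => AvgTendsto π lam T u) ?_ ?_ ?_ ?_ hu
  · intro c s hs _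
    have h : (s.indicator fun _ => c) = fun z => c * s.indicator (fun _ => (1 : ℝ)) z := by
      funext z
      by_cases hz : z ∈ s <;> simp [hz]
    rw [h]
    exact (avgTendsto_indicator_of_generateFrom hT hgen hpi hC s hs).const_mul c
  · intro f g _ hf hg hf' hg'
    exact hf'.add hT hf hg hg'
  -- Closedness in L¹ is exactly the approximation lemma `AvgTendsto.of_approx`.
  · refine isClosed_iff_clusterPt.2 fun f hf => ?_
    rw [← mem_closure_iff_clusterPt, EMetric.mem_closure_iff] at hf
    refine AvgTendsto.of_approx hT (L1.integrable_coeFn f) fun ε hε => ?_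
    obtain ⟨g, hg, hfg⟩ := hf ε hε
    refine ⟨g, L1.integrable_coeFn g, hg, ?_⟩
    rw [Lp.edist_def, eLpNorm_one_eq_lintegral_enorm] at hfg
    exact hfg.le
  · intro f g hfg hf hf'
    refine AvgTendsto.of_approx hT (hf.congr hfg) fun ε hε => ⟨f, hf, hf', ?_⟩
    have : ∫⁻ z, ‖(g - f) z‖ₑ ∂(π.prod lam) = 0 := by
      rw [lintegral_eq_zero_iff' ((hf.congr hfg).sub hf).1.enorm]
      filter_upwards [hfg] with z hz
      simp [hz]
    exact this.le.trans zero_le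

end Averages

/-! ### Shifts of sequences -/

section Shift

variable {S : Type*} [MeasurableSpace S]

/-- The shift of a two-sided sequence by `i` steps. -/
def shiftSeq (i : ℤ) (y : ℤ → S) : ℤ → S := fun s => y (s + i)

lemma measurable_shiftSeq (i : ℤ) : Measurable (shiftSeq (S := S) i) :=
  measurable_pi_lambda _ fun s => measurable_pi_apply (s + i)

lemma measurePreserving_shiftSeq (ν : Measure S) [IsProbabilityMeasure ν] (i : ℤ) :
    MeasurePreserving (shiftSeq i) (Measure.infinitePi fun _ : ℤ => ν)
      (Measure.infinitePi fun _ : ℤ => ν) :=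
  ⟨measurable_shiftSeq i, Measure.map_infinitePi_infinitePi_of_inj
    (P := fun _ : ℤ => ν) (add_left_injective i)⟩

/-- Shifts of a cylinder set by sufficiently different amounts involve disjoint coordinates and are
independent, so the centred indicators are orthogonal at large lags and the average has variance
O(1/N). -/
lemma avgTendsto_cylinder {X : Type*} [MeasurableSpace X] (ν : Measure S)
    [IsProbabilityMeasure ν] (lam : Measure X) [IsFiniteMeasure lam] (s : Finset ℤ)
    (t : ℤ → Set S) (ht : ∀ k, MeasurableSet (t k)) (b : Set X) :
    AvgTendsto (Measure.infinitePi fun _ : ℤ => ν) lam (fun i : ℕ => shiftSeq (i : ℤ))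
      ((((s : Set ℤ).pi t) ×ˢ b).indicator fun _ => (1 : ℝ)) := by
  set π := Measure.infinitePi fun _ : ℤ => ν with hπ
  set A : Set (ℤ → S) := (s : Set ℤ).pi t with hA
  have hAm : MeasurableSet A := MeasurableSet.pi s.countable_toSet fun k _ => ht k
  set I : (ℤ → S) → ℝ := A.indicator fun _ => (1 : ℝ) with hI
  have hIm : Measurable I := measurable_const.indicator hAm
  set c := ∫ e, I e ∂π with hc
  set a : ℕ → (ℤ → S) → ℝ := fun i e => I (shiftSeq i e) - c with ha
  have hI01 : ∀ e, 0 ≤ I e ∧ I e ≤ 1 := fun e => by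
    by_cases he : e ∈ A <;> simp [hI, he]
  have hIint : Integrable I π := (integrable_const (1 : ℝ)).indicator hAm
  have hc01 : 0 ≤ c ∧ c ≤ 1 := by
    refine ⟨integral_nonneg fun e => (hI01 e).1, ?_⟩
    have := integral_mono hIint (integrable_const (1 : ℝ)) fun e => (hI01 e).2
    simpa using this
  have ham : ∀ i, Measurable (a i) := fun i =>
    (hIm.comp (measurable_shiftSeq _)).sub measurable_const
  have habs : ∀ i e, |a i e| ≤ 1 := fun i e => by
    rw [abs_le]
    have := hI01 (shiftSeq i e)
    constructor <;> simp only [ha] <;> linarith [hc01.1, hc01.2]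
  have hmem : ∀ i, MemLp (a i) 2 π := fun i =>
    MemLp.of_bound (ham i).aestronglyMeasurable 1 (Eventually.of_forall (habs i))
  have hmean : ∀ i, ∫ e, a i e ∂π = 0 := by
    intro i
    have h1 : ∫ e, I (shiftSeq i e) ∂π = c :=
      (measurePreserving_shiftSeq ν i).integral_comp' (f := ⟨⟨shiftSeq i, shiftSeq (-i),
        fun e => by funext k; simp [shiftSeq], fun e => by funext k; simp [shiftSeq]⟩,
        measurable_shiftSeq _, measurable_shiftSeq _⟩) I
    have h2 : Integrable (fun e => I (shiftSeq i e)) π :=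
      (measurePreserving_shiftSeq ν i).integrable_comp_of_integrable hIint
    simp only [ha]
    rw [integral_sub h2 (integrable_const _), h1]
    simp
  -- The base `s` lies in an interval of length `q - 1` centred at `0`, so its translates by amounts
  -- at least `q` apart are disjoint.
  set q := 2 * s.sup Int.natAbs + 1 with hq
  have hdep : ∀ i : ℕ, ∃ φ : ((s.map (addRightEmbedding (i : ℤ))) → S) → ℝ, Measurable φ ∧
      ∀ e, a i e = φ fun k => e k := by
    intro i
    refine ⟨fun e => ({e | ∀ k : s, e ⟨k + i, by simp⟩ ∈ t k}.indicator fun _ => (1 : ℝ)) e - c,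
      ?_, fun e => ?_⟩
    · refine (measurable_const.indicator ?_).sub measurable_const
      rw [Set.ofPred_forall]
      exact MeasurableSet.iInter fun k => measurable_pi_apply _ (ht k)
    · classical
      simp only [ha, hI, hA, Set.indicator_apply, Set.mem_pi, Finset.mem_coe, shiftSeq,
        Set.mem_ofPred_eq, Subtype.forall]
  have hindep : iIndepFun (fun (k : ℤ) (e : ℤ → S) => e k) π := by
    have := iIndepFun_infinitePi (P := fun _ : ℤ => ν) (X := fun _ => (id : S → S))
      (fun _ => measurable_id)
    simpa using this
  have horth : ∀ i j, i + q ≤ j → ∫ e, a i e * a j e ∂π = 0 := by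
    intro i j hij
    obtain ⟨φ, hφ, hφa⟩ := hdep i
    obtain ⟨ψ, hψ, hψa⟩ := hdep j
    have hdisj : Disjoint (s.map (addRightEmbedding (i : ℤ)))
        (s.map (addRightEmbedding (j : ℤ))) := by
      rw [Finset.disjoint_left]
      simp only [Finset.mem_map, addRightEmbedding_apply, not_exists, not_and]
      rintro _ ⟨k, hk, rfl⟩ l hl hkl
      have h1 := Finset.le_sup (f := Int.natAbs) hk
      have h2 := Finset.le_sup (f := Int.natAbs) hl
      omega
    have h := (hindep.indepFun_finset _ _ hdisj fun k => measurable_pi_apply k).comp hφ hψ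
    have h3 : IndepFun (a i) (a j) π := by
      convert h using 1
      · funext e; exact hφa e
      · funext e; exact hψa e
    rw [h3.integral_fun_mul_eq_mul_integral (ham i).aestronglyMeasurable
      (ham j).aestronglyMeasurable, hmean, zero_mul]
  have hsum : ∀ N : ℕ, ∫ e, (∑ i ∈ Finset.range N, a i e) ^ 2 ∂π ≤ 2 * q * N * 1 := fun N => by
    refine integral_sum_sq_le hmem zero_le_one (fun i => ?_) horth N
    calc ∫ e, a i e ^ 2 ∂π ≤ ∫ e, (1 : ℝ) ∂π := by
          refine integral_mono (hmem i).integrable_sq (integrable_const _) fun e => ?_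
          rw [sq_le_one_iff_abs_le_one]; exact habs i e
      _ = 1 := by simp
  -- The parameter only switches the indicator on or off: the section of the rectangle is the
  -- cylinder `A` or empty.
  have hpt : ∀ N : ℕ, 0 < N → ∀ z : (ℤ → S) × X,
      ‖avgDev π (fun i : ℕ => shiftSeq (i : ℤ)) ((A ×ˢ b).indicator fun _ => (1 : ℝ)) N z‖ₑ ≤
        ‖(1 / (N : ℝ)) * ∑ i ∈ Finset.range N, a i z.1‖ₑ := by
    intro N hN z
    have hN' : (N : ℝ) ≠ 0 := by exact_mod_cast hN.ne'
    by_cases hz : z.2 ∈ b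
    · have h1 : ∀ e, (A ×ˢ b).indicator (fun _ => (1 : ℝ)) (e, z.2) = I e := fun e => by
        classical
        simp [hI, Set.indicator_apply, hz]
      refine le_of_eq ?_
      congr 1
      simp only [avgDev, h1, ha, Finset.sum_sub_distrib, Finset.sum_const, Finset.card_range,
        nsmul_eq_mul, mul_sub]
      rw [← hc, one_div, inv_mul_cancel_left₀ hN']
    · have h1 : ∀ e, (A ×ˢ b).indicator (fun _ => (1 : ℝ)) (e, z.2) = 0 := fun e => by
        simp [hz]
      simp [avgDev, h1]
  have hL1 : ∀ N : ℕ, 0 < N → ∀ η : ℝ, 0 < η →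
      ∫⁻ e, ‖(1 / (N : ℝ)) * ∑ i ∈ Finset.range N, a i e‖ₑ ∂π ≤
        ENNReal.ofReal (η + (2 * (q : ℝ) * (1 / (N : ℝ))) / η) := by
    intro N hN η hη
    have hN' : (N : ℝ) ≠ 0 := by exact_mod_cast hN.ne'
    refine lintegral_enorm_le_of_integral_sq ?_ hη ?_
    · exact (memLp_finsetSum _ fun i _ => hmem i).const_mul _
    · simp_rw [mul_pow]
      rw [integral_const_mul]
      calc (1 / (N : ℝ)) ^ 2 * ∫ e, (∑ i ∈ Finset.range N, a i e) ^ 2 ∂π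
          ≤ (1 / (N : ℝ)) ^ 2 * (2 * (q : ℝ) * (N : ℝ) * 1) := by gcongr; exact hsum N
        _ = 2 * (q : ℝ) * (1 / (N : ℝ)) := by field_simp
  rw [AvgTendsto]
  -- The choice η = √(1/N) balances `η` against the variance term 2q/(Nη).
  have hzero : Tendsto (fun N : ℕ => ENNReal.ofReal (Real.sqrt (1 / N) +
      (2 * q * (1 / N)) / Real.sqrt (1 / N)) * lam Set.univ) atTop (𝓝 0) := by
    have h1 : Tendsto (fun N : ℕ => Real.sqrt (1 / (N : ℝ)) + 2 * q * Real.sqrt (1 / (N : ℝ)))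
        atTop (𝓝 0) := by
      have h0 : Tendsto (fun N : ℕ => Real.sqrt (1 / (N : ℝ))) atTop (𝓝 0) := by
        have := (tendsto_one_div_atTop_nhds_zero_nat (𝕜 := ℝ)).sqrt
        rwa [Real.sqrt_zero] at this
      simpa using h0.add (h0.const_mul (2 * (q : ℝ)))
    have h2 := ENNReal.tendsto_ofReal h1
    rw [ENNReal.ofReal_zero] at h2
    have h3 := ENNReal.Tendsto.mul_const h2 (b := lam Set.univ) (Or.inr (measure_ne_top _ _))
    rw [zero_mul] at h3
    refine h3.congr fun N => ?_
    congr 3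
    rw [mul_div_assoc, Real.div_sqrt]
  refine tendsto_of_tendsto_of_tendsto_of_le_of_le' tendsto_const_nhds hzero
    (Eventually.of_forall fun _ => zero_le) ?_
  filter_upwards [eventually_gt_atTop 0] with N hN
  have hN' : (0 : ℝ) < N := by exact_mod_cast hN
  calc _ ≤ ∫⁻ z : (ℤ → S) × X, ‖(1 / (N : ℝ)) * ∑ i ∈ Finset.range N, a i z.1‖ₑ ∂(π.prod lam) :=
        lintegral_mono (hpt N hN)
    _ = (∫⁻ e, ‖(1 / (N : ℝ)) * ∑ i ∈ Finset.range N, a i e‖ₑ ∂π) * lam Set.univ := by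
        have hm : Measurable fun e => ‖(1 / (N : ℝ)) * ∑ i ∈ Finset.range N, a i e‖ₑ :=
          ((Finset.measurable_fun_sum _ fun i _ => ham i).const_mul _).enorm
        rw [lintegral_prod (fun z : (ℤ → S) × X => ‖(1 / (N : ℝ)) * ∑ i ∈ Finset.range N, a i z.1‖ₑ)
          (hm.comp measurable_fst).aemeasurable]
        simp only [lintegral_const]
        rw [lintegral_mul_const _ hm]
    _ ≤ _ := by
        gcongr
        exact hL1 N hN _ (Real.sqrt_pos.2 (by positivity))

/-- The `L¹` ergodic theorem for the Bernoulli shift, with a parameter. -/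
lemma avgTendsto_shiftSeq {X : Type*} [MeasurableSpace X] (ν : Measure S)
    [IsProbabilityMeasure ν] (lam : Measure X) [IsFiniteMeasure lam] {u : (ℤ → S) × X → ℝ}
    (hu : Integrable u ((Measure.infinitePi fun _ : ℤ => ν).prod lam)) :
    AvgTendsto (Measure.infinitePi fun _ : ℤ => ν) lam (fun i : ℕ => shiftSeq (i : ℤ)) u := by
  set C : Set (Set (ℤ → S)) := squareCylinders fun _ : ℤ => {s : Set S | MeasurableSet s}
  have hCpi : IsPiSystem C := isPiSystem_squareCylinders (fun _ => MeasurableSpace.isPiSystem_measurableSet)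
    fun _ => MeasurableSet.univ
  have hCgen : MeasurableSpace.generateFrom C = MeasurableSpace.pi :=
    generateFrom_squareCylinders
  -- The whole space is the cylinder with empty base.
  have hspan : IsCountablySpanning C :=
    ⟨fun _ => Set.univ, fun _ => ⟨∅, fun _ => Set.univ, by simp⟩, Set.iUnion_const _⟩
  have hgen := generateFrom_prod_eq (C := C) (D := {b : Set X | MeasurableSet b}) hspan
    isCountablySpanning_measurableSet
  rw [hCgen, MeasurableSpace.generateFrom_measurableSet] at hgen
  refine avgTendsto_of_generateFrom (fun i => measurePreserving_shiftSeq ν i) hgen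
    (hCpi.prod MeasurableSpace.isPiSystem_measurableSet) ?_ hu
  rintro _ ⟨_, ⟨s, t, ht, rfl⟩, b, -, rfl⟩
  exact avgTendsto_cylinder ν lam s t (fun k => ht k (Set.mem_univ k)) b

end Shift

end MDCP

end

noncomputable section

set_option linter.unusedSectionVars false

namespace MDCP

/-! ### The law of the series on path space -/

lemma measurable_lagVec (p : ℕ) (t : ℤ) : Measurable fun y : ℤ → ℝ => lagVec p y t :=
  measurable_pi_lambda _ fun _ => measurable_pi_apply _

lemma dependsOn_lagVec (p : ℕ) (t : ℤ) :
    DependsOn (fun y : ℤ → ℝ => lagVec p y t) (Set.Ioc (t - p) t) := by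
  intro x y h
  funext s
  have := s.2
  exact h _ ⟨by omega, by omega⟩

lemma lagVec_shiftSeq (p : ℕ) (i t : ℤ) (y : ℤ → ℝ) :
    lagVec p (shiftSeq i y) t = lagVec p y (t + i) := by
  funext s
  simp only [lagVec, shiftSeq]
  congr 1
  ring

lemma lagVec_succ (k : ℕ) (t : ℤ) (y : ℤ → ℝ) :
    lagVec (k + 1) y (t + 1) = (Fin.cons (y (t + 1)) (lagVec k y t) : Fin (k + 1) → ℝ) := by
  funext s
  refine Fin.cases ?_ (fun s => ?_) s
  · simp [lagVec]
  · simp only [lagVec, Fin.cons_succ, Fin.val_succ]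
    congr 1
    push_cast
    ring

/-- The sequence `y` with all values after time `t` replaced by `0`. -/
def truncSeq (t : ℤ) (y : ℤ → ℝ) : ℤ → ℝ := fun s => if s ≤ t then y s else 0

lemma measurable_truncSeq (t : ℤ) : Measurable (truncSeq t) := by
  refine measurable_pi_lambda _ fun s => ?_
  unfold truncSeq
  split_ifs
  · exact measurable_pi_apply s
  · exact measurable_const

lemma truncSeq_of_le {t s : ℤ} (h : s ≤ t) (y : ℤ → ℝ) : truncSeq t y s = y s := if_pos h

lemma lagVec_truncSeq (p : ℕ) (t : ℤ) (y : ℤ → ℝ) : lagVec p (truncSeq t y) t = lagVec p y t :=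
  dependsOn_lagVec p t fun _ hs => truncSeq_of_le hs.2 y

/-- The kernel `κ` applied to the lag vector at time `t`. -/
def lagKernel {p : ℕ} (κ : Kernel (Fin p → ℝ) ℝ) (t : ℤ) : Kernel (ℤ → ℝ) ℝ :=
  κ.comap (fun y => lagVec p y t) (measurable_lagVec p t)

instance {p : ℕ} (κ : Kernel (Fin p → ℝ) ℝ) [IsMarkovKernel κ] (t : ℤ) :
    IsMarkovKernel (lagKernel κ t) := by unfold lagKernel; infer_instance

@[simp] lemma lagKernel_apply {p : ℕ} (κ : Kernel (Fin p → ℝ) ℝ) (t : ℤ) (y : ℤ → ℝ) :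
    lagKernel κ t y = κ (lagVec p y t) := rfl

/-- A stationary Markov law of order `p` on path space for which ergodic averages converge, and
whose lag vectors and transition kernel have densities on `D`. -/
structure PathLaw (p : ℕ) (κ : Kernel (Fin p → ℝ) ℝ) (D : Set ℝ) (Q : Measure (ℤ → ℝ)) :
    Prop where
  shift : ∀ i, MeasurePreserving (shiftSeq i) Q Q
  markov : ∀ t, Q.map (fun y => (truncSeq (t - 1) y, y t)) =
    (Q.map (truncSeq (t - 1))) ⊗ₘ (lagKernel κ (t - 1))
  average : ∀ u : (ℤ → ℝ) × (Fin p → ℝ) → ℝ, Measurable u →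
    Integrable u (Q.prod (volume.restrict (cube p D))) →
    AvgTendsto Q (volume.restrict (cube p D)) (fun i : ℕ => shiftSeq (i : ℤ)) u
  mem : ∀ᵐ y ∂Q, ∀ t, y t ∈ D
  kernel_ac : ∀ x ∈ cube p D, κ x ≪ volume.restrict D
  law_ac : ∀ t, Q.map (fun y => lagVec p y t) ≪ volume.restrict (cube p D)
  ac_law : ∀ t, volume.restrict (cube p D) ≪ Q.map (fun y => lagVec p y t)

section

variable {p : ℕ} {κ : Kernel (Fin p → ℝ) ℝ} [IsMarkovKernel κ] {D : Set ℝ}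
  {Q : Measure (ℤ → ℝ)} [IsProbabilityMeasure Q]

lemma volume_restrict_cube (k : ℕ) (D : Set ℝ) :
    (volume.restrict (cube k D) : Measure (Fin k → ℝ)) =
      Measure.pi fun _ => volume.restrict D := by
  rw [cube, volume_pi, Measure.restrict_pi_pi]

/-- Splits off the newest coordinate, the one that the Markov kernel adds in the induction of
`PathLaw.map_past_block_ac`. -/
lemma lintegral_cube_succ (k : ℕ) (D : Set ℝ) {φ : (Fin (k + 1) → ℝ) → ℝ≥0∞}
    (hφ : Measurable φ) :
    ∫⁻ x in cube (k + 1) D, φ x =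
      ∫⁻ z in D, ∫⁻ l in cube k D, φ (Fin.cons z l : Fin (k + 1) → ℝ) := by
  have hmp := (measurePreserving_piFinSuccAbove
    (fun _ : Fin (k + 1) => (volume.restrict D : Measure ℝ)) 0).symm
  rw [volume_restrict_cube, volume_restrict_cube, ← hmp.map_eq,
    lintegral_map hφ hmp.measurable, lintegral_prod]
  · refine lintegral_congr fun z => lintegral_congr fun l => ?_
    congr 1
    simp [MeasurableEquiv.piFinSuccAbove, Fin.insertNthEquiv]
  · exact (hφ.comp hmp.measurable).aemeasurable

lemma PathLaw.lagVec_mem (hQ : PathLaw p κ D Q) : ∀ᵐ y ∂Q, ∀ t, lagVec p y t ∈ cube p D := by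
  filter_upwards [hQ.mem] with y hy t
  exact fun s _ => hy _

lemma update_truncSeq (t : ℤ) (y : ℤ → ℝ) (s : ℤ) (hs : s ≤ t) :
    Function.update (truncSeq (t - 1) y) t (y t) s = y s := by
  rcases eq_or_ne s t with rfl | hst
  · simp
  · rw [Function.update_of_ne hst, truncSeq_of_le (by omega)]

lemma measurable_update_prod (t : ℤ) :
    Measurable fun a : (ℤ → ℝ) × ℝ => Function.update a.1 t a.2 := by
  refine measurable_pi_lambda _ fun s => ?_
  rcases eq_or_ne s t with rfl | hst
  · simpa using measurable_snd
  · simp_rw [Function.update_of_ne hst]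
    exact (measurable_pi_apply s).comp measurable_fst

/-- Integrating out the last coordinate by the Markov kernel. -/
lemma PathLaw.lintegral_markov (hQ : PathLaw p κ D Q) (t : ℤ) {Ψ : (ℤ → ℝ) → ℝ≥0∞}
    (hΨ : Measurable Ψ) (hdep : DependsOn Ψ (Set.Iic t)) :
    ∫⁻ y, Ψ y ∂Q = ∫⁻ y, ∫⁻ z, Ψ (Function.update y t z) ∂(κ (lagVec p y (t - 1))) ∂Q := by
  have hm : Measurable fun a : (ℤ → ℝ) × ℝ => Ψ (Function.update a.1 t a.2) :=
    hΨ.comp (measurable_update_prod t)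
  have htr := measurable_truncSeq (t - 1)
  -- As `Ψ` ignores times after `t`, it is a function of the truncated past and the value at `t`,
  -- whose joint law the Markov property disintegrates.
  have h1 : ∀ y, Ψ y = Ψ (Function.update (truncSeq (t - 1) y) t (y t)) := fun y =>
    hdep fun s hs => (update_truncSeq t y s hs).symm
  have h2 := lintegral_map (μ := Q) hm (htr.prodMk (measurable_pi_apply t))
  simp only [← h1] at h2
  rw [← h2, hQ.markov, Measure.lintegral_compProd hm, lintegral_map _ htr]
  · refine lintegral_congr fun y => ?_
    rw [lagKernel_apply, lagVec_truncSeq]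
    refine lintegral_congr fun z => hdep fun s hs => ?_
    rcases eq_or_ne s t with rfl | hst
    · simp
    · have : s ≤ t := hs
      rw [Function.update_of_ne hst, Function.update_of_ne hst]
      exact truncSeq_of_le (by omega) y
  · exact hm.lintegral_kernel_prod_right'

lemma PathLaw.integral_markov (hQ : PathLaw p κ D Q) (t : ℤ) {Ψ : (ℤ → ℝ) → ℝ}
    (hΨ : Measurable Ψ) (hint : Integrable Ψ Q) (hdep : DependsOn Ψ (Set.Iic t)) :
    ∫ y, Ψ y ∂Q = ∫ y, ∫ z, Ψ (Function.update y t z) ∂(κ (lagVec p y (t - 1))) ∂Q := by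
  have hm : Measurable fun a : (ℤ → ℝ) × ℝ => Ψ (Function.update a.1 t a.2) :=
    hΨ.comp (measurable_update_prod t)
  have htr := measurable_truncSeq (t - 1)
  have hpm : Measurable fun y : ℤ → ℝ => (truncSeq (t - 1) y, y t) :=
    htr.prodMk (measurable_pi_apply t)
  have h1 : ∀ y, Ψ y = Ψ (Function.update (truncSeq (t - 1) y) t (y t)) := fun y =>
    hdep fun s hs => (update_truncSeq t y s hs).symm
  have h2 := integral_map (μ := Q) hpm.aemeasurable hm.aestronglyMeasurable
  have h3 : Integrable (fun a : (ℤ → ℝ) × ℝ => Ψ (Function.update a.1 t a.2))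
      (Q.map fun y => (truncSeq (t - 1) y, y t)) := by
    rw [integrable_map_measure hm.aestronglyMeasurable hpm.aemeasurable]
    exact hint.congr (Eventually.of_forall h1)
  simp only [← h1] at h2
  rw [hQ.markov] at h3
  rw [← h2, hQ.markov, Measure.integral_compProd h3, integral_map htr.aemeasurable]
  · refine integral_congr_ae (Eventually.of_forall fun y => ?_)
    simp only [lagKernel_apply, lagVec_truncSeq]
    refine integral_congr_ae (Eventually.of_forall fun z => hdep fun s hs => ?_)
    rcases eq_or_ne s t with rfl | hst
    · simp
    · have : s ≤ t := hs
      rw [Function.update_of_ne hst, Function.update_of_ne hst]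
      exact truncSeq_of_le (by omega) y
  · exact hm.stronglyMeasurable.integral_kernel_prod_right'.aestronglyMeasurable

/-! ### Decoupling a lag vector from the past and from the future -/

/-- A block of `k` consecutive values has a density given the past. -/
lemma PathLaw.map_past_block_ac (hQ : PathLaw p κ D Q) (k : ℕ) :
    Q.map (fun y => (truncSeq 0 y, lagVec k y k)) ≪
      (Q.map (truncSeq 0)).prod (volume.restrict (cube k D)) := by
  have htr := measurable_truncSeq 0
  have : IsProbabilityMeasure (Q.map (truncSeq 0)) :=
    Measure.isProbabilityMeasure_map htr.aemeasurable
  induction k with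
  | zero =>
    -- For an empty block the cube is a single point of mass one.
    have h1 : (volume.restrict (cube 0 D) : Measure (Fin 0 → ℝ)) = Measure.dirac default := by
      rw [volume_restrict_cube, Measure.pi_of_empty _ default]
    rw [h1, Measure.prod_dirac, Measure.map_map (by fun_prop) htr]
    refine Measure.absolutelyContinuous_of_eq (congrArg (fun f => Q.map f) ?_)
    funext y
    exact Prod.ext rfl (Subsingleton.elim _ _)
  | succ k ih =>
    refine Measure.AbsolutelyContinuous.mk fun E hE hE0 => ?_
    have hmk : Measurable fun y : ℤ → ℝ =>
        (truncSeq 0 y, lagVec (k + 1) y ((k + 1 : ℕ) : ℤ)) :=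
      htr.prodMk (measurable_lagVec _ _)
    set φ : (ℤ → ℝ) × (Fin (k + 1) → ℝ) → ℝ≥0∞ := E.indicator 1 with hφ
    have hφm : Measurable φ := measurable_one.indicator hE
    have hcons : Measurable fun a : ((ℤ → ℝ) × (Fin k → ℝ)) × ℝ =>
        (a.1.1, (Fin.cons a.2 a.1.2 : Fin (k + 1) → ℝ)) := by
      refine (measurable_fst.comp measurable_fst).prodMk (measurable_pi_lambda _ fun s => ?_)
      refine Fin.cases ?_ (fun s => ?_) s
      · simpa using measurable_snd
      · simp only [Fin.cons_succ]
        exact (measurable_pi_apply s).comp (measurable_snd.comp measurable_fst)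
    have hG : Measurable fun a : (ℤ → ℝ) × (Fin k → ℝ) =>
        ∫⁻ z in D, φ (a.1, (Fin.cons z a.2 : Fin (k + 1) → ℝ)) :=
      (hφm.comp hcons).lintegral_prod_right'
    -- By Tonelli, for almost every past and block of length `k` the section of the null set `E` in
    -- the newest coordinate is Lebesgue null in `D`.
    have h0 : ∫⁻ a : (ℤ → ℝ) × (Fin k → ℝ),
        (∫⁻ z in D, φ (a.1, (Fin.cons z a.2 : Fin (k + 1) → ℝ)))
          ∂((Q.map (truncSeq 0)).prod (volume.restrict (cube k D))) = 0 := by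
      rw [lintegral_prod _ hG.aemeasurable]
      rw [← lintegral_indicator_one hE, lintegral_prod _ hφm.aemeasurable] at hE0
      rw [← hE0]
      refine lintegral_congr fun q => ?_
      rw [lintegral_cube_succ k D (φ := fun l => φ (q, l)) (hφm.comp measurable_prodMk_left),
        lintegral_lintegral_swap]
      exact (hφm.comp (hcons.comp
        ((measurable_const.prodMk measurable_fst).prodMk measurable_snd))).aemeasurable
    rw [lintegral_eq_zero_iff hG] at h0
    have h1 := ae_of_ae_map (htr.prodMk (measurable_lagVec k k)).aemeasurable (ih.ae_le h0)
    rw [← lintegral_indicator_one hE, lintegral_map hφm hmk,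
      hQ.lintegral_markov ((k + 1 : ℕ) : ℤ)
        (Ψ := fun y => φ (truncSeq 0 y, lagVec (k + 1) y ((k + 1 : ℕ) : ℤ))) (hφm.comp hmk)]
    -- The induction hypothesis moves this to the true joint law, and the transition law, having a
    -- density on `D`, does not charge a Lebesgue null section.
    · rw [lintegral_eq_zero_iff']
      · filter_upwards [h1, hQ.lagVec_mem] with y hy hyD
        have h2 : ∀ z, φ (truncSeq 0 (Function.update y ((k + 1 : ℕ) : ℤ) z),
            lagVec (k + 1) (Function.update y ((k + 1 : ℕ) : ℤ) z) ((k + 1 : ℕ) : ℤ)) =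
            φ (truncSeq 0 y, (Fin.cons z (lagVec k y k) : Fin (k + 1) → ℝ)) := by
          intro z
          congr 2
          · funext s
            unfold truncSeq
            split_ifs with hs
            · rw [Function.update_of_ne]; push_cast; omega
            · rfl
          · push_cast
            rw [lagVec_succ, Function.update_self]
            congr 1
            refine dependsOn_lagVec k k fun s hs => ?_
            rw [Function.update_of_ne]
            have := hs.2
            omega
        simp only [h2, Pi.zero_apply] at hy ⊢
        have hm : Measurable fun z => φ (truncSeq 0 y,
            (Fin.cons z (lagVec k y k) : Fin (k + 1) → ℝ)) :=
          hφm.comp (hcons.comp (measurable_prodMk_left (x := (truncSeq 0 y, lagVec k y k))))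
        rw [lintegral_eq_zero_iff hm] at hy ⊢
        exact (hQ.kernel_ac _ (hyD _)).ae_le hy
      · have hm : Measurable fun a : (ℤ → ℝ) × ℝ =>
            φ (truncSeq 0 (Function.update a.1 ((k + 1 : ℕ) : ℤ) a.2), lagVec (k + 1)
              (Function.update a.1 ((k + 1 : ℕ) : ℤ) a.2) ((k + 1 : ℕ) : ℤ)) :=
          (hφm.comp hmk).comp (measurable_update_prod _)
        exact (hm.lintegral_kernel_prod_right'
          (κ := lagKernel κ (((k + 1 : ℕ) : ℤ) - 1))).aemeasurable
    · intro x y hxy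
      dsimp only
      congr 2
      · funext s
        unfold truncSeq
        split_ifs with hs
        · exact hxy s (by simp only [Set.mem_Iic]; omega)
        · rfl
      · exact dependsOn_lagVec _ _ fun s hs => hxy s hs.2

/-- The value `Φ y (X_t)` of a function of the past of time `t - p` is controlled by its mean over
independent lag vectors. -/
lemma PathLaw.past_transfer (hQ : PathLaw p κ D Q) [IsFiniteMeasure (volume.restrict (cube p D))]
    {ε : ℝ≥0∞} (hε : ε ≠ 0) : ∃ A : ℝ≥0, ∀ (t : ℤ) (Φ : (ℤ → ℝ) → (Fin p → ℝ) → ℝ≥0∞),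
      Measurable (Function.uncurry Φ) → (∀ y x, Φ y x ≤ 1) →
      (∀ x, DependsOn (fun y => Φ y x) (Set.Iic (t - p))) →
      ∫⁻ y, Φ y (lagVec p y t) ∂Q ≤ A * ∫⁻ y, (∫⁻ x in cube p D, Φ y x) ∂Q + ε := by
  have htr := measurable_truncSeq 0
  have : IsProbabilityMeasure (Q.map (truncSeq 0)) :=
    Measure.isProbabilityMeasure_map htr.aemeasurable
  have hpair : Measurable fun y : ℤ → ℝ => (truncSeq 0 y, lagVec p y p) :=
    htr.prodMk (measurable_lagVec p p)
  have : IsProbabilityMeasure (Q.map fun y => (truncSeq 0 y, lagVec p y p)) :=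
    Measure.isProbabilityMeasure_map hpair.aemeasurable
  obtain ⟨A, hA⟩ := exists_lintegral_le_mul_add (hQ.map_past_block_ac p) hε
  refine ⟨A, fun t Φ hΦ hΦ1 hdep => ?_⟩
  -- Stationarity moves the end of the past to time `0` and the lag vector to time `p`, so one
  -- constant `A` serves every `t`.
  have hs := hQ.shift (-(t - p))
  have hsm := measurable_shiftSeq (S := ℝ) (-(t - p))
  have hφ : Measurable fun a : (ℤ → ℝ) × (Fin p → ℝ) => Φ (shiftSeq (-(t - p)) a.1) a.2 :=
    hΦ.comp ((hsm.comp measurable_fst).prodMk measurable_snd)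
  have hshift : ∀ x y, Φ (shiftSeq (-(t - p)) (truncSeq 0 y)) x = Φ (shiftSeq (-(t - p)) y) x :=
    fun x y => hdep x fun s hs => truncSeq_of_le (by have : s ≤ t - p := hs; omega) y
  have h1 := hA _ hφ fun a => hΦ1 _ _
  rw [lintegral_map hφ hpair, lintegral_prod _ hφ.aemeasurable,
    lintegral_map hφ.lintegral_prod_right' htr] at h1
  simp only [hshift] at h1
  have h2 : ∫⁻ y, Φ y (lagVec p y t) ∂Q =
      ∫⁻ y, Φ (shiftSeq (-(t - p)) y) (lagVec p y p) ∂Q := by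
    rw [← hs.lintegral_comp (f := fun y => Φ y (lagVec p y t))
      (hΦ.comp (measurable_id.prodMk (measurable_lagVec p t)))]
    simp [lagVec_shiftSeq]
  have h3 : ∫⁻ y, (∫⁻ x in cube p D, Φ y x) ∂Q =
      ∫⁻ y, (∫⁻ x in cube p D, Φ (shiftSeq (-(t - p)) y) x) ∂Q :=
    (hs.lintegral_comp (f := fun y => ∫⁻ x in cube p D, Φ y x) hΦ.lintegral_prod_right').symm
  rw [h2, h3]
  exact h1

/-- If only the values at times 1, …, p are involved, the pair of lag vectors at `p` and `0`
decides. Later values are integrated out one at a time with the Markov kernel, which changes neither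
side of the inequality; therefore `A` does not depend on `k`. -/
lemma PathLaw.future_transfer_zero (hQ : PathLaw p κ D Q)
    [IsFiniteMeasure (volume.restrict (cube p D))]
    {ε : ℝ≥0∞} (hε : ε ≠ 0) : ∃ A : ℝ≥0, ∀ (k : ℕ) (Φ : (ℤ → ℝ) → (Fin p → ℝ) → ℝ≥0∞),
      Measurable (Function.uncurry Φ) → (∀ y x, Φ y x ≤ 1) →
      (∀ x, DependsOn (fun y => Φ y x) (Set.Ioc 0 (p + k))) →
      ∫⁻ y, Φ y (lagVec p y 0) ∂Q ≤ A * ∫⁻ y, (∫⁻ x in cube p D, Φ y x) ∂Q + ε := by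
  set lam : Measure (Fin p → ℝ) := volume.restrict (cube p D) with hlam
  have hX := measurable_lagVec p
  have hpr : ∀ t, IsProbabilityMeasure (Q.map fun y => lagVec p y t) := fun t =>
    Measure.isProbabilityMeasure_map (hX t).aemeasurable
  have hpair : Measurable fun y : ℤ → ℝ => (lagVec p y p, lagVec p y 0) :=
    (hX p).prodMk (hX 0)
  have : IsProbabilityMeasure (Q.map fun y => (lagVec p y p, lagVec p y 0)) :=
    Measure.isProbabilityMeasure_map hpair.aemeasurable
  -- Projecting the past to the lag vector at `0` gives domination by Lebesgue measure times its
  -- law; as the law of a lag vector and Lebesgue measure on the cube are equivalent, the factors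
  -- can be exchanged.
  have hac : Q.map (fun y => (lagVec p y p, lagVec p y 0)) ≪
      (Q.map fun y => lagVec p y p).prod lam := by
    have htr := measurable_truncSeq 0
    have : IsProbabilityMeasure (Q.map (truncSeq 0)) :=
      Measure.isProbabilityMeasure_map htr.aemeasurable
    have hsw : Measurable fun a : (ℤ → ℝ) × (Fin p → ℝ) => (a.2, lagVec p a.1 0) :=
      measurable_snd.prodMk ((hX 0).comp measurable_fst)
    have h1 := (hQ.map_past_block_ac p).map hsw
    rw [Measure.map_map hsw (htr.prodMk (hX p))] at h1
    have h2 : ((fun a : (ℤ → ℝ) × (Fin p → ℝ) => (a.2, lagVec p a.1 0)) ∘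
        fun y => (truncSeq 0 y, lagVec p y p)) = fun y => (lagVec p y p, lagVec p y 0) := by
      funext y
      simp [lagVec_truncSeq]
    rw [h2] at h1
    refine h1.trans ?_
    have h3 : ((Q.map (truncSeq 0)).prod lam).map
        (fun a : (ℤ → ℝ) × (Fin p → ℝ) => (a.2, lagVec p a.1 0)) =
        lam.prod (Q.map fun y => lagVec p y 0) := by
      have h4 : (fun a : (ℤ → ℝ) × (Fin p → ℝ) => (a.2, lagVec p a.1 0)) =
          Prod.swap ∘ Prod.map (fun y => lagVec p y 0) id := rfl
      rw [h4, ← Measure.map_map measurable_swap ((hX 0).prodMap measurable_id),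
        ← Measure.map_prod_map _ _ (hX 0) measurable_id, Measure.map_id,
        Measure.map_map (hX 0) htr, Measure.prod_swap]
      congr 2
      funext y
      simp [lagVec_truncSeq]
    rw [h3]
    exact (hQ.ac_law p).prod (hQ.law_ac 0)
  obtain ⟨A, hA⟩ := exists_lintegral_le_mul_add hac hε
  refine ⟨A, fun k => ?_⟩
  induction k with
  | zero =>
    intro Φ hΦ hΦ1 hdep
    -- A lag vector at time `p` is written back as a sequence at the times 1, …, p; the value `0`
    -- elsewhere is never read.
    let ext : (Fin p → ℝ) → ℤ → ℝ := fun l s =>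
      if hs : 0 < s ∧ s ≤ p then l ⟨(p - s).toNat, by omega⟩ else 0
    have hext : Measurable ext := by
      refine measurable_pi_lambda _ fun s => ?_
      simp only [ext]
      split_ifs
      · exact measurable_pi_apply _
      · exact measurable_const
    have hextΦ : ∀ x y, Φ (ext (lagVec p y p)) x = Φ y x := by
      intro x y
      refine hdep x fun s hs => ?_
      simp only [Nat.cast_zero, add_zero, Set.mem_Ioc] at hs
      simp only [ext, dif_pos hs, lagVec]
      congr 1
      omega
    have hφ : Measurable fun a : (Fin p → ℝ) × (Fin p → ℝ) => Φ (ext a.1) a.2 :=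
      hΦ.comp ((hext.comp measurable_fst).prodMk measurable_snd)
    have h1 := hA _ hφ fun a => hΦ1 _ _
    rw [lintegral_map hφ hpair, lintegral_prod _ hφ.aemeasurable,
      lintegral_map hφ.lintegral_prod_right' (hX p)] at h1
    simpa only [hextΦ] using h1
  | succ k ih =>
    intro Φ hΦ hΦ1 hdep
    set t : ℤ := p + (k + 1 : ℕ) with ht
    set Φ' : (ℤ → ℝ) → (Fin p → ℝ) → ℝ≥0∞ := fun y x =>
      ∫⁻ z, Φ (Function.update y t z) x ∂(κ (lagVec p y (t - 1))) with hΦ'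
    have hm3 : Measurable fun a : ((ℤ → ℝ) × (Fin p → ℝ)) × ℝ =>
        Φ (Function.update a.1.1 t a.2) a.1.2 :=
      hΦ.comp (((measurable_update_prod t).comp
        ((measurable_fst.comp measurable_fst).prodMk measurable_snd)).prodMk
        (measurable_snd.comp measurable_fst))
    have hΦ'm : Measurable (Function.uncurry Φ') :=
      hm3.lintegral_kernel_prod_right' (κ := (lagKernel κ (t - 1)).comap Prod.fst measurable_fst)
    have hΦ'1 : ∀ y x, Φ' y x ≤ 1 := fun y x => by
      calc Φ' y x ≤ ∫⁻ z, 1 ∂(κ (lagVec p y (t - 1))) := lintegral_mono fun z => hΦ1 _ _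
        _ = 1 := by simp
    -- Integrating out the value at time `p + k + 1` brings in the preceding `p` values, all after
    -- time `0`; this is why the induction starts from a window of length `p`.
    have hΦ'dep : ∀ x, DependsOn (fun y => Φ' y x) (Set.Ioc 0 (p + k)) := by
      intro x y y' hy
      have h1 : lagVec p y (t - 1) = lagVec p y' (t - 1) :=
        dependsOn_lagVec p _ fun s hs => hy s ⟨by have := hs.1; omega, by have := hs.2; omega⟩
      simp only [hΦ', h1]
      refine lintegral_congr fun z => hdep x fun s hs => ?_
      rcases eq_or_ne s t with rfl | hst
      · simp
      · rw [Function.update_of_ne hst, Function.update_of_ne hst]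
        exact hy s ⟨hs.1, by have := hs.2; omega⟩
    have h1 := ih Φ' hΦ'm hΦ'1 hΦ'dep
    have h2 : ∫⁻ y, Φ y (lagVec p y 0) ∂Q = ∫⁻ y, Φ' y (lagVec p y 0) ∂Q := by
      rw [hQ.lintegral_markov t (Ψ := fun y => Φ y (lagVec p y 0))
        (hΦ.comp (measurable_id.prodMk (hX 0)))]
      · refine lintegral_congr fun y => lintegral_congr fun z => ?_
        congr 1
        refine dependsOn_lagVec p 0 fun s hs => ?_
        rw [Function.update_of_ne]
        have := hs.2
        omega
      · intro y y' hy
        have h0 : lagVec p y 0 = lagVec p y' 0 := dependsOn_lagVec p 0 fun s hs =>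
          hy s (by have := hs.2; simp only [Set.mem_Iic]; omega)
        simp only [h0]
        exact hdep _ fun s hs => hy s hs.2
    have h3 : ∫⁻ y, (∫⁻ x in cube p D, Φ y x) ∂Q = ∫⁻ y, (∫⁻ x in cube p D, Φ' y x) ∂Q := by
      rw [lintegral_lintegral_swap hΦ.aemeasurable, lintegral_lintegral_swap hΦ'm.aemeasurable]
      refine lintegral_congr fun x => ?_
      exact hQ.lintegral_markov t (hΦ.comp measurable_prodMk_right)
        ((hdep x).mono Set.Ioc_subset_Iic_self)
    rw [h2, h3]
    exact h1

/-- The value `Φ y (X_t)` of a function of the future of time `t` is controlled by its mean over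
independent lag vectors. -/
lemma PathLaw.future_transfer (hQ : PathLaw p κ D Q)
    [IsFiniteMeasure (volume.restrict (cube p D))] {ε : ℝ≥0∞} (hε : ε ≠ 0) :
    ∃ A : ℝ≥0, ∀ (t T : ℤ) (Φ : (ℤ → ℝ) → (Fin p → ℝ) → ℝ≥0∞),
      Measurable (Function.uncurry Φ) → (∀ y x, Φ y x ≤ 1) →
      (∀ x, DependsOn (fun y => Φ y x) (Set.Ioc t T)) →
      ∫⁻ y, Φ y (lagVec p y t) ∂Q ≤ A * ∫⁻ y, (∫⁻ x in cube p D, Φ y x) ∂Q + ε := by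
  obtain ⟨A, hA⟩ := hQ.future_transfer_zero hε
  refine ⟨A, fun t T Φ hΦ hΦ1 hdep => ?_⟩
  have hs := hQ.shift (-t)
  have hsm := measurable_shiftSeq (S := ℝ) (-t)
  -- After the shift the window (t, T] becomes (0, T - t], contained in the one allowed for this
  -- `k`.
  have h1 := hA (T - t).toNat (fun y x => Φ (shiftSeq (-t) y) x)
    (hΦ.comp ((hsm.comp measurable_fst).prodMk measurable_snd)) (fun y x => hΦ1 _ _) ?_
  · have h2 : ∫⁻ y, Φ y (lagVec p y t) ∂Q = ∫⁻ y, Φ (shiftSeq (-t) y) (lagVec p y 0) ∂Q := by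
      rw [← hs.lintegral_comp (f := fun y => Φ y (lagVec p y t))
        (hΦ.comp (measurable_id.prodMk (measurable_lagVec p t)))]
      simp [lagVec_shiftSeq]
    have h3 : ∫⁻ y, (∫⁻ x in cube p D, Φ y x) ∂Q =
        ∫⁻ y, (∫⁻ x in cube p D, Φ (shiftSeq (-t) y) x) ∂Q :=
      (hs.lintegral_comp (f := fun y => ∫⁻ x in cube p D, Φ y x) hΦ.lintegral_prod_right').symm
    rw [h2, h3]
    exact h1
  · intro x y y' hy
    refine hdep x fun s hs => hy (s + -t) ⟨?_, ?_⟩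
    · have := hs.1; omega
    · have := hs.2; omega

end

end MDCP

end

noncomputable section

set_option linter.unusedSectionVars false

namespace MDCP

/-! ### `L¹` consistency of the kernel sums -/

section

variable {p : ℕ} {κ : Kernel (Fin p → ℝ) ℝ} [IsMarkovKernel κ] {D : Set ℝ}
  {Q : Measure (ℤ → ℝ)} [IsProbabilityMeasure Q] {w K : ℝ → ℝ}

/-- The first moment of a sum of orthogonal variables that depend on a parameter. -/
lemma lintegral_orthogonal_sum_le [IsFiniteMeasure (volume.restrict (cube p D))]
    {a : ℕ → (ℤ → ℝ) → (Fin p → ℝ) → ℝ}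
    (ha : ∀ j, Measurable (Function.uncurry (a j)))
    (hmem : ∀ j x, MemLp (fun y => a j y x) 2 Q) {m : (Fin p → ℝ) → ℝ} (hm : Measurable m)
    (hm0 : ∀ x, 0 ≤ m x) (hm1 : ∫⁻ x in cube p D, ENNReal.ofReal (m x) ≤ 1) {V : ℝ}
    (hV0 : 0 ≤ V) (hV : ∀ j x, ∫ y, a j y x ^ 2 ∂Q ≤ V * m x) {q : ℕ}
    (horth : ∀ i j x, i + q ≤ j → ∫ y, a i y x * a j y x ∂Q = 0) {N η : ℝ} (hN : 0 < N)
    (hη : 0 < η) {l : ℕ} (hl : (l : ℝ) ≤ N) :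
    ∫⁻ y, (∫⁻ x in cube p D, ‖(1 / N) * ∑ j ∈ Finset.range l, a j y x‖ₑ) ∂Q ≤
      ENNReal.ofReal η * volume (cube p D) + ENNReal.ofReal (2 * q * V / (N * η)) := by
  have hsm : Measurable fun z : (ℤ → ℝ) × (Fin p → ℝ) =>
      ‖(1 / N) * ∑ j ∈ Finset.range l, a j z.1 z.2‖ₑ :=
    ((Finset.measurable_fun_sum _ fun j _ => ha j).const_mul _).enorm
  -- For fixed `x` the second moment is of order q V m(x)/N; integrating over `x` costs nothing
  -- because `m` has total mass at most one.
  rw [lintegral_lintegral_swap hsm.aemeasurable]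
  have hx : ∀ x, ∫⁻ y, ‖(1 / N) * ∑ j ∈ Finset.range l, a j y x‖ₑ ∂Q ≤
      ENNReal.ofReal η + ENNReal.ofReal (2 * q * V / (N * η)) * ENNReal.ofReal (m x) := by
    intro x
    have h1 := lintegral_enorm_le_of_integral_sq (μ := Q)
      (f := fun y => (1 / N) * ∑ j ∈ Finset.range l, a j y x) (v := 2 * q * V / N * m x)
      ((memLp_finsetSum _ fun j _ => hmem j x).const_mul _) hη ?_
    · refine h1.trans ?_
      have hmx := hm0 x
      rw [← ENNReal.ofReal_mul (by positivity), ← ENNReal.ofReal_add hη.le (by positivity)]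
      refine ENNReal.ofReal_le_ofReal (le_of_eq ?_)
      field_simp
    · have h2 := integral_sum_sq_le (fun j => hmem j x) (mul_nonneg hV0 (hm0 x))
        (fun j => hV j x) (fun i j hij => horth i j x hij) l
      simp_rw [mul_pow]
      rw [integral_const_mul]
      have hmx := hm0 x
      calc (1 / N) ^ 2 * ∫ y, (∑ j ∈ Finset.range l, a j y x) ^ 2 ∂Q
          ≤ (1 / N) ^ 2 * (2 * (q : ℝ) * N * (V * m x)) := by
            refine mul_le_mul_of_nonneg_left (h2.trans ?_) (by positivity)
            gcongr
        _ = 2 * (q : ℝ) * V / N * m x := by field_simp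
  calc _ ≤ ∫⁻ x in cube p D, (ENNReal.ofReal η +
        ENNReal.ofReal (2 * q * V / (N * η)) * ENNReal.ofReal (m x)) := lintegral_mono hx
    _ = ENNReal.ofReal η * volume (cube p D) + ENNReal.ofReal (2 * q * V / (N * η)) *
        ∫⁻ x in cube p D, ENNReal.ofReal (m x) := by
      rw [lintegral_add_left measurable_const, lintegral_const_mul _ hm.ennreal_ofReal]
      simp
    _ ≤ _ := by
      gcongr
      exact mul_le_of_le_one_right' hm1

/-- The mean weight at `x`. -/
def meanWeight (Q : Measure (ℤ → ℝ)) (w : ℝ → ℝ) (h : ℝ) (x : Fin p → ℝ) : ℝ :=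
  ∫ y, prodWeight w h (lagVec p y 0) x ∂Q

lemma PathLaw.integral_lagVec (hQ : PathLaw p κ D Q) {φ : (Fin p → ℝ) → ℝ} (hφ : Measurable φ)
    (t : ℤ) : ∫ y, φ (lagVec p y t) ∂Q = ∫ y, φ (lagVec p y 0) ∂Q := by
  have hs := hQ.shift t
  have h1 := integral_map (μ := Q) hs.measurable.aemeasurable
    (f := fun y => φ (lagVec p y 0)) (hφ.comp (measurable_lagVec p 0)).aestronglyMeasurable
  rw [hs.map_eq] at h1
  rw [h1]
  simp [lagVec_shiftSeq]

lemma PathLaw.lintegral_lagVec (hQ : PathLaw p κ D Q) {φ : (Fin p → ℝ) → ℝ≥0∞}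
    (hφ : Measurable φ) (t : ℤ) : ∫⁻ y, φ (lagVec p y t) ∂Q = ∫⁻ y, φ (lagVec p y 0) ∂Q := by
  rw [← (hQ.shift t).lintegral_comp (f := fun y => φ (lagVec p y 0))
    (hφ.comp (measurable_lagVec p 0))]
  simp [lagVec_shiftSeq]

lemma measurable_weight (hw : Measurable w) (h : ℝ) (t : ℤ) :
    Measurable fun z : (ℤ → ℝ) × (Fin p → ℝ) => prodWeight w h (lagVec p z.1 t) z.2 :=
  (measurable_prodWeight hw h).comp
    (((measurable_lagVec p t).comp measurable_fst).prodMk measurable_snd)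

lemma integrable_weight (hwK : KernelConditions p w K) (hp : 1 ≤ p) {h : ℝ} (hh : 0 < h)
    (t : ℤ) (x : Fin p → ℝ) : Integrable (fun y => prodWeight w h (lagVec p y t) x) Q := by
  obtain ⟨B, -, hB⟩ := hwK.exists_bound
  refine Integrable.of_bound ((measurable_weight (hwK.continuous_w hp).measurable h t).comp
    measurable_prodMk_right).aestronglyMeasurable ((B / h) ^ p) (Eventually.of_forall fun y => ?_)
  rw [Real.norm_of_nonneg (prodWeight_nonneg hwK.w_nonneg hh _ _)]
  exact prodWeight_le hwK.w_nonneg hB hh _ _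

lemma meanWeight_nonneg (hwK : KernelConditions p w K) {h : ℝ} (hh : 0 < h) (x : Fin p → ℝ) :
    0 ≤ meanWeight Q w h x :=
  integral_nonneg fun _ => prodWeight_nonneg hwK.w_nonneg hh _ _

lemma measurable_meanWeight (hw : Measurable w) (h : ℝ) :
    Measurable (meanWeight (p := p) Q w h) :=
  (measurable_weight hw h 0).stronglyMeasurable.integral_prod_left.measurable

lemma lintegral_meanWeight_le (hwK : KernelConditions p w K) (hp : 1 ≤ p) {h : ℝ} (hh : 0 < h) :
    ∫⁻ x in cube p D, ENNReal.ofReal (meanWeight Q w h x) ≤ 1 := by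
  have h1 : ∀ x, ENNReal.ofReal (meanWeight Q w h x) =
      ∫⁻ y, ENNReal.ofReal (prodWeight w h (lagVec p y 0) x) ∂Q := fun x =>
    ofReal_integral_eq_lintegral_ofReal (integrable_weight hwK hp hh 0 x)
      (Eventually.of_forall fun y => prodWeight_nonneg hwK.w_nonneg hh _ _)
  have hm := (measurable_weight (p := p) (hwK.continuous_w hp).measurable h 0).ennreal_ofReal
  calc _ ≤ ∫⁻ x, ENNReal.ofReal (meanWeight Q w h x) := setLIntegral_le_lintegral _ _
    _ = ∫⁻ y, (∫⁻ x, ENNReal.ofReal (prodWeight w h (lagVec p y 0) x)) ∂Q := by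
        simp_rw [h1]
        rw [lintegral_lintegral_swap]
        exact (hm.comp measurable_swap).aemeasurable
    _ = 1 := by simp [lintegral_prodWeight hwK hp hh]

/-- The conditional mean of `K ((v - Y) / h₀)` given the lag vector. -/
def smoothCDF (κ : Kernel (Fin p → ℝ) ℝ) (K : ℝ → ℝ) (h₀ v : ℝ) (u : Fin p → ℝ) : ℝ :=
  ∫ z, K ((v - z) / h₀) ∂(κ u)

lemma KernelConditions.measurable_K (hwK : KernelConditions p w K) : Measurable K :=
  hwK.K_differentiable.continuous.measurable

lemma KernelConditions.measurable_K_sub (hwK : KernelConditions p w K) (h₀ v : ℝ) :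
    Measurable fun z : ℝ => K ((v - z) / h₀) :=
  hwK.measurable_K.comp (by fun_prop)

lemma measurable_smoothCDF (hwK : KernelConditions p w K) (h₀ v : ℝ) :
    Measurable (smoothCDF κ K h₀ v) := by
  have hm : Measurable fun a : (Fin p → ℝ) × ℝ => K ((v - a.2) / h₀) :=
    hwK.measurable_K.comp (by fun_prop)
  exact hm.stronglyMeasurable.integral_kernel_prod_right'.measurable

lemma integrable_K (hwK : KernelConditions p w K) (h₀ v : ℝ) (μ : Measure ℝ) [IsFiniteMeasure μ] :
    Integrable (fun z => K ((v - z) / h₀)) μ :=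
  Integrable.of_bound (hwK.measurable_K.comp (by fun_prop)).aestronglyMeasurable 1
    (Eventually.of_forall fun z => by
      rw [Real.norm_of_nonneg (hwK.K_nonneg _)]; exact hwK.K_le_one _)

lemma smoothCDF_mem (hwK : KernelConditions p w K) (h₀ v : ℝ) (u : Fin p → ℝ) :
    0 ≤ smoothCDF κ K h₀ v u ∧ smoothCDF κ K h₀ v u ≤ 1 := by
  refine ⟨integral_nonneg fun z => hwK.K_nonneg _, ?_⟩
  have := integral_mono (integrable_K hwK h₀ v (κ u)) (integrable_const (1 : ℝ))
    fun z => hwK.K_le_one _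
  simpa [smoothCDF] using this

/-- The martingale part of the numerator of the estimator is negligible. -/
lemma PathLaw.lintegral_martingale_le (hQ : PathLaw p κ D Q) (hwK : KernelConditions p w K)
    (hp : 1 ≤ p) [IsFiniteMeasure (volume.restrict (cube p D))] {B : ℝ} (hB0 : 0 < B)
    (hB : ∀ v, w v ≤ B) {h h₀ N η : ℝ} (hh : 0 < h) (hN : 0 < N) (hη : 0 < η) (v : ℝ) (b : ℤ)
    {l : ℕ} (hl : (l : ℝ) ≤ N) :
    ∫⁻ y, (∫⁻ x in cube p D, ‖(1 / N) * ∑ j ∈ Finset.range l,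
      prodWeight w h (lagVec p y (b + j - 1)) x *
        (K ((v - y (b + j)) / h₀) - smoothCDF κ K h₀ v (lagVec p y (b + j - 1)))‖ₑ) ∂Q ≤
      ENNReal.ofReal η * volume (cube p D) +
        ENNReal.ofReal (2 * (1 : ℕ) * (B / h) ^ p / (N * η)) := by
  have hwm := (hwK.continuous_w hp).measurable
  set ξ : ℤ → (ℤ → ℝ) → ℝ := fun i y =>
    K ((v - y i) / h₀) - smoothCDF κ K h₀ v (lagVec p y (i - 1)) with hξ
  have hξm : ∀ i, Measurable (ξ i) := fun i =>
    ((hwK.measurable_K_sub h₀ v).comp (measurable_pi_apply i)).sub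
      ((measurable_smoothCDF hwK h₀ v).comp (measurable_lagVec p _))
  have hξ1 : ∀ i y, |ξ i y| ≤ 1 := fun i y => by
    have h1 := smoothCDF_mem (κ := κ) hwK h₀ v (lagVec p y (i - 1))
    have h2 := hwK.K_nonneg ((v - y i) / h₀)
    have h3 := hwK.K_le_one ((v - y i) / h₀)
    simp only [hξ, abs_le]
    constructor <;> linarith [h1.1, h1.2]
  set a : ℕ → (ℤ → ℝ) → (Fin p → ℝ) → ℝ := fun j y x =>
    prodWeight w h (lagVec p y (b + j - 1)) x * ξ (b + j) y with ha
  have hW0 : ∀ u x : Fin p → ℝ, 0 ≤ prodWeight w h u x := prodWeight_nonneg hwK.w_nonneg hh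
  have hWB : ∀ u x : Fin p → ℝ, prodWeight w h u x ≤ (B / h) ^ p :=
    prodWeight_le hwK.w_nonneg hB hh
  have ham : ∀ j, Measurable (Function.uncurry (a j)) := fun j =>
    (measurable_weight hwm h _).mul ((hξm _).comp measurable_fst)
  have hamx : ∀ j x, Measurable fun y => a j y x := fun j x =>
    (ham j).comp measurable_prodMk_right
  have hab : ∀ j y x, |a j y x| ≤ (B / h) ^ p := fun j y x => by
    rw [ha]
    simp only [abs_mul, abs_of_nonneg (hW0 _ _)]
    calc _ ≤ (B / h) ^ p * 1 := mul_le_mul (hWB _ _) (hξ1 _ _) (abs_nonneg _) (by positivity)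
      _ = _ := mul_one _
  have hmem : ∀ j x, MemLp (fun y => a j y x) 2 Q := fun j x =>
    MemLp.of_bound (hamx j x).aestronglyMeasurable ((B / h) ^ p)
      (Eventually.of_forall fun y => hab j y x)
  refine lintegral_orthogonal_sum_le ham hmem (measurable_meanWeight (Q := Q) hwm h)
    (meanWeight_nonneg (Q := Q) hwK hh) (lintegral_meanWeight_le (Q := Q) hwK hp hh) (by positivity) ?_ ?_ hN hη hl
  -- Since the weight is at most (B/h)^p and the centred factor at most one, the square is at most
  -- (B/h)^p times the weight itself: one factor h^{-p} is lost, not two.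
  · intro j x
    rw [meanWeight, ← hQ.integral_lagVec (φ := fun u => prodWeight w h u x)
      (measurable_prodWeight_left hwm h x) (b + j - 1), ← integral_const_mul]
    refine integral_mono (hmem j x).integrable_sq
      ((integrable_weight hwK hp hh _ x).const_mul _) fun y => ?_
    have h1 : ξ (b + j) y ^ 2 ≤ 1 := (sq_le_one_iff_abs_le_one _).2 (hξ1 _ _)
    have h0 := hW0 (lagVec p y (b + j - 1)) x
    calc a j y x ^ 2 = prodWeight w h (lagVec p y (b + j - 1)) x *
          prodWeight w h (lagVec p y (b + j - 1)) x * ξ (b + j) y ^ 2 := by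
          simp only [ha]; ring
      _ ≤ (B / h) ^ p * prodWeight w h (lagVec p y (b + j - 1)) x * 1 := by
          gcongr
          exact hWB _ _
      _ = _ := mul_one _
  -- Given the past, the later factor has mean zero by the definition of `smoothCDF`, while the
  -- weight and the earlier term are determined by that past; hence orthogonality already at lag
  -- one.
  · intro i j x hij
    rw [hQ.integral_markov (b + j) (Ψ := fun y => a i y x * a j y x)
      ((hamx i x).mul (hamx j x)) ((hmem i x).integrable_mul (hmem j x))]
    · refine integral_eq_zero_of_ae (Eventually.of_forall fun y => ?_)
      have h1 : ∀ z, lagVec p (Function.update y (b + j) z) (b + j - 1) =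
          lagVec p y (b + j - 1) := fun z => dependsOn_lagVec p _ fun s hs => by
        rw [Function.update_of_ne]; have := hs.2; omega
      have h2 : ∀ z, a i (Function.update y (b + j) z) x = a i y x := by
        intro z
        have h3 : lagVec p (Function.update y (b + j) z) (b + i - 1) =
            lagVec p y (b + i - 1) := dependsOn_lagVec p _ fun s hs => by
          rw [Function.update_of_ne]; have := hs.2; omega
        simp only [ha, hξ, h3]
        rw [Function.update_of_ne]
        omega
      simp only [h2]
      simp only [ha, hξ, h1, Function.update_self, Pi.zero_apply]
      rw [integral_const_mul, integral_const_mul, integral_sub (integrable_K hwK h₀ v _)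
        (integrable_const _)]
      simp [smoothCDF]
    · have h5 : ∀ k : ℕ, k ≤ j → DependsOn (fun y => a k y x) (Set.Iic (b + j)) := by
        intro k hk y y' hy
        have h3 : lagVec p y (b + k - 1) = lagVec p y' (b + k - 1) :=
          dependsOn_lagVec p _ fun s hs =>
            hy s (by have := hs.2; simp only [Set.mem_Iic]; omega)
        simp only [ha, hξ, h3]
        rw [hy (b + k) (by simp only [Set.mem_Iic]; omega)]
      intro y y' hy
      dsimp only
      rw [show a i y x = a i y' x from h5 i (by omega) hy, show a j y x = a j y' x from h5 j le_rfl hy]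

end

end MDCP

end

/-! ### Consistency of the numerator -/

noncomputable section

set_option linter.unusedSectionVars false

namespace MDCP

section

variable {p : ℕ} {κ : Kernel (Fin p → ℝ) ℝ} [IsMarkovKernel κ] {D : Set ℝ}
  {Q : Measure (ℤ → ℝ)} [IsProbabilityMeasure Q] {w K : ℝ → ℝ}

lemma BandwidthConditions.tendsto_h₀ {h h₀ : ℕ → ℝ} (hh : BandwidthConditions p h h₀) :
    Tendsto h₀ atTop (𝓝 0) :=
  hh.comparable.isBigO.trans_tendsto hh.tendsto_zero

lemma integral_add_const_of_prob {μ : Measure ℝ} [IsProbabilityMeasure μ] {f : ℝ → ℝ}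
    (hf : Integrable f μ) (c : ℝ) : ∫ z, (f z + c) ∂μ = ∫ z, f z ∂μ + c := by
  rw [integral_add hf (integrable_const c)]
  simp

/-- The smoothed step K((v - z)/h₀) lies between the indicators of z ≤ v - η and z ≤ v + η, up to
the tails of `K` beyond η/h₀; the Lipschitz bound pays for the shift by `η`. -/
lemma abs_smoothCDF_sub_le (hwK : KernelConditions p w K) {u : Fin p → ℝ} {L : ℝ≥0}
    (hL : LipschitzWith L fun y => (κ u).real (Set.Iic y)) {h₀ η : ℝ} (hh₀ : 0 < h₀)
    (hη : 0 < η) (v : ℝ) : |smoothCDF κ K h₀ v u - (κ u).real (Set.Iic v)| ≤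
      L * η + max (K (-(η / h₀))) (1 - K (η / h₀)) := by
  have hKi := integrable_K hwK h₀ v (κ u)
  have hind : ∀ c : ℝ, Integrable ((Set.Iic c).indicator fun _ => (1 : ℝ)) (κ u) := fun c =>
    (integrable_const _).indicator measurableSet_Iic
  have hindv : ∀ c : ℝ, ∫ z, (Set.Iic c).indicator (fun _ => (1 : ℝ)) z ∂(κ u) =
      (κ u).real (Set.Iic c) := fun c => by
    rw [integral_indicator measurableSet_Iic]; simp
  have hup : smoothCDF κ K h₀ v u ≤ (κ u).real (Set.Iic (v + η)) + K (-(η / h₀)) := by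
    rw [← hindv, ← integral_add_const_of_prob (hind (v + η))]
    refine integral_mono hKi ((hind _).add (integrable_const _)) fun z => ?_
    by_cases hz : z ≤ v + η
    · simp only [Set.indicator_of_mem (show z ∈ Set.Iic (v + η) from hz)]
      linarith [hwK.K_le_one ((v - z) / h₀), hwK.K_nonneg (-(η / h₀))]
    · simp only [Set.indicator_of_notMem (show z ∉ Set.Iic (v + η) from hz), zero_add]
      refine hwK.K_mono ?_
      rw [← neg_div]
      gcongr
      linarith
  have hlo : (κ u).real (Set.Iic (v - η)) ≤ smoothCDF κ K h₀ v u + (1 - K (η / h₀)) := by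
    rw [← hindv, smoothCDF, ← integral_add_const_of_prob hKi]
    refine integral_mono (hind _) (hKi.add (integrable_const _)) fun z => ?_
    by_cases hz : z ≤ v - η
    · simp only [Set.indicator_of_mem (show z ∈ Set.Iic (v - η) from hz)]
      have : K (η / h₀) ≤ K ((v - z) / h₀) := hwK.K_mono (by gcongr; linarith)
      linarith
    · simp only [Set.indicator_of_notMem (show z ∉ Set.Iic (v - η) from hz)]
      linarith [hwK.K_nonneg ((v - z) / h₀), hwK.K_le_one (η / h₀)]
  have h1 := hL.dist_le_mul (v + η) v
  have h2 := hL.dist_le_mul v (v - η)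
  simp only [Real.dist_eq, add_sub_cancel_left, sub_sub_cancel, abs_of_pos hη] at h1 h2
  have h1' := (abs_le.1 h1).2
  have h2' := (abs_le.1 h2).2
  have h3 := le_max_left (K (-(η / h₀))) (1 - K (η / h₀))
  have h4 := le_max_right (K (-(η / h₀))) (1 - K (η / h₀))
  rw [abs_le]
  constructor <;> linarith

lemma eventually_abs_smoothCDF_sub_le (hwK : KernelConditions p w K)
    (hLip : ∃ L : ℝ≥0, ∀ x ∈ cube p D, LipschitzWith L fun y => (κ x).real (Set.Iic y))
    {h h₀ : ℕ → ℝ} (hh : BandwidthConditions p h h₀) (v : ℝ) {ε : ℝ} (hε : 0 < ε) :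
    ∀ᶠ n in atTop, ∀ u ∈ cube p D,
      |smoothCDF κ K (h₀ n) v u - (κ u).real (Set.Iic v)| ≤ ε := by
  obtain ⟨L, hL⟩ := hLip
  -- Half of `ε` goes to the Lipschitz term, half to the tails; `L + 1` guards against a zero
  -- constant.
  set η : ℝ := ε / (2 * (L + 1)) with hη
  have hη0 : 0 < η := by positivity
  have hinf : Tendsto (fun n => η / h₀ n) atTop atTop := by
    have h0 : Tendsto h₀ atTop (𝓝[>] 0) :=
      tendsto_nhdsWithin_iff.2 ⟨hh.tendsto_h₀, Eventually.of_forall hh.h₀_pos⟩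
    exact (tendsto_inv_nhdsGT_zero.comp h0).const_mul_atTop hη0
  have hK1 : ∀ᶠ n in atTop, K (-(η / h₀ n)) < ε / 2 :=
    (hwK.K_atBot.comp (tendsto_neg_atTop_atBot.comp hinf)).eventually_lt_const (by positivity)
  have hK2 : ∀ᶠ n in atTop, 1 - ε / 2 < K (η / h₀ n) :=
    (hwK.K_atTop.comp hinf).eventually_const_lt (by linarith)
  filter_upwards [hK1, hK2] with n h1 h2 u hu
  refine (abs_smoothCDF_sub_le hwK (hL u hu) (hh.h₀_pos n) hη0 v).trans ?_
  have h3 : (L : ℝ) * η ≤ ε / 2 := by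
    rw [hη, mul_div_assoc', div_le_div_iff₀ (by positivity) (by positivity)]
    nlinarith [L.2]
  have h4 : max (K (-(η / h₀ n))) (1 - K (η / h₀ n)) ≤ ε / 2 := max_le h1.le (by linarith)
  linarith

lemma measurable_condCDF (v : ℝ) : Measurable fun x => (κ x).real (Set.Iic v) :=
  (κ.measurable_coe measurableSet_Iic).ennreal_toReal

/-- The oscillation of `F(v | ·)` around the data points is negligible. -/
lemma PathLaw.tendsto_oscillation (hQ : PathLaw p κ D Q) (hwK : KernelConditions p w K)
    (hp : 1 ≤ p) (hD : MeasurableSet D) {v : ℝ}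
    (hcont : ContinuousOn (fun x => (κ x).real (Set.Iic v)) (cube p D))
    {h h₀ : ℕ → ℝ} (hh : BandwidthConditions p h h₀) :
    Tendsto (fun n => ∫⁻ y, (∫⁻ x in cube p D,
      ENNReal.ofReal (prodWeight w (h n) (lagVec p y 0) x) *
        ‖(κ (lagVec p y 0)).real (Set.Iic v) - (κ x).real (Set.Iic v)‖ₑ) ∂Q) atTop (𝓝 0) := by
  have hwm := (hwK.continuous_w hp).measurable
  have hF := measurable_condCDF (κ := κ) v
  have hcube : MeasurableSet (cube p D) := MeasurableSet.univ_pi fun _ => hD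
  -- The distribution function is continuous only within the cube; cutting off in `x` turns this
  -- into convergence along the full neighbourhood filter of `u`, so boundary points need no
  -- separate treatment.
  set H : (Fin p → ℝ) → (Fin p → ℝ) → ℝ≥0∞ := fun u x => (cube p D).indicator
    (fun x => ‖(κ u).real (Set.Iic v) - (κ x).real (Set.Iic v)‖ₑ) x with hH
  have hHm : Measurable (Function.uncurry H) := by
    have h1 : Function.uncurry H = (Set.univ ×ˢ cube p D).indicator
        fun z => ‖(κ z.1).real (Set.Iic v) - (κ z.2).real (Set.Iic v)‖ₑ := by
      classical
      funext z
      simp [Function.uncurry, hH, Set.indicator_apply]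
    rw [h1]
    exact (((hF.comp measurable_fst).sub (hF.comp measurable_snd)).enorm).indicator
      (MeasurableSet.univ.prod hcube)
  have hH1 : ∀ u x, H u x ≤ 1 := fun u x => by
    refine Set.indicator_apply_le' (fun _ => ?_) fun _ => zero_le
    rw [Real.enorm_eq_ofReal_abs, ← ENNReal.ofReal_one]
    refine ENNReal.ofReal_le_ofReal (abs_sub_le_iff.2 ⟨?_, ?_⟩)
    · linarith [measureReal_le_one (μ := κ u) (s := Set.Iic v),
        measureReal_nonneg (μ := κ x) (s := Set.Iic v)]
    · linarith [measureReal_le_one (μ := κ x) (s := Set.Iic v),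
        measureReal_nonneg (μ := κ u) (s := Set.Iic v)]
  have hX := measurable_lagVec p 0
  have : IsProbabilityMeasure (Q.map fun y => lagVec p y 0) :=
    Measure.isProbabilityMeasure_map hX.aemeasurable
  have hae : ∀ᵐ u ∂(Q.map fun y => lagVec p y 0), Tendsto (H u) (𝓝 u) (𝓝 0) := by
    have h1 : ∀ᵐ u ∂(Q.map fun y => lagVec p y 0), u ∈ cube p D := by
      rw [ae_map_iff hX.aemeasurable (p := fun u => u ∈ cube p D) hcube]
      filter_upwards [hQ.lagVec_mem] with y hy using hy 0
    filter_upwards [h1] with u hu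
    have h2 : Tendsto (fun x => ‖(κ u).real (Set.Iic v) - (κ x).real (Set.Iic v)‖ₑ)
        (𝓝[cube p D] u) (𝓝 0) := by
      have h3 : Tendsto (fun x => (κ u).real (Set.Iic v) - (κ x).real (Set.Iic v))
          (𝓝[cube p D] u) (𝓝 0) := by
        simpa using (hcont u hu).const_sub ((κ u).real (Set.Iic v))
      simpa [Function.comp_def] using (continuous_enorm.tendsto (0 : ℝ)).comp h3
    rw [ENNReal.tendsto_nhds_zero] at h2 ⊢
    intro ε hε
    have h4 := h2 ε hε
    rw [eventually_nhdsWithin_iff] at h4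
    filter_upwards [h4] with x hx
    exact Set.indicator_apply_le' hx fun _ => zero_le
  refine (tendsto_lintegral_prodWeight_mul hwK hp hh.h_pos hh.tendsto_zero
    (Q.map fun y => lagVec p y 0) hHm hH1 hae).congr fun n => ?_
  have hm2 : Measurable fun z : (Fin p → ℝ) × (Fin p → ℝ) =>
      ENNReal.ofReal (prodWeight w (h n) z.1 z.2) * H z.1 z.2 :=
    (measurable_prodWeight hwm _).ennreal_ofReal.mul hHm
  rw [lintegral_map hm2.lintegral_prod_right' hX]
  refine lintegral_congr fun y => ?_
  rw [← lintegral_indicator hcube]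
  refine lintegral_congr fun x => ?_
  by_cases hx : x ∈ cube p D <;> simp [hH, hx]

lemma lintegral_lintegral_add_sum {α β : Type*} [MeasurableSpace α] [MeasurableSpace β]
    {μ : Measure α} {ν : Measure β} [SFinite μ] [SFinite ν] {f : α × β → ℝ≥0∞}
    {f₁ f₂ : ℕ → α × β → ℝ≥0∞} (hf : Measurable f) (hf₁ : ∀ j, Measurable (f₁ j))
    (hf₂ : ∀ j, Measurable (f₂ j)) {c : ℝ≥0∞} (hc : c ≠ ∞) (l : ℕ) :
    ∫⁻ y, (∫⁻ x, (f (y, x) + c * ∑ j ∈ Finset.range l, (f₁ j (y, x) + f₂ j (y, x))) ∂ν) ∂μ =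
      ∫⁻ y, (∫⁻ x, f (y, x) ∂ν) ∂μ + c * ∑ j ∈ Finset.range l,
        (∫⁻ y, (∫⁻ x, f₁ j (y, x) ∂ν) ∂μ + ∫⁻ y, (∫⁻ x, f₂ j (y, x) ∂ν) ∂μ) := by
  have hs : Measurable fun z : α × β => c * ∑ j ∈ Finset.range l, (f₁ j z + f₂ j z) :=
    (Finset.measurable_fun_sum _ fun j _ => (hf₁ j).add (hf₂ j)).const_mul c
  rw [← lintegral_prod _ hf.aemeasurable]
  simp_rw [← fun j => lintegral_prod (μ := μ) (ν := ν) _ (hf₁ j).aemeasurable,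
    ← fun j => lintegral_prod (μ := μ) (ν := ν) _ (hf₂ j).aemeasurable]
  rw [← lintegral_prod (fun z => f z + c * ∑ j ∈ Finset.range l, (f₁ j z + f₂ j z))
    (hf.add hs).aemeasurable, lintegral_add_left hf, lintegral_const_mul' _ _ hc]
  congr 2
  rw [lintegral_finsetSum (f := fun j z => f₁ j z + f₂ j z) _ fun j _ => (hf₁ j).add (hf₂ j)]
  exact Finset.sum_congr rfl fun j _ => lintegral_add_left (hf₁ j) _

/-- Consistency of the numerator of the estimator, centred at `F(v | x)`, uniformly over blocks of
data. -/
lemma PathLaw.eventually_numerator_le (hQ : PathLaw p κ D Q) (hwK : KernelConditions p w K)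
    (hp : 1 ≤ p) (hD : MeasurableSet D) [IsFiniteMeasure (volume.restrict (cube p D))] {v : ℝ}
    (hcont : ContinuousOn (fun x => (κ x).real (Set.Iic v)) (cube p D))
    (hLip : ∃ L : ℝ≥0, ∀ x ∈ cube p D, LipschitzWith L fun y => (κ x).real (Set.Iic y))
    {h h₀ : ℕ → ℝ} (hh : BandwidthConditions p h h₀) {ε : ℝ≥0∞} (hε : 0 < ε) :
    ∀ᶠ n in atTop, ∀ (b : ℤ) (l : ℕ), (l : ℝ) ≤ sampleSize p n →
      ∫⁻ y, (∫⁻ x in cube p D, ‖(1 / sampleSize p n) * ∑ j ∈ Finset.range l,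
        prodWeight w (h n) (lagVec p y (b + j - 1)) x *
          (K ((v - y (b + j)) / h₀ n) - (κ x).real (Set.Iic v))‖ₑ) ∂Q ≤ ε := by
  have hwm := (hwK.continuous_w hp).measurable
  have hF := measurable_condCDF (κ := κ) v
  obtain ⟨B, hB0, hB⟩ := hwK.exists_bound
  have hcube : MeasurableSet (cube p D) := MeasurableSet.univ_pi fun _ => hD
  set Λ : ℝ≥0∞ := volume (cube p D) with hΛ
  have hΛfin : Λ ≠ ∞ := by
    have := measure_lt_top (volume.restrict (cube p D)) Set.univ
    rw [Measure.restrict_apply_univ] at this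
    exact this.ne
  wlog hεfin : ε ≠ ∞ generalizing ε
  · filter_upwards [this (ε := 1) one_pos ENNReal.one_ne_top] with n hn b l hl
    rw [not_not.1 hεfin]; exact le_top
  set e : ℝ := ε.toReal / 4 with he
  have he0 : 0 < e := div_pos (ENNReal.toReal_pos hε.ne' hεfin) (by norm_num)
  have hεe : ε = ENNReal.ofReal e + ENNReal.ofReal e + (ENNReal.ofReal e + ENNReal.ofReal e) := by
    rw [← ENNReal.ofReal_add he0.le he0.le, ← ENNReal.ofReal_add (by positivity) (by positivity),
      show e + e + (e + e) = ε.toReal by rw [he]; ring, ENNReal.ofReal_toReal hεfin]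
  set η : ℝ := e / (Λ.toReal + 1) with hη
  have hΛ0 : 0 ≤ Λ.toReal := ENNReal.toReal_nonneg
  have hη0 : 0 < η := by positivity
  have hηΛ : ENNReal.ofReal η * Λ ≤ ENNReal.ofReal e := by
    rw [← ENNReal.ofReal_toReal hΛfin, ← ENNReal.ofReal_mul hη0.le]
    refine ENNReal.ofReal_le_ofReal ?_
    rw [hη, div_mul_eq_mul_div, div_le_iff₀ (by positivity)]
    nlinarith
  have hN : ∀ᶠ n : ℕ in atTop, 0 < sampleSize p n := by
    filter_upwards [eventually_ge_atTop p] with n hn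
    have : (p : ℝ) ≤ n := by exact_mod_cast hn
    simp only [sampleSize]; linarith
  -- The divergence of N h^p makes the variance term at most `e`.
  have hNh : ∀ᶠ n in atTop, 2 * B ^ p / (η * e) ≤ sampleSize p n * h n ^ p :=
    hh.tendsto_infty.eventually_ge_atTop _
  have hosc := ENNReal.tendsto_nhds_zero.1 (hQ.tendsto_oscillation hwK hp hD hcont hh)
    (ENNReal.ofReal e) (ENNReal.ofReal_pos.2 he0)
  filter_upwards [hN, hNh, hosc, eventually_abs_smoothCDF_sub_le hwK hLip hh v he0]
    with n hN hNh hosc hsm b l hl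
  set N := sampleSize p n with hNdef
  have hhn := hh.h_pos n
  have hmart := hQ.lintegral_martingale_le hwK hp hB0 hB (h₀ := h₀ n) hhn hN hη0 v b hl
  set W : ℕ → (ℤ → ℝ) → (Fin p → ℝ) → ℝ := fun j y x =>
    prodWeight w (h n) (lagVec p y (b + j - 1)) x with hW
  have hW0 : ∀ j y x, 0 ≤ W j y x := fun j y x => prodWeight_nonneg hwK.w_nonneg hhn _ _
  have hWm : ∀ j, Measurable fun z : (ℤ → ℝ) × (Fin p → ℝ) => W j z.1 z.2 := fun j =>
    measurable_weight hwm (h n) _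
  set k := smoothCDF κ K (h₀ n) v with hk
  have hkm : Measurable k := measurable_smoothCDF hwK (h₀ n) v
  have hpt : ∀ᵐ y ∂Q, ∀ x, ‖(1 / N) * ∑ j ∈ Finset.range l, W j y x *
      (K ((v - y (b + j)) / h₀ n) - (κ x).real (Set.Iic v))‖ₑ ≤
      ‖(1 / N) * ∑ j ∈ Finset.range l, W j y x *
        (K ((v - y (b + j)) / h₀ n) - k (lagVec p y (b + j - 1)))‖ₑ +
      ENNReal.ofReal (1 / N) * ∑ j ∈ Finset.range l, (ENNReal.ofReal e * ENNReal.ofReal (W j y x) +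
        ENNReal.ofReal (W j y x) * ‖(κ (lagVec p y (b + j - 1))).real (Set.Iic v) -
          (κ x).real (Set.Iic v)‖ₑ) := by
    filter_upwards [hQ.lagVec_mem] with y hy x
    -- Insert the conditional mean `k` of the smoothed step, then F(v | ·), both at the data point:
    -- martingale difference, smoothing bias, oscillation.
    have h1 : (1 / N) * ∑ j ∈ Finset.range l, W j y x *
        (K ((v - y (b + j)) / h₀ n) - (κ x).real (Set.Iic v)) =
        (1 / N) * ∑ j ∈ Finset.range l, W j y x *
          (K ((v - y (b + j)) / h₀ n) - k (lagVec p y (b + j - 1))) +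
        (1 / N) * ∑ j ∈ Finset.range l, (W j y x *
          (k (lagVec p y (b + j - 1)) - (κ (lagVec p y (b + j - 1))).real (Set.Iic v)) +
          W j y x * ((κ (lagVec p y (b + j - 1))).real (Set.Iic v) - (κ x).real (Set.Iic v))) := by
      rw [← mul_add, ← Finset.sum_add_distrib]
      congr 1
      exact Finset.sum_congr rfl fun j _ => by ring
    rw [h1]
    refine (enorm_add_le _ _).trans (add_le_add le_rfl ?_)
    rw [enorm_mul, Real.enorm_of_nonneg (by positivity)]
    gcongr
    refine (enorm_sum_le _ _).trans (Finset.sum_le_sum fun j _ => (enorm_add_le _ _).trans ?_)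
    rw [enorm_mul, enorm_mul, Real.enorm_of_nonneg (hW0 _ _ _), mul_comm (ENNReal.ofReal e)]
    gcongr
    rw [Real.enorm_eq_ofReal_abs]
    exact ENNReal.ofReal_le_ofReal (hsm _ (hy _))
  have hm1 : Measurable fun z : (ℤ → ℝ) × (Fin p → ℝ) =>
      ‖(1 / N) * ∑ j ∈ Finset.range l, W j z.1 z.2 *
        (K ((v - z.1 (b + j)) / h₀ n) - k (lagVec p z.1 (b + j - 1)))‖ₑ := by
    refine ((Finset.measurable_fun_sum _ fun j _ => (hWm j).mul (Measurable.sub ?_ ?_)).const_mul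
      _).enorm
    · exact (hwK.measurable_K_sub _ v).comp ((measurable_pi_apply _).comp measurable_fst)
    · exact hkm.comp ((measurable_lagVec p _).comp measurable_fst)
  have hm2 : ∀ j, Measurable fun z : (ℤ → ℝ) × (Fin p → ℝ) =>
      ENNReal.ofReal e * ENNReal.ofReal (W j z.1 z.2) := fun j =>
    (hWm j).ennreal_ofReal.const_mul _
  have hm3 : ∀ j, Measurable fun z : (ℤ → ℝ) × (Fin p → ℝ) =>
      ENNReal.ofReal (W j z.1 z.2) * ‖(κ (lagVec p z.1 (b + j - 1))).real (Set.Iic v) -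
          (κ z.2).real (Set.Iic v)‖ₑ := fun j =>
    (hWm j).ennreal_ofReal.mul ((hF.comp ((measurable_lagVec p _).comp measurable_fst)).sub
      (hF.comp measurable_snd)).enorm
  have hint2 : ∀ j, ∫⁻ y, (∫⁻ x in cube p D, ENNReal.ofReal e * ENNReal.ofReal (W j y x)) ∂Q ≤
      ENNReal.ofReal e := by
    intro j
    calc _ ≤ ∫⁻ y, ENNReal.ofReal e ∂Q := by
          refine lintegral_mono fun y => ?_
          refine (lintegral_const_mul _
            ((hWm j).comp measurable_prodMk_left).ennreal_ofReal).trans_le ?_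
          refine mul_le_of_le_one_right' ?_
          rw [← lintegral_prodWeight hwK hp hhn (lagVec p y (b + j - 1))]
          exact setLIntegral_le_lintegral _ _
      _ = _ := by simp
  have hint3 : ∀ j : ℕ, ∫⁻ y, (∫⁻ x in cube p D, ENNReal.ofReal (W j y x) *
      ‖(κ (lagVec p y (b + j - 1))).real (Set.Iic v) - (κ x).real (Set.Iic v)‖ₑ) ∂Q ≤
      ENNReal.ofReal e := by
    intro j
    have hφ : Measurable fun u : Fin p → ℝ => ∫⁻ x in cube p D,
        ENNReal.ofReal (prodWeight w (h n) u x) *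
          ‖(κ u).real (Set.Iic v) - (κ x).real (Set.Iic v)‖ₑ :=
      Measurable.lintegral_prod_right' (f := fun z : (Fin p → ℝ) × (Fin p → ℝ) =>
        ENNReal.ofReal (prodWeight w (h n) z.1 z.2) *
          ‖(κ z.1).real (Set.Iic v) - (κ z.2).real (Set.Iic v)‖ₑ)
        ((measurable_prodWeight hwm _).ennreal_ofReal.mul
          ((hF.comp measurable_fst).sub (hF.comp measurable_snd)).enorm)
    have := hQ.lintegral_lagVec hφ (b + j - 1)
    simp only [hW]
    rw [this]
    exact hosc
  calc _ ≤ ∫⁻ y, (∫⁻ x in cube p D, (‖(1 / N) * ∑ j ∈ Finset.range l, W j y x *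
        (K ((v - y (b + j)) / h₀ n) - k (lagVec p y (b + j - 1)))‖ₑ +
      ENNReal.ofReal (1 / N) * ∑ j ∈ Finset.range l, (ENNReal.ofReal e * ENNReal.ofReal (W j y x) +
        ENNReal.ofReal (W j y x) * ‖(κ (lagVec p y (b + j - 1))).real (Set.Iic v) -
          (κ x).real (Set.Iic v)‖ₑ))) ∂Q := by
        refine lintegral_mono_ae ?_
        filter_upwards [hpt] with y hy
        exact lintegral_mono fun x => hy x
    _ = ∫⁻ y, (∫⁻ x in cube p D, ‖(1 / N) * ∑ j ∈ Finset.range l, W j y x *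
        (K ((v - y (b + j)) / h₀ n) - k (lagVec p y (b + j - 1)))‖ₑ) ∂Q +
        ENNReal.ofReal (1 / N) * ∑ j ∈ Finset.range l,
          (∫⁻ y, (∫⁻ x in cube p D, ENNReal.ofReal e * ENNReal.ofReal (W j y x)) ∂Q +
          ∫⁻ y, (∫⁻ x in cube p D, ENNReal.ofReal (W j y x) *
            ‖(κ (lagVec p y (b + j - 1))).real (Set.Iic v) - (κ x).real (Set.Iic v)‖ₑ) ∂Q) := by
        exact lintegral_lintegral_add_sum hm1 hm2 hm3 ENNReal.ofReal_ne_top l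
    _ ≤ (ENNReal.ofReal e + ENNReal.ofReal e) + (ENNReal.ofReal e + ENNReal.ofReal e) := by
        refine add_le_add (hmart.trans (add_le_add hηΛ (ENNReal.ofReal_le_ofReal ?_))) ?_
        · rw [Nat.cast_one, mul_one, div_pow, mul_div_assoc', div_div, div_le_iff₀ (by positivity)]
          rw [div_le_iff₀ (by positivity)] at hNh
          nlinarith
        · calc _ ≤ ENNReal.ofReal (1 / N) * ∑ j ∈ Finset.range l,
                (ENNReal.ofReal e + ENNReal.ofReal e) := by
                gcongr with j
                · exact hint2 j
                · exact hint3 j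
            _ = ENNReal.ofReal (1 / N) * ENNReal.ofReal l *
                (ENNReal.ofReal e + ENNReal.ofReal e) := by
                rw [Finset.sum_const, Finset.card_range, nsmul_eq_mul, ENNReal.ofReal_natCast,
                  mul_assoc]
            _ ≤ _ := by
                refine mul_le_of_le_one_left' ?_
                rw [← ENNReal.ofReal_mul (by positivity), ← ENNReal.ofReal_one]
                refine ENNReal.ofReal_le_ofReal ?_
                rw [one_div, inv_mul_le_iff₀ hN, mul_one]
                exact hl
    _ = ε := hεe.symm

end

end MDCP

end

/-! ### Conditional densities given the past, and centred kernel weights -/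

noncomputable section

set_option linter.unusedSectionVars false

namespace MDCP

section

variable {p : ℕ} {κ : Kernel (Fin p → ℝ) ℝ} [IsMarkovKernel κ] {D : Set ℝ}
  {Q : Measure (ℤ → ℝ)} [IsProbabilityMeasure Q] {w K : ℝ → ℝ}

/-- `u (y, ·)` is a density on `D^p` of the lag vector at time `p`, given the values of the series
up to time `0`. -/
structure IsBlockDensity (p : ℕ) (D : Set ℝ) (Q : Measure (ℤ → ℝ))
    (u : (ℤ → ℝ) × (Fin p → ℝ) → ℝ) : Prop where
  measurable : Measurable u
  nonneg : ∀ z, 0 ≤ u z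
  lintegral_le : ∀ y, ∫⁻ x in cube p D, ENNReal.ofReal (u (y, x)) ≤ 1
  integral_eq : ∀ Φ : (ℤ → ℝ) × (Fin p → ℝ) → ℝ, Measurable Φ →
    Integrable (fun y => Φ (y, lagVec p y p)) Q →
    (∀ x, DependsOn (fun y => Φ (y, x)) (Set.Iic 0)) →
    ∫ y, Φ (y, lagVec p y p) ∂Q = ∫ y, (∫ x in cube p D, u (y, x) * Φ (y, x)) ∂Q
  dependsOn : ∀ x, DependsOn (fun y => u (y, x)) (Set.Iic 0)

/-- A version of the Radon–Nikodym derivative of the joint law of past and lag vector, modified so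
that the mass bound and the dependence on the past hold everywhere and not just almost everywhere.
-/
lemma PathLaw.exists_blockDensity (hQ : PathLaw p κ D Q)
    [IsFiniteMeasure (volume.restrict (cube p D))] : ∃ u, IsBlockDensity p D Q u := by
  set lam : Measure (Fin p → ℝ) := volume.restrict (cube p D) with hlam
  have htr := measurable_truncSeq 0
  set μ₀ := Q.map (truncSeq 0) with hμ₀
  have : IsProbabilityMeasure μ₀ := Measure.isProbabilityMeasure_map htr.aemeasurable
  have hpair : Measurable fun y : ℤ → ℝ => (truncSeq 0 y, lagVec p y p) :=
    htr.prodMk (measurable_lagVec p p)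
  set ρ := Q.map (fun y => (truncSeq 0 y, lagVec p y p)) with hρ
  have : IsProbabilityMeasure ρ := Measure.isProbabilityMeasure_map hpair.aemeasurable
  set r := ρ.rnDeriv (μ₀.prod lam) with hr
  have hrm : Measurable r := Measure.measurable_rnDeriv _ _
  have hρr : (μ₀.prod lam).withDensity r = ρ :=
    Measure.withDensity_rnDeriv_eq _ _ (hQ.map_past_block_ac p)
  have hI : Measurable fun q => ∫⁻ x, r (q, x) ∂lam := hrm.lintegral_prod_right'
  -- The first marginal of the joint law is the law of the past itself.
  have hone : ∀ᵐ q ∂μ₀, ∫⁻ x, r (q, x) ∂lam = 1 := by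
    refine ae_eq_of_forall_setLIntegral_eq_of_sigmaFinite hI measurable_const fun A hA _ => ?_
    have h1 : ρ (A ×ˢ Set.univ) = μ₀ A := by
      rw [hρ, hμ₀, Measure.map_apply hpair (hA.prod MeasurableSet.univ), Measure.map_apply htr hA]
      congr 1
      ext y
      simp
    rw [← hρr, withDensity_apply _ (hA.prod MeasurableSet.univ), ← Measure.prod_restrict,
      Measure.restrict_univ, lintegral_prod _ hrm.aemeasurable] at h1
    rw [h1]
    simp
  -- Discarding the null set of pasts with excessive mass makes the bound hold at every point.
  set G : Set (ℤ → ℝ) := {q | ∫⁻ x, r (q, x) ∂lam ≤ 1} with hG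
  have hGm : MeasurableSet G := measurableSet_le hI measurable_const
  set u₀ : (ℤ → ℝ) × (Fin p → ℝ) → ℝ := fun z =>
    G.indicator (fun _ => (r z).toReal) z.1 with hu₀
  have hu₀m : Measurable u₀ := by
    have : u₀ = (G ×ˢ Set.univ).indicator fun z => (r z).toReal := by
      classical
      funext z
      simp [hu₀, Set.indicator_apply]
    rw [this]
    exact hrm.ennreal_toReal.indicator (hGm.prod MeasurableSet.univ)
  have hu₀n : ∀ z, 0 ≤ u₀ z := fun z => Set.indicator_nonneg (fun _ _ => ENNReal.toReal_nonneg) _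
  have hu₀r : (fun z => ENNReal.ofReal (u₀ z)) =ᵐ[μ₀.prod lam] r := by
    have h1 : ∀ᵐ z ∂(μ₀.prod lam), z.1 ∈ G :=
      Measure.quasiMeasurePreserving_fst.ae (hone.mono fun q hq => hq.le)
    filter_upwards [h1, Measure.rnDeriv_lt_top ρ (μ₀.prod lam)] with z hz hz'
    simp only [hu₀, Set.indicator_of_mem hz]
    exact ENNReal.ofReal_toReal hz'.ne
  have hρu : (μ₀.prod lam).withDensity (fun z => ENNReal.ofReal (u₀ z)) = ρ := by
    rw [withDensity_congr_ae hu₀r, hρr]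
  have htrid : ∀ (x : Fin p → ℝ) (Φ : (ℤ → ℝ) × (Fin p → ℝ) → ℝ),
      (∀ x, DependsOn (fun y => Φ (y, x)) (Set.Iic 0)) → ∀ y, Φ (truncSeq 0 y, x) = Φ (y, x) :=
    fun x Φ hdep y => hdep x fun s hs => truncSeq_of_le hs y
  refine ⟨fun z => u₀ (truncSeq 0 z.1, z.2), ?_, fun z => hu₀n _, fun y => ?_,
    fun Φ hΦ hint hdep => ?_, fun x y y' hy => ?_⟩
  · exact hu₀m.comp ((htr.comp measurable_fst).prodMk measurable_snd)
  · by_cases hy : truncSeq 0 y ∈ G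
    · refine le_trans (lintegral_mono fun x => ?_) hy
      simp only [hu₀, Set.indicator_of_mem hy]
      exact ENNReal.ofReal_toReal_le
    · simp [hu₀, Set.indicator_of_notMem hy]
  · have h1 : ∫ y, Φ (y, lagVec p y p) ∂Q = ∫ z, Φ z ∂ρ := by
      rw [hρ, integral_map hpair.aemeasurable hΦ.aestronglyMeasurable]
      exact integral_congr_ae (Eventually.of_forall fun y => (htrid _ Φ hdep y).symm)
    have hintρ : Integrable Φ ρ := by
      rw [hρ, integrable_map_measure hΦ.aestronglyMeasurable hpair.aemeasurable]
      exact hint.congr (Eventually.of_forall fun y => (htrid _ Φ hdep y).symm)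
    rw [← hρu, integrable_withDensity_iff_integrable_smul' hu₀m.ennreal_ofReal
      (Eventually.of_forall fun _ => ENNReal.ofReal_lt_top)] at hintρ
    rw [h1, ← hρu, integral_withDensity_eq_integral_toReal_smul hu₀m.ennreal_ofReal
      (Eventually.of_forall fun _ => ENNReal.ofReal_lt_top), integral_prod _ hintρ, hμ₀,
      integral_map htr.aemeasurable]
    · refine integral_congr_ae (Eventually.of_forall fun y => ?_)
      refine integral_congr_ae (Eventually.of_forall fun x => ?_)
      simp only [ENNReal.toReal_ofReal (hu₀n _), smul_eq_mul, htrid x Φ hdep y]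
    · have : Measurable fun z => (ENNReal.ofReal (u₀ z)).toReal • Φ z :=
        hu₀m.ennreal_ofReal.ennreal_toReal.smul hΦ
      exact this.stronglyMeasurable.integral_prod_right'.aestronglyMeasurable
  · have : truncSeq 0 y = truncSeq 0 y' := by
      funext s
      unfold truncSeq
      split_ifs with hs
      · exact hy s hs
      · rfl
    simp only [this]

/-- The density of the lag vectors on `D^p`. -/
def marginalDensity (p : ℕ) (D : Set ℝ) (Q : Measure (ℤ → ℝ))
    (u : (ℤ → ℝ) × (Fin p → ℝ) → ℝ) (x : Fin p → ℝ) : ℝ :=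
  (cube p D).indicator (fun x => ∫ y, u (y, x) ∂Q) x

variable {u : (ℤ → ℝ) × (Fin p → ℝ) → ℝ}

lemma IsBlockDensity.integrable (hu : IsBlockDensity p D Q u) :
    Integrable u (Q.prod (volume.restrict (cube p D))) := by
  refine ⟨hu.measurable.aestronglyMeasurable, ?_⟩
  rw [hasFiniteIntegral_iff_ofReal (Eventually.of_forall hu.nonneg),
    lintegral_prod _ hu.measurable.ennreal_ofReal.aemeasurable]
  calc _ ≤ ∫⁻ _, 1 ∂Q := lintegral_mono fun y => hu.lintegral_le y
    _ < ∞ := by simp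

lemma IsBlockDensity.integrable_section (hu : IsBlockDensity p D Q u) (y : ℤ → ℝ) :
    IntegrableOn (fun x => u (y, x)) (cube p D) := by
  refine ⟨(hu.measurable.comp measurable_prodMk_left).aestronglyMeasurable, ?_⟩
  rw [hasFiniteIntegral_iff_ofReal (Eventually.of_forall fun x => hu.nonneg _)]
  exact (hu.lintegral_le y).trans_lt ENNReal.one_lt_top

lemma IsBlockDensity.integral_section_le (hu : IsBlockDensity p D Q u) (y : ℤ → ℝ) :
    ∫ x in cube p D, u (y, x) ≤ 1 := by
  rw [integral_eq_lintegral_of_nonneg_ae (Eventually.of_forall fun x => hu.nonneg _)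
    (hu.integrable_section y).1]
  exact ENNReal.toReal_le_of_le_ofReal zero_le_one (by simpa using hu.lintegral_le y)

lemma IsBlockDensity.measurable_marginal (hu : IsBlockDensity p D Q u) (hD : MeasurableSet D) :
    Measurable (marginalDensity p D Q u) :=
  (hu.measurable.stronglyMeasurable.integral_prod_left'.measurable).indicator
    (MeasurableSet.univ_pi fun _ => hD)

lemma IsBlockDensity.integrable_marginal (hu : IsBlockDensity p D Q u) (hD : MeasurableSet D) :
    Integrable (marginalDensity p D Q u) := by
  have h := hu.integrable.swap.integral_prod_left
  exact (integrable_indicator_iff (f := fun x => ∫ y, u (y, x) ∂Q)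
    (MeasurableSet.univ_pi fun _ => hD)).2 h

/-- The law of the lag vectors has density `marginalDensity`, so it does not charge the set where
this density is nonpositive. This is what permits division by the limit of the denominator. -/
lemma IsBlockDensity.marginal_pos (hu : IsBlockDensity p D Q u) (hQ : PathLaw p κ D Q)
    (hD : MeasurableSet D) [IsFiniteMeasure (volume.restrict (cube p D))] :
    ∀ᵐ y ∂Q, ∀ t, 0 < marginalDensity p D Q u (lagVec p y t) := by
  set g := marginalDensity p D Q u with hg
  have hgm : Measurable g := hu.measurable_marginal hD
  have hcube : MeasurableSet (cube p D) := MeasurableSet.univ_pi fun _ => hD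
  set A : Set (Fin p → ℝ) := {x | g x ≤ 0} with hA
  have hAm : MeasurableSet A := measurableSet_le hgm measurable_const
  have hp : Q {y | lagVec p y p ∈ A} = 0 := by
    have hm : MeasurableSet {y : ℤ → ℝ | lagVec p y p ∈ A} := measurable_lagVec p p hAm
    have h1 := hu.integral_eq (fun z => A.indicator (fun _ => (1 : ℝ)) z.2)
      ((measurable_const.indicator hAm).comp measurable_snd)
      ((integrable_const (1 : ℝ)).indicator hm) (fun x y y' _ => rfl)
    have h2 : ∫ y, A.indicator (fun _ => (1 : ℝ)) (lagVec p y p) ∂Q =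
        Q.real {y | lagVec p y p ∈ A} := by
      have : (fun y => A.indicator (fun _ => (1 : ℝ)) (lagVec p y p)) =
          {y | lagVec p y p ∈ A}.indicator fun _ => (1 : ℝ) := rfl
      rw [this, integral_indicator hm]
      simp
    have hint : Integrable (Function.uncurry fun y x => u (y, x) * A.indicator
        (fun _ => (1 : ℝ)) x) (Q.prod (volume.restrict (cube p D))) := by
      refine hu.integrable.mul_bdd (c := 1) ((measurable_const.indicator hAm).comp
        measurable_snd).aestronglyMeasurable (Eventually.of_forall fun z => ?_)
      exact (norm_indicator_le_norm_self _ _).trans (by simp)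
    have h3 : ∫ y, (∫ x in cube p D, u (y, x) * A.indicator (fun _ => (1 : ℝ)) x) ∂Q ≤ 0 := by
      rw [integral_integral_swap hint]
      refine setIntegral_nonpos hcube fun x hx => ?_
      rw [integral_mul_const]
      by_cases hxA : x ∈ A
      · have : g x ≤ 0 := hxA
        rw [hg, marginalDensity, Set.indicator_of_mem hx] at this
        simpa [hxA] using this
      · simp [hxA]
    rw [h2] at h1
    have h4 : Q.real {y | lagVec p y p ∈ A} = 0 := le_antisymm (h1.trans_le h3) measureReal_nonneg
    exact (measureReal_eq_zero_iff).1 h4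
  rw [ae_all_iff]
  intro t
  have h5 := (hQ.shift (t - p)).quasiMeasurePreserving.ae
    (show ∀ᵐ y ∂Q, lagVec p y p ∉ A from measure_eq_zero_iff_ae_notMem.1 hp)
  filter_upwards [h5] with y hy
  rw [lagVec_shiftSeq, add_sub_cancel] at hy
  exact not_le.1 hy

/-- The mean weight given the past. -/
def compensator (p : ℕ) (D : Set ℝ) (u : (ℤ → ℝ) × (Fin p → ℝ) → ℝ) (w : ℝ → ℝ) (h : ℝ)
    (y : ℤ → ℝ) (x : Fin p → ℝ) : ℝ :=
  ∫ x' in cube p D, u (y, x') * prodWeight w h x' x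

lemma measurable_compensator (hu : IsBlockDensity p D Q u) (hw : Measurable w) (h : ℝ) :
    Measurable fun z : (ℤ → ℝ) × (Fin p → ℝ) => compensator p D u w h z.1 z.2 := by
  have : Measurable fun a : ((ℤ → ℝ) × (Fin p → ℝ)) × (Fin p → ℝ) =>
      u (a.1.1, a.2) * prodWeight w h a.2 a.1.2 :=
    (hu.measurable.comp ((measurable_fst.comp measurable_fst).prodMk measurable_snd)).mul
      ((measurable_prodWeight hw h).comp (measurable_snd.prodMk
        (measurable_snd.comp measurable_fst)))
  exact this.stronglyMeasurable.integral_prod_right'.measurable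

lemma compensator_nonneg (hu : IsBlockDensity p D Q u) (hwK : KernelConditions p w K) {h : ℝ}
    (hh : 0 < h) (y : ℤ → ℝ) (x : Fin p → ℝ) : 0 ≤ compensator p D u w h y x :=
  integral_nonneg fun _ => mul_nonneg (hu.nonneg _) (prodWeight_nonneg hwK.w_nonneg hh _ _)

lemma integrable_section_mul_weight (hu : IsBlockDensity p D Q u) (hwK : KernelConditions p w K)
    (hp : 1 ≤ p) {h : ℝ} (hh : 0 < h) (y : ℤ → ℝ) (x : Fin p → ℝ) :
    IntegrableOn (fun x' => u (y, x') * prodWeight w h x' x) (cube p D) := by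
  obtain ⟨B, -, hB⟩ := hwK.exists_bound
  refine (hu.integrable_section y).mul_bdd (c := (B / h) ^ p)
    (measurable_prodWeight_left (hwK.continuous_w hp).measurable h x).aestronglyMeasurable
    (Eventually.of_forall fun x' => ?_)
  rw [Real.norm_of_nonneg (prodWeight_nonneg hwK.w_nonneg hh _ _)]
  exact prodWeight_le hwK.w_nonneg hB hh _ _

lemma compensator_le (hu : IsBlockDensity p D Q u) (hwK : KernelConditions p w K) (hp : 1 ≤ p)
    {B : ℝ} (hB0 : 0 < B) (hB : ∀ v, w v ≤ B) {h : ℝ} (hh : 0 < h) (y : ℤ → ℝ)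
    (x : Fin p → ℝ) : compensator p D u w h y x ≤ (B / h) ^ p := by
  calc compensator p D u w h y x ≤ ∫ x' in cube p D, u (y, x') * (B / h) ^ p := by
        refine integral_mono (integrable_section_mul_weight hu hwK hp hh y x)
          ((hu.integrable_section y).mul_const _) fun x' => ?_
        exact mul_le_mul_of_nonneg_left (prodWeight_le hwK.w_nonneg hB hh _ _) (hu.nonneg _)
    _ ≤ 1 * (B / h) ^ p := by
        rw [integral_mul_const]
        gcongr
        exact hu.integral_section_le y
    _ = _ := one_mul _

lemma integral_compensator (hu : IsBlockDensity p D Q u) (hQ : PathLaw p κ D Q)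
    (hwK : KernelConditions p w K) (hp : 1 ≤ p) {h : ℝ} (hh : 0 < h) (x : Fin p → ℝ) :
    ∫ y, compensator p D u w h y x ∂Q = meanWeight Q w h x := by
  have hm := measurable_prodWeight_left (hwK.continuous_w hp).measurable h x
  have h1 := hu.integral_eq (fun z => prodWeight w h z.2 x) (hm.comp measurable_snd)
    (integrable_weight hwK hp hh p x) (fun x y y' _ => rfl)
  rw [meanWeight, ← hQ.integral_lagVec (φ := fun u => prodWeight w h u x) hm p, h1]
  rfl

/-- The weights, centred at their means given the distant past, are negligible. -/
lemma PathLaw.lintegral_centred_weights_le (hQ : PathLaw p κ D Q) (hu : IsBlockDensity p D Q u)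
    (hwK : KernelConditions p w K) (hp : 1 ≤ p) [IsFiniteMeasure (volume.restrict (cube p D))]
    {B : ℝ} (hB0 : 0 < B) (hB : ∀ v, w v ≤ B) {h N η : ℝ} (hh : 0 < h) (hN : 0 < N) (hη : 0 < η)
    (s : ℤ) {l : ℕ} (hl : (l : ℝ) ≤ N) :
    ∫⁻ y, (∫⁻ x in cube p D, ‖(1 / N) * ∑ j ∈ Finset.range l,
      (prodWeight w h (lagVec p y (p + (s + j))) x -
        compensator p D u w h (shiftSeq (s + j) y) x)‖ₑ) ∂Q ≤
      ENNReal.ofReal η * volume (cube p D) +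
        ENNReal.ofReal (2 * p * (2 * (B / h) ^ p) / (N * η)) := by
  have hwm := (hwK.continuous_w hp).measurable
  set M := (B / h) ^ p with hM
  have hM0 : 0 ≤ M := by positivity
  obtain ⟨c, hc⟩ : ∃ c, c = compensator p D u w h := ⟨_, rfl⟩
  have hcm : Measurable fun z : (ℤ → ℝ) × (Fin p → ℝ) => c z.1 z.2 := by
    rw [hc]; exact measurable_compensator hu hwm h
  obtain ⟨b, hb⟩ : ∃ b : (ℤ → ℝ) → (Fin p → ℝ) → ℝ,
    b = fun y x => prodWeight w h (lagVec p y p) x - c y x := ⟨_, rfl⟩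
  have hbm : Measurable (Function.uncurry b) := by
    rw [hb]; exact (measurable_weight hwm h p).sub hcm
  have hbmx : ∀ x, Measurable fun y => b y x := fun x => hbm.of_uncurry_right
  have hW0 : ∀ u x : Fin p → ℝ, 0 ≤ prodWeight w h u x := prodWeight_nonneg hwK.w_nonneg hh
  have hWM : ∀ u x : Fin p → ℝ, prodWeight w h u x ≤ M := prodWeight_le hwK.w_nonneg hB hh
  have hc0 : ∀ y x, 0 ≤ c y x := by
    rw [hc]; exact compensator_nonneg hu hwK hh
  have hcM : ∀ y x, c y x ≤ M := by
    rw [hc]; exact compensator_le hu hwK hp hB0 hB hh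
  have hbM : ∀ y x, |b y x| ≤ M := fun y x => by
    rw [abs_le]
    constructor <;> simp only [hb] <;> linarith [hW0 (lagVec p y p) x, hWM (lagVec p y p) x,
      hc0 y x, hcM y x]
  have hbmem : ∀ x, MemLp (fun y => b y x) 2 Q := fun x =>
    MemLp.of_bound (hbmx x).aestronglyMeasurable M (Eventually.of_forall fun y => hbM y x)
  have hcint : ∀ x, Integrable (fun y => c y x) Q := fun x =>
    Integrable.of_bound (hcm.comp measurable_prodMk_right).aestronglyMeasurable M
      (Eventually.of_forall fun y => by rw [Real.norm_of_nonneg (hc0 y x)]; exact hcM y x)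
  -- The centred weight is bounded both by `M` and by weight plus compensator, two functions with
  -- the same mean; multiplying the two bounds costs again only one factor h^{-p}.
  have hbsq : ∀ x, ∫ y, b y x ^ 2 ∂Q ≤ 2 * M * meanWeight Q w h x := by
    intro x
    calc ∫ y, b y x ^ 2 ∂Q ≤ ∫ y, M * (prodWeight w h (lagVec p y p) x + c y x) ∂Q := by
          refine integral_mono (hbmem x).integrable_sq
            (((integrable_weight hwK hp hh p x).add (hcint x)).const_mul M) fun y => ?_
          have h1 := hbM y x
          have h2 : |b y x| ≤ prodWeight w h (lagVec p y p) x + c y x := by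
            rw [abs_le]
            constructor <;> simp only [hb] <;> linarith [hW0 (lagVec p y p) x, hc0 y x]
          rw [← sq_abs, sq]
          exact mul_le_mul h1 h2 (abs_nonneg _) hM0
      _ = 2 * M * meanWeight Q w h x := by
          rw [integral_const_mul, integral_add (integrable_weight hwK hp hh p x) (hcint x),
            hc, integral_compensator hu hQ hwK hp hh,
            hQ.integral_lagVec (φ := fun u => prodWeight w h u x)
              (measurable_prodWeight_left hwm h x) p]
          simp only [meanWeight]
          ring
  have hshift : ∀ (i : ℤ) {φ : (ℤ → ℝ) → ℝ}, Measurable φ →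
      ∫ y, φ (shiftSeq i y) ∂Q = ∫ y, φ y ∂Q := fun i φ hφ => by
    have := integral_map (μ := Q) (hQ.shift i).measurable.aemeasurable
      (f := φ) hφ.aestronglyMeasurable
    rw [(hQ.shift i).map_eq] at this
    exact this.symm
  obtain ⟨a, ha⟩ : ∃ a : ℕ → (ℤ → ℝ) → (Fin p → ℝ) → ℝ,
    a = fun (j : ℕ) y x => b (shiftSeq (s + j) y) x := ⟨_, rfl⟩
  have ham : ∀ j, Measurable (Function.uncurry (a j)) := fun j => by
    rw [ha]
    exact hbm.comp (((measurable_shiftSeq (s + j)).comp measurable_fst).prodMk measurable_snd)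
  have hmem : ∀ j x, MemLp (fun y => a j y x) 2 Q := fun j x => by
    rw [ha]
    exact (hbmem x).comp_measurePreserving (hQ.shift (s + j))
  have hV : ∀ j x, ∫ y, a j y x ^ 2 ∂Q ≤ 2 * M * meanWeight Q w h x := fun j x => by
    rw [ha]
    exact (hshift (s + j) (φ := fun y => b y x ^ 2) ((hbmx x).pow_const 2)).trans_le (hbsq x)
  suffices horth : ∀ i j x, i + p ≤ j → ∫ y, a i y x * a j y x ∂Q = 0 by
    have hgoal := lintegral_orthogonal_sum_le (p := p) (D := D) (Q := Q) (a := a) ham hmem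
      (measurable_meanWeight (Q := Q) hwm h) (meanWeight_nonneg (Q := Q) hwK hh)
      (lintegral_meanWeight_le (Q := Q) hwK hp hh) (by positivity : (0 : ℝ) ≤ 2 * M) hV horth
      hN hη hl
    have ha' : ∀ (j : ℕ) y x, a j y x = prodWeight w h (lagVec p y (p + (s + j))) x -
        compensator p D u w h (shiftSeq (s + j) y) x := fun j y x => by
      simp only [ha, hb, hc, lagVec_shiftSeq]
    simp only [ha'] at hgoal
    exact hgoal
  intro i j x hij
  -- Shift so that the later lag vector sits at time `p`. As d ≤ -p, the earlier term then depends
  -- only on times up to `0` and factors out of the conditional mean.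
  obtain ⟨d, hd⟩ : ∃ d : ℤ, d = (i : ℤ) - j := ⟨_, rfl⟩
  obtain ⟨b', hb'⟩ : ∃ b' : (ℤ → ℝ) → ℝ, b' = fun y => b (shiftSeq d y) x := ⟨_, rfl⟩
  have hb'm : Measurable b' := by
    rw [hb']; exact (hbmx x).comp (hQ.shift d).measurable
  have hb'dep : DependsOn b' (Set.Iic 0) := by
    intro y y' hy
    have h1 : lagVec p (shiftSeq d y) p = lagVec p (shiftSeq d y') p := by
      rw [lagVec_shiftSeq, lagVec_shiftSeq]
      exact dependsOn_lagVec p _ fun k hk =>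
        hy k (by have := hk.2; simp only [Set.mem_Iic]; omega)
    have h2 : ∀ x', u (shiftSeq d y, x') = u (shiftSeq d y', x') := fun x' =>
      hu.dependsOn x' fun k hk => by
        have : k ≤ 0 := hk
        exact hy _ (by simp only [Set.mem_Iic]; omega)
    simp only [hb', hb, hc, compensator, h1, h2]
  have h1 : ∫ y, a i y x * a j y x ∂Q = ∫ y, b' y * b y x ∂Q := by
    rw [← hshift (s + j) (φ := fun y => b' y * b y x) (hb'm.mul (hbmx x))]
    refine integral_congr_ae (Eventually.of_forall fun y => ?_)
    simp only [ha, hb']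
    congr 2
    funext k
    simp only [shiftSeq, hd]
    congr 1
    ring
  have hb'M : ∀ y, |b' y| ≤ M := fun y => by
    rw [hb']; exact hbM _ _
  have hb'W : Integrable (fun y => b' y * prodWeight w h (lagVec p y p) x) Q :=
    (integrable_weight hwK hp hh p x).bdd_mul hb'm.aestronglyMeasurable
      (Eventually.of_forall hb'M)
  have hb'c : Integrable (fun y => b' y * c y x) Q :=
    (hcint x).bdd_mul hb'm.aestronglyMeasurable (Eventually.of_forall hb'M)
  have h2 := hu.integral_eq (fun z => b' z.1 * prodWeight w h z.2 x)
    ((hb'm.comp measurable_fst).mul ((measurable_prodWeight_left hwm h x).comp measurable_snd))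
    hb'W (fun x' y y' hy => by simp only [hb'dep hy])
  have h3 : ∀ y, ∫ x' in cube p D, u (y, x') * (b' y * prodWeight w h x' x) =
      b' y * c y x := fun y => by
    rw [hc, compensator, ← integral_const_mul]
    refine integral_congr_ae (Eventually.of_forall fun x' => ?_)
    simp only
    ring
  simp only [h3] at h2
  rw [h1]
  simp only [hb, mul_sub]
  rw [integral_sub hb'W hb'c, h2, sub_self]

end

end MDCP

end

/-! ### Consistency of the denominator -/

noncomputable section

set_option linter.unusedSectionVars false

namespace MDCP

section

variable {p : ℕ} {κ : Kernel (Fin p → ℝ) ℝ} [IsMarkovKernel κ] {D : Set ℝ}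
  {Q : Measure (ℤ → ℝ)} [IsProbabilityMeasure Q] {w K : ℝ → ℝ}
  {u : (ℤ → ℝ) × (Fin p → ℝ) → ℝ}

lemma tendsto_sampleSize (p : ℕ) : Tendsto (sampleSize p) atTop atTop := by
  have h : Tendsto (fun n : ℕ => (n : ℝ) + (1 - p)) atTop atTop :=
    tendsto_atTop_add_const_right _ _ tendsto_natCast_atTop_atTop
  refine h.congr fun n => ?_
  simp only [sampleSize]
  ring

/-- Smoothing by the kernel weights is a contraction in `L¹`. -/
lemma lintegral_enorm_smoothing_le (hwK : KernelConditions p w K) (hp : 1 ≤ p) {h : ℝ}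
    (hh : 0 < h) {R : (Fin p → ℝ) → ℝ} (hR : Measurable R) (A : Set (Fin p → ℝ)) :
    ∫⁻ x in A, ‖∫ x' in A, R x' * prodWeight w h x' x‖ₑ ≤ ∫⁻ x in A, ‖R x‖ₑ := by
  have hwm := (hwK.continuous_w hp).measurable
  have hm : Measurable fun z : (Fin p → ℝ) × (Fin p → ℝ) =>
      ‖R z.2‖ₑ * ENNReal.ofReal (prodWeight w h z.2 z.1) :=
    (hR.enorm.comp measurable_snd).mul
      ((measurable_prodWeight hwm h).comp measurable_swap).ennreal_ofReal
  calc _ ≤ ∫⁻ x in A, (∫⁻ x' in A, ‖R x'‖ₑ * ENNReal.ofReal (prodWeight w h x' x)) := by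
        refine lintegral_mono fun x => (enorm_integral_le_lintegral_enorm _).trans ?_
        refine lintegral_mono fun x' => ?_
        rw [enorm_mul, Real.enorm_of_nonneg (prodWeight_nonneg hwK.w_nonneg hh _ _)]
    _ = ∫⁻ x' in A, (∫⁻ x in A, ‖R x'‖ₑ * ENNReal.ofReal (prodWeight w h x' x)) :=
        lintegral_lintegral_swap hm.aemeasurable
    _ ≤ ∫⁻ x' in A, ‖R x'‖ₑ := by
        refine lintegral_mono fun x' => ?_
        rw [lintegral_const_mul' _ _ enorm_ne_top]
        refine mul_le_of_le_one_right' ?_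
        rw [← lintegral_prodWeight hwK hp hh x']
        exact setLIntegral_le_lintegral _ _

/-- Averages over initial segments of a long stretch converge uniformly. -/
lemma eventually_mul_le_of_tendsto_zero {d : ℕ → ℝ≥0∞} (hd : Tendsto d atTop (𝓝 0)) {C : ℝ≥0∞}
    (hC : C ≠ ∞) (hdC : ∀ l, d l ≤ C) {ε : ℝ≥0∞} (hε : 0 < ε) :
    ∀ᶠ N : ℝ in atTop, ∀ l : ℕ, (l : ℝ) ≤ N → ENNReal.ofReal (l / N) * d l ≤ ε := by
  -- Long segments have small deviation; segments shorter than the fixed length `L` have negligible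
  -- relative length L/N and bounded deviation.
  obtain ⟨L, hL⟩ := eventually_atTop.1 (ENNReal.tendsto_nhds_zero.1 hd ε hε)
  have h1 : Tendsto (fun N : ℝ => ENNReal.ofReal (L / N) * C) atTop (𝓝 0) := by
    have h2 : Tendsto (fun N : ℝ => ENNReal.ofReal (L / N)) atTop (𝓝 0) := by
      simpa using ENNReal.tendsto_ofReal (tendsto_const_nhds.div_atTop tendsto_id)
    simpa using ENNReal.Tendsto.mul_const h2 (Or.inr hC)
  filter_upwards [ENNReal.tendsto_nhds_zero.1 h1 ε hε, eventually_gt_atTop 0] with N hN hN0 l hl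
  rcases le_or_gt L l with h | h
  · refine (mul_le_of_le_one_left' ?_).trans (hL l h)
    rw [ENNReal.ofReal_le_one]
    exact div_le_one_of_le₀ hl hN0.le
  · refine le_trans (mul_le_mul' (ENNReal.ofReal_le_ofReal ?_) (hdC l)) hN
    have : (l : ℝ) ≤ L := by exact_mod_cast h.le
    gcongr

lemma integrable_marginalDensity_mul_weight (hu : IsBlockDensity p D Q u)
    (hD : MeasurableSet D) (hwK : KernelConditions p w K) (hp : 1 ≤ p) {h : ℝ} (hh : 0 < h)
    (x : Fin p → ℝ) :
    Integrable fun x' => marginalDensity p D Q u x' * prodWeight w h x' x := by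
  obtain ⟨B, -, hB⟩ := hwK.exists_bound
  refine (hu.integrable_marginal hD).mul_bdd (c := (B / h) ^ p)
    (measurable_prodWeight_left (hwK.continuous_w hp).measurable h x).aestronglyMeasurable
    (Eventually.of_forall fun x' => ?_)
  rw [Real.norm_of_nonneg (prodWeight_nonneg hwK.w_nonneg hh _ _)]
  exact prodWeight_le hwK.w_nonneg hB hh _ _

lemma marginalDensity_of_mem {x : Fin p → ℝ} (hx : x ∈ cube p D) :
    marginalDensity p D Q u x = ∫ y, u (y, x) ∂Q := Set.indicator_of_mem hx _

/-- Averages of the compensators are close to the smoothed marginal density. -/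
lemma PathLaw.lintegral_compensator_sub_le (hQ : PathLaw p κ D Q) (hu : IsBlockDensity p D Q u)
    (hD : MeasurableSet D) (hwK : KernelConditions p w K) (hp : 1 ≤ p)
    [IsFiniteMeasure (volume.restrict (cube p D))] {h N : ℝ} (hh : 0 < h) (hN : 0 < N) (s : ℤ)
    (l : ℕ) :
    ∫⁻ y, (∫⁻ x in cube p D, ‖(1 / N) * ∑ j ∈ Finset.range l,
        compensator p D u w h (shiftSeq (s + j) y) x -
        (l / N) * ∫ x', prodWeight w h x' x * marginalDensity p D Q u x'‖ₑ) ∂Q ≤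
      ENNReal.ofReal (l / N) *
        ∫⁻ z, ‖avgDev Q (fun i : ℕ => shiftSeq (i : ℤ)) u l z‖ₑ
          ∂(Q.prod (volume.restrict (cube p D))) := by
  have hcube : MeasurableSet (cube p D) := MeasurableSet.univ_pi fun _ => hD
  have hgm := hu.measurable_marginal hD
  obtain ⟨g, hg⟩ : ∃ g, g = marginalDensity p D Q u := ⟨_, rfl⟩
  rw [← hg] at hgm ⊢
  -- The compensator and the smoothed marginal density are one smoothing operator applied to `u` and
  -- to `g`. Contraction of this operator in L¹ reduces the claim to `R`, which does not involve the
  -- bandwidth.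
  obtain ⟨R, hR⟩ : ∃ R : (ℤ → ℝ) → (Fin p → ℝ) → ℝ, R = fun y x' =>
    (1 / N) * ∑ j ∈ Finset.range l, u (shiftSeq (j : ℤ) y, x') - (l / N) * g x' := ⟨_, rfl⟩
  have husm : ∀ i : ℤ, Measurable fun z : (ℤ → ℝ) × (Fin p → ℝ) => u (shiftSeq i z.1, z.2) :=
    fun i => hu.measurable.comp (((measurable_shiftSeq i).comp measurable_fst).prodMk
      measurable_snd)
  have hRm : Measurable (Function.uncurry R) := by
    rw [hR]
    exact ((Finset.measurable_fun_sum (Finset.range l) fun (j : ℕ) _ => husm j).const_mul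
      (1 / N)).sub ((hgm.comp measurable_snd).const_mul _)
  have hRy : ∀ y, Measurable (R y) := fun y => hRm.of_uncurry_left
  have h1 : ∀ y x, (1 / N) * ∑ j ∈ Finset.range l,
      compensator p D u w h (shiftSeq (s + j) y) x -
        (l / N) * ∫ x', prodWeight w h x' x * g x' =
      ∫ x' in cube p D, R (shiftSeq s y) x' * prodWeight w h x' x := by
    intro y x
    have hi1 : ∀ j : ℕ, IntegrableOn (fun x' => u (shiftSeq (s + j) y, x') * prodWeight w h x' x)
        (cube p D) := fun j => integrable_section_mul_weight hu hwK hp hh _ x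
    have hi2 := integrable_marginalDensity_mul_weight hu hD hwK hp hh x
    rw [← hg] at hi2
    have h2 : ∫ x', prodWeight w h x' x * g x' =
        ∫ x' in cube p D, g x' * prodWeight w h x' x := by
      rw [setIntegral_eq_integral_of_forall_compl_eq_zero]
      · simp only [mul_comm]
      · intro x' hx'
        rw [hg, marginalDensity, Set.indicator_of_notMem hx', zero_mul]
    have h3 : ∀ x', R (shiftSeq s y) x' * prodWeight w h x' x =
        (1 / N) * ∑ j ∈ Finset.range l, u (shiftSeq (s + j) y, x') * prodWeight w h x' x -
          (l / N) * (g x' * prodWeight w h x' x) := by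
      intro x'
      have h4 : ∀ j : ℕ, shiftSeq (j : ℤ) (shiftSeq s y) = shiftSeq (s + j) y := fun j => by
        funext k
        simp only [shiftSeq]
        congr 1
        ring
      rw [hR]
      simp only [h4]
      rw [sub_mul, mul_assoc, Finset.sum_mul, mul_assoc]
    simp only [h3]
    rw [integral_sub ((integrable_finsetSum _ fun j _ => hi1 j).const_mul _)
      (hi2.integrableOn.const_mul _), integral_const_mul, integral_const_mul,
      integral_finsetSum _ fun j _ => hi1 j, h2]
    rfl
  have hRi : Measurable fun y => ∫⁻ x in cube p D, ‖R y x‖ₑ := hRm.enorm.lintegral_prod_right'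
  simp only [h1]
  calc _ ≤ ∫⁻ y, (∫⁻ x in cube p D, ‖R (shiftSeq s y) x‖ₑ) ∂Q :=
        lintegral_mono fun y => lintegral_enorm_smoothing_le hwK hp hh (hRy _) _
    _ = ∫⁻ y, (∫⁻ x in cube p D, ‖R y x‖ₑ) ∂Q := (hQ.shift s).lintegral_comp hRi
    _ = ∫⁻ y, (∫⁻ x in cube p D, ENNReal.ofReal (l / N) *
        ‖avgDev Q (fun i : ℕ => shiftSeq (i : ℤ)) u l (y, x)‖ₑ) ∂Q := by
        refine lintegral_congr fun y => setLIntegral_congr_fun hcube fun x hx => ?_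
        rw [← Real.enorm_of_nonneg (by positivity : (0 : ℝ) ≤ l / N), ← enorm_mul]
        congr 1
        rw [hR]
        simp only [avgDev]
        rw [hg, marginalDensity_of_mem hx]
        rcases Nat.eq_zero_or_pos l with rfl | hl
        · simp
        · have : (l : ℝ) ≠ 0 := by exact_mod_cast hl.ne'
          field_simp
    _ = ENNReal.ofReal (l / N) * ∫⁻ y, (∫⁻ x in cube p D,
        ‖avgDev Q (fun i : ℕ => shiftSeq (i : ℤ)) u l (y, x)‖ₑ) ∂Q := by
        simp only [lintegral_const_mul' _ _ ENNReal.ofReal_ne_top]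
    _ = _ := by
        rw [lintegral_prod]
        exact (aestronglyMeasurable_avgDev (fun i => hQ.shift i) hu.integrable l).enorm

/-- The denominator of the estimator converges to the marginal density. -/
lemma PathLaw.eventually_denominator_le (hQ : PathLaw p κ D Q) (hu : IsBlockDensity p D Q u)
    (hwK : KernelConditions p w K) (hp : 1 ≤ p) (hD : MeasurableSet D)
    [IsFiniteMeasure (volume.restrict (cube p D))] {h h₀ : ℕ → ℝ}
    (hh : BandwidthConditions p h h₀) {ε : ℝ≥0∞} (hε : 0 < ε) :
    ∀ᶠ n in atTop, ∀ (b : ℤ) (l : ℕ), (l : ℝ) ≤ sampleSize p n →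
      ∫⁻ y, (∫⁻ x in cube p D, ‖(1 / sampleSize p n) * ∑ j ∈ Finset.range l,
        prodWeight w (h n) (lagVec p y (b + j - 1)) x -
          (l / sampleSize p n) * marginalDensity p D Q u x‖ₑ) ∂Q ≤ ε := by
  have hwm := (hwK.continuous_w hp).measurable
  obtain ⟨B, hB0, hB⟩ := hwK.exists_bound
  have hΛfin : volume (cube p D) ≠ ∞ := by
    have := measure_lt_top (volume.restrict (cube p D)) Set.univ
    rw [Measure.restrict_apply_univ] at this
    exact this.ne
  wlog hεfin : ε ≠ ∞ generalizing ε
  · filter_upwards [this (ε := 1) one_pos ENNReal.one_ne_top] with n hn b l hl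
    rw [not_not.1 hεfin]; exact le_top
  obtain ⟨e, he⟩ : ∃ e, e = ε.toReal / 4 := ⟨_, rfl⟩
  have he0 : 0 < e := by rw [he]; exact div_pos (ENNReal.toReal_pos hε.ne' hεfin) (by norm_num)
  have hεe : ε = (ENNReal.ofReal e + ENNReal.ofReal e) +
      (ENNReal.ofReal e + ENNReal.ofReal e) := by
    rw [← ENNReal.ofReal_add he0.le he0.le, ← ENNReal.ofReal_add (by positivity) (by positivity),
      show e + e + (e + e) = ε.toReal by rw [he]; ring, ENNReal.ofReal_toReal hεfin]
  have he' : 0 < ENNReal.ofReal e := ENNReal.ofReal_pos.2 he0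
  obtain ⟨η, hη⟩ : ∃ η, η = e / ((volume (cube p D)).toReal + 1) := ⟨_, rfl⟩
  have hΛ0 : 0 ≤ (volume (cube p D)).toReal := ENNReal.toReal_nonneg
  have hη0 : 0 < η := by rw [hη]; positivity
  have hηΛ : ENNReal.ofReal η * volume (cube p D) ≤ ENNReal.ofReal e := by
    rw [← ENNReal.ofReal_toReal hΛfin, ← ENNReal.ofReal_mul hη0.le]
    refine ENNReal.ofReal_le_ofReal ?_
    rw [hη, div_mul_eq_mul_div, div_le_iff₀ (by positivity)]
    nlinarith
  have hNh : ∀ᶠ n in atTop, 2 * p * (2 * B ^ p) / (η * e) ≤ sampleSize p n * h n ^ p :=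
    hh.tendsto_infty.eventually_ge_atTop _
  have hsm := ENNReal.tendsto_nhds_zero.1 (tendsto_lintegral_smoothing_sub hwK hp hh.h_pos
    hh.tendsto_zero (hu.measurable_marginal hD) (hu.integrable_marginal hD)) _ he'
  -- The ergodic theorem for the conditional densities; no rate is needed, because the averaged
  -- function does not change with `n`.
  have hav := (tendsto_sampleSize p).eventually (eventually_mul_le_of_tendsto_zero
    (hQ.average u hu.measurable hu.integrable)
    (C := 2 * ∫⁻ z, ‖u z‖ₑ ∂(Q.prod (volume.restrict (cube p D))))
    (ENNReal.mul_ne_top ENNReal.ofNat_ne_top hu.integrable.2.ne)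
    (fun l => lintegral_avgDev_le (fun i => hQ.shift i) hu.integrable l) he')
  filter_upwards [(tendsto_sampleSize p).eventually_gt_atTop 0, hNh, hsm, hav]
    with n hN hNh hsm hav b l hl
  have hhn := hh.h_pos n
  -- The offset b - 1 - p accounts for the block density describing the lag vector at time `p`,
  -- while the sum starts with the lag vector at time b - 1.
  have h1 := hQ.lintegral_centred_weights_le hu hwK hp hB0 hB hhn hN hη0 (b - 1 - p) hl
  have h2 := hQ.lintegral_compensator_sub_le hu hD hwK hp hhn hN (b - 1 - p) l
  have h3 := h2.trans (hav l hl)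
  have hidx : ∀ j : ℕ, (p : ℤ) + (b - 1 - p + j) = b + j - 1 := fun j => by ring
  simp only [hidx] at h1
  generalize hNdef : sampleSize p n = N at *
  generalize hgdef : marginalDensity p D Q u = g at *
  have hgm : Measurable g := by rw [← hgdef]; exact hu.measurable_marginal hD
  have hcm := measurable_compensator hu hwm (h n)
  obtain ⟨F₁, hF₁⟩ : ∃ F : (ℤ → ℝ) → (Fin p → ℝ) → ℝ≥0∞, F = fun y x =>
      ‖(1 / N) * ∑ j ∈ Finset.range l, (prodWeight w (h n) (lagVec p y (b + j - 1)) x -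
        compensator p D u w (h n) (shiftSeq (b - 1 - p + j) y) x)‖ₑ := ⟨_, rfl⟩
  obtain ⟨F₂, hF₂⟩ : ∃ F : (ℤ → ℝ) → (Fin p → ℝ) → ℝ≥0∞, F = fun y x =>
      ‖(1 / N) * ∑ j ∈ Finset.range l,
        compensator p D u w (h n) (shiftSeq (b - 1 - p + j) y) x -
        (l / N) * ∫ x', prodWeight w (h n) x' x * g x'‖ₑ := ⟨_, rfl⟩
  have hm1 : Measurable (Function.uncurry F₁) := by
    rw [hF₁]
    exact ((Finset.measurable_fun_sum (Finset.range l) fun (j : ℕ) _ =>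
      (measurable_weight hwm (h n) (b + j - 1)).sub (hcm.comp
        (((measurable_shiftSeq (b - 1 - p + j)).comp measurable_fst).prodMk
          measurable_snd))).const_mul (1 / N)).enorm
  have hsmm : Measurable fun x => ∫ x', prodWeight w (h n) x' x * g x' := by
    have : Measurable fun z : (Fin p → ℝ) × (Fin p → ℝ) => prodWeight w (h n) z.2 z.1 * g z.2 :=
      ((measurable_prodWeight hwm (h n)).comp measurable_swap).mul (hgm.comp measurable_snd)
    exact this.stronglyMeasurable.integral_prod_right'.measurable
  have hm2 : Measurable (Function.uncurry F₂) := by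
    rw [hF₂]
    exact (((Finset.measurable_fun_sum (Finset.range l) fun (j : ℕ) _ => hcm.comp
      (((measurable_shiftSeq (b - 1 - p + j)).comp measurable_fst).prodMk
        measurable_snd)).const_mul (1 / N)).sub
        ((hsmm.comp measurable_snd).const_mul (l / N))).enorm
  have h1' : ∫⁻ y, (∫⁻ x in cube p D, F₁ y x) ∂Q ≤ ENNReal.ofReal η * volume (cube p D) +
      ENNReal.ofReal (2 * p * (2 * (B / h n) ^ p) / (N * η)) := by rw [hF₁]; exact h1
  have h3' : ∫⁻ y, (∫⁻ x in cube p D, F₂ y x) ∂Q ≤ ENNReal.ofReal e := by rw [hF₂]; exact h3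
  have hpt : ∀ y x, ‖(1 / N) * ∑ j ∈ Finset.range l,
        prodWeight w (h n) (lagVec p y (b + j - 1)) x - (l / N) * g x‖ₑ ≤
      F₁ y x + (F₂ y x + ‖(∫ x', prodWeight w (h n) x' x * g x') - g x‖ₑ) := by
    intro y x
    -- Centred weights, then averaged compensators against the smoothed density, then the smoothing
    -- error of the density.
    have h4 : (1 / N) * ∑ j ∈ Finset.range l,
        prodWeight w (h n) (lagVec p y (b + j - 1)) x - (l / N) * g x =
      (1 / N) * ∑ j ∈ Finset.range l, (prodWeight w (h n) (lagVec p y (b + j - 1)) x -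
        compensator p D u w (h n) (shiftSeq (b - 1 - p + j) y) x) +
      (((1 / N) * ∑ j ∈ Finset.range l,
        compensator p D u w (h n) (shiftSeq (b - 1 - p + j) y) x -
        (l / N) * ∫ x', prodWeight w (h n) x' x * g x') +
      (l / N) * ((∫ x', prodWeight w (h n) x' x * g x') - g x)) := by
      rw [Finset.sum_sub_distrib]
      ring
    rw [h4, hF₁, hF₂]
    refine (enorm_add_le _ _).trans (add_le_add le_rfl ((enorm_add_le _ _).trans
      (add_le_add le_rfl ?_)))
    rw [enorm_mul]
    refine mul_le_of_le_one_left' ?_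
    rw [Real.enorm_of_nonneg (by positivity), ENNReal.ofReal_le_one]
    exact div_le_one_of_le₀ hl hN.le
  refine (lintegral_mono fun y => lintegral_mono fun x => hpt y x).trans ?_
  simp only [lintegral_add_left hm1.of_uncurry_left, lintegral_add_left hm2.of_uncurry_left]
  have hi1 : Measurable fun y => ∫⁻ x in cube p D, F₁ y x := hm1.lintegral_prod_right'
  have hi2 : Measurable fun y => ∫⁻ x in cube p D, F₂ y x := hm2.lintegral_prod_right'
  rw [lintegral_add_left hi1, lintegral_add_left hi2, hεe]
  refine add_le_add (h1'.trans (add_le_add hηΛ (ENNReal.ofReal_le_ofReal ?_)))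
    (add_le_add h3' ?_)
  · rw [div_pow, mul_div_assoc', mul_div_assoc', div_div, div_le_iff₀ (by positivity)]
    rw [div_le_iff₀ (by positivity)] at hNh
    nlinarith
  · simp only [lintegral_const, measure_univ, mul_one]
    exact (setLIntegral_le_lintegral _ _).trans hsm

end

end MDCP

end

/-! ### Consistency of the estimator at the lag vectors of the sample -/

noncomputable section

set_option linter.unusedSectionVars false

namespace MDCP

section

variable {p : ℕ} {κ : Kernel (Fin p → ℝ) ℝ} [IsMarkovKernel κ] {D : Set ℝ}
  {Q : Measure (ℤ → ℝ)} [IsProbabilityMeasure Q] {w K : ℝ → ℝ}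
  {u : (ℤ → ℝ) × (Fin p → ℝ) → ℝ}

/-- A statistic of the values before the lag vector at time `t`, or after it, that is small in `L¹`
over the cube, is small in probability at the lag vector. -/
lemma PathLaw.exists_transfer (hQ : PathLaw p κ D Q)
    [IsFiniteMeasure (volume.restrict (cube p D))] {τ : ℝ} (hτ : 0 < τ) {ε : ℝ≥0∞} (hε : 0 < ε) :
    ∃ c : ℝ≥0∞, 0 < c ∧ ∀ (t : ℤ) (Z : (ℤ → ℝ) → (Fin p → ℝ) → ℝ),
      Measurable (Function.uncurry Z) →
      ((∀ x, DependsOn (fun y => Z y x) (Set.Iic (t - p))) ∨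
        ∃ T, ∀ x, DependsOn (fun y => Z y x) (Set.Ioc t T)) →
      ∫⁻ y, (∫⁻ x in cube p D, ‖Z y x‖ₑ) ∂Q ≤ c →
      Q {y | τ ≤ |Z y (lagVec p y t)|} ≤ ε := by
  have hε2 : 0 < ε / 2 := ENNReal.div_pos hε.ne' ENNReal.ofNat_ne_top
  obtain ⟨A₁, hA₁⟩ := hQ.past_transfer hε2.ne'
  obtain ⟨A₂, hA₂⟩ := hQ.future_transfer hε2.ne'
  -- `a` combines the larger transfer constant with the factor 1/τ of Markov's inequality; adding
  -- one keeps it nonzero. The transfer lemmas require functions bounded by one, so they are applied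
  -- to the indicator of a large value of `Z`.
  obtain ⟨a, ha⟩ : ∃ a : ℝ≥0∞, a = ((max A₁ A₂ + 1 : ℝ≥0) : ℝ≥0∞) * (ENNReal.ofReal τ)⁻¹ :=
    ⟨_, rfl⟩
  have hτ' : ENNReal.ofReal τ ≠ 0 := (ENNReal.ofReal_pos.2 hτ).ne'
  have ha0 : a ≠ 0 := by
    rw [ha]
    refine mul_ne_zero ?_ (ENNReal.inv_ne_zero.2 ENNReal.ofReal_ne_top)
    exact_mod_cast (by positivity : (max A₁ A₂ + 1 : ℝ≥0) ≠ 0)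
  have hatop : a ≠ ∞ := by
    rw [ha]
    exact ENNReal.mul_ne_top ENNReal.coe_ne_top (ENNReal.inv_ne_top.2 hτ')
  refine ⟨ε / 2 / a, ENNReal.div_pos hε2.ne' hatop, fun t Z hZ hdep hle => ?_⟩
  obtain ⟨G, hG⟩ : ∃ G : Set ℝ, G = {r | τ ≤ |r|} := ⟨_, rfl⟩
  have hGm : MeasurableSet G := by
    rw [hG]
    exact measurableSet_le measurable_const measurable_id.abs
  obtain ⟨Φ, hΦ⟩ : ∃ Φ : (ℤ → ℝ) → (Fin p → ℝ) → ℝ≥0∞,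
      Φ = fun y x => G.indicator (fun _ => 1) (Z y x) := ⟨_, rfl⟩
  have hΦm : Measurable (Function.uncurry Φ) := by
    rw [hΦ]
    exact (measurable_const.indicator hGm).comp hZ
  have hΦ1 : ∀ y x, Φ y x ≤ 1 := fun y x => by
    rw [hΦ]
    exact Set.indicator_le_self' (fun _ _ => zero_le) _
  have hdepΦ : ∀ (s : Set ℤ) (x : Fin p → ℝ), DependsOn (fun y => Z y x) s →
      DependsOn (fun y => Φ y x) s := fun s x hs y y' hy => by
    rw [hΦ]
    exact congrArg (G.indicator fun _ => (1 : ℝ≥0∞)) (hs hy)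
  have hl : ∫⁻ y, Φ y (lagVec p y t) ∂Q = Q {y | τ ≤ |Z y (lagVec p y t)|} := by
    have hm : MeasurableSet {y | τ ≤ |Z y (lagVec p y t)|} :=
      measurableSet_le measurable_const
        (hZ.comp (measurable_id.prodMk (measurable_lagVec p t))).abs
    rw [← lintegral_indicator_one hm, hΦ, hG]
    rfl
  have hΦle : ∀ y x, Φ y x ≤ (ENNReal.ofReal τ)⁻¹ * ‖Z y x‖ₑ := by
    intro y x
    rw [hΦ]
    by_cases h : Z y x ∈ G
    · simp only [Set.indicator_of_mem h]
      rw [← ENNReal.inv_mul_cancel hτ' ENNReal.ofReal_ne_top, Real.enorm_eq_ofReal_abs]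
      gcongr
      rw [hG] at h
      exact h
    · simp only [Set.indicator_of_notMem h]
      exact zero_le
  have hI : ∫⁻ y, (∫⁻ x in cube p D, Φ y x) ∂Q ≤
      (ENNReal.ofReal τ)⁻¹ * ∫⁻ y, (∫⁻ x in cube p D, ‖Z y x‖ₑ) ∂Q := by
    have hne : (ENNReal.ofReal τ)⁻¹ ≠ ∞ := ENNReal.inv_ne_top.2 hτ'
    simp only [← lintegral_const_mul' _ _ hne]
    exact lintegral_mono fun y => lintegral_mono fun x => hΦle y x
  have key : ∀ A : ℝ≥0, A ≤ max A₁ A₂ →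
      A * ∫⁻ y, (∫⁻ x in cube p D, Φ y x) ∂Q + ε / 2 ≤ ε := by
    intro A hA
    calc A * ∫⁻ y, (∫⁻ x in cube p D, Φ y x) ∂Q + ε / 2
        ≤ ((max A₁ A₂ + 1 : ℝ≥0) : ℝ≥0∞) * ((ENNReal.ofReal τ)⁻¹ * (ε / 2 / a)) + ε / 2 := by
          gcongr
          · exact hA.trans (le_add_of_nonneg_right zero_le_one)
          · exact hI.trans (by gcongr)
      _ = ε := by
          rw [← mul_assoc, ← ha, ENNReal.mul_div_cancel ha0 hatop, ENNReal.add_halves]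
  rw [← hl]
  rcases hdep with hdep | ⟨T, hdep⟩
  · exact (hA₁ t Φ hΦm hΦ1 fun x => hdepΦ _ x (hdep x)).trans (key _ (le_max_left _ _))
  · exact (hA₂ t T Φ hΦm hΦ1 fun x => hdepΦ _ x (hdep x)).trans (key _ (le_max_right _ _))

lemma sum_Icc_eq_sum_range (b e : ℤ) (f : ℤ → ℝ) :
    ∑ i ∈ Finset.Icc b e, f i = ∑ j ∈ Finset.range (e + 1 - b).toNat, f (b + j) := by
  rw [Int.Icc_eq_finset_map, Finset.sum_map]
  rfl

/-- The term with index i reads the times i - p, …, i, and the lag vector at `t` occupies t - p + 1,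
…, t. Indices up to t - p thus read only values before this block, indices from t + p + 1 on only
values after it, and at most 2p indices remain. -/
lemma Icc_split {p n : ℕ} {t : ℤ} (hpt : p ≤ t) (htn : t ≤ n) (f : ℤ → ℝ) :
    ∃ s : Finset ℤ, (s.card : ℝ) ≤ 2 * p ∧
      ∑ i ∈ Finset.Icc ((p : ℤ) + 1) (n + 1), f i =
        ∑ j ∈ Finset.range (t - 2 * p).toNat, f (p + 1 + j) +
        ∑ j ∈ Finset.range (n + 1 - t - p).toNat, f (t + p + 1 + j) + ∑ i ∈ s, f i := by
  classical
  refine ⟨Finset.Icc ((p : ℤ) + 1) (n + 1) \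
    (Finset.Icc ((p : ℤ) + 1) (t - p) ∪ Finset.Icc (t + p + 1) (n + 1)), ?_, ?_⟩
  · have h1 : Finset.Icc ((p : ℤ) + 1) (n + 1) \
        (Finset.Icc ((p : ℤ) + 1) (t - p) ∪ Finset.Icc (t + p + 1) (n + 1)) ⊆
        Finset.Icc (t - p + 1) (t + p) := by
      intro i hi
      simp only [Finset.mem_sdiff, Finset.mem_union, Finset.mem_Icc] at hi ⊢
      omega
    have h2 := Finset.card_le_card h1
    rw [Int.card_Icc, show t + p + 1 - (t - p + 1) = ((2 * p : ℕ) : ℤ) by push_cast; ring,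
      Int.toNat_natCast] at h2
    exact_mod_cast h2
  · have hdisj : Disjoint (Finset.Icc ((p : ℤ) + 1) (t - p)) (Finset.Icc (t + p + 1) (n + 1)) := by
      rw [Finset.disjoint_left]
      intro i hi
      simp only [Finset.mem_Icc] at hi ⊢
      omega
    have hsub : Finset.Icc ((p : ℤ) + 1) (t - p) ∪ Finset.Icc (t + p + 1) (n + 1) ⊆
        Finset.Icc ((p : ℤ) + 1) (n + 1) := by
      intro i hi
      simp only [Finset.mem_union, Finset.mem_Icc] at hi ⊢
      omega
    rw [← Finset.sum_sdiff hsub, Finset.sum_union hdisj, sum_Icc_eq_sum_range,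
      sum_Icc_eq_sum_range, show t - p + 1 - (p + 1) = t - 2 * (p : ℤ) by ring,
      show (n : ℤ) + 1 + 1 - (t + p + 1) = n + 1 - t - p by ring]
    ring

/-- The centred numerator of the estimator over a stretch of indices. -/
def centredNumer (κ : Kernel (Fin p → ℝ) ℝ) (w K : ℝ → ℝ) (h h₀ N v : ℝ) (b : ℤ) (l : ℕ)
    (y : ℤ → ℝ) (x : Fin p → ℝ) : ℝ :=
  (1 / N) * ∑ j ∈ Finset.range l, prodWeight w h (lagVec p y (b + j - 1)) x *
    (K ((v - y (b + j)) / h₀) - (κ x).real (Set.Iic v))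

/-- The centred denominator of the estimator over a stretch of indices. -/
def centredDenom (g : (Fin p → ℝ) → ℝ) (w : ℝ → ℝ) (h N : ℝ) (b : ℤ) (l : ℕ)
    (y : ℤ → ℝ) (x : Fin p → ℝ) : ℝ :=
  (1 / N) * ∑ j ∈ Finset.range l, prodWeight w h (lagVec p y (b + j - 1)) x - (l / N) * g x

lemma measurable_centredNumer (hwK : KernelConditions p w K) (hp : 1 ≤ p) (h h₀ N v : ℝ) (b : ℤ)
    (l : ℕ) : Measurable (Function.uncurry (centredNumer κ w K h h₀ N v b l)) := by
  refine (Finset.measurable_fun_sum (Finset.range l) fun (j : ℕ) _ =>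
    (measurable_weight (hwK.continuous_w hp).measurable h (b + j - 1)).mul
      (Measurable.sub ?_ ?_)).const_mul (1 / N)
  · exact (hwK.measurable_K_sub h₀ v).comp ((measurable_pi_apply (b + (j : ℤ))).comp measurable_fst)
  · exact (measurable_condCDF v).comp measurable_snd

lemma measurable_centredDenom (hwK : KernelConditions p w K) (hp : 1 ≤ p)
    {g : (Fin p → ℝ) → ℝ} (hg : Measurable g) (h N : ℝ) (b : ℤ) (l : ℕ) :
    Measurable (Function.uncurry (centredDenom g w h N b l)) :=
  ((Finset.measurable_fun_sum (Finset.range l) fun (j : ℕ) _ =>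
    measurable_weight (hwK.continuous_w hp).measurable h (b + j - 1)).const_mul (1 / N)).sub
    ((hg.comp measurable_snd).const_mul (l / N))

lemma dependsOn_centredNumer (h h₀ N v : ℝ) (b : ℤ) (l : ℕ) (x : Fin p → ℝ) {s : Set ℤ}
    (hs : l ≠ 0 → Set.Ico (b - p) (b + l) ⊆ s) :
    DependsOn (fun y => centredNumer κ w K h h₀ N v b l y x) s := by
  intro y y' hy
  simp only [centredNumer]
  congr 1
  refine Finset.sum_congr rfl fun j hj => ?_
  have hj' := Finset.mem_range.1 hj
  have hl : l ≠ 0 := by omega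
  rw [hy (b + j) (hs hl ⟨by omega, by omega⟩), show lagVec p y (b + j - 1) = lagVec p y' (b + j - 1) from
    dependsOn_lagVec p _ fun k hk => hy k (hs hl ⟨by have := hk.1; omega, by have := hk.2; omega⟩)]

lemma dependsOn_centredDenom (g : (Fin p → ℝ) → ℝ) (h N : ℝ) (b : ℤ) (l : ℕ) (x : Fin p → ℝ)
    {s : Set ℤ} (hs : l ≠ 0 → Set.Ico (b - p) (b + l) ⊆ s) :
    DependsOn (fun y => centredDenom g w h N b l y x) s := by
  intro y y' hy
  simp only [centredDenom]
  congr 2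
  refine Finset.sum_congr rfl fun j hj => ?_
  have hj' := Finset.mem_range.1 hj
  have hl : l ≠ 0 := by omega
  rw [show lagVec p y (b + j - 1) = lagVec p y' (b + j - 1) from
    dependsOn_lagVec p _ fun k hk => hy k (hs hl ⟨by have := hk.1; omega, by have := hk.2; omega⟩)]

/-- With numerator and denominator A and B, the error is (A - F B)/B. The past, future and middle
parts of the numerator give 3τ in all; since N ≥ 4p, past and future make up at least half the
sample, so B ≥ η/2 - 2τ ≥ η/4. -/
lemma abs_condCDFEst_sub_le (hwK : KernelConditions p w K) {n : ℕ} {t : ℤ} (hpt : p ≤ t)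
    (htn : t ≤ n) {B h h₀ N : ℝ} (hB : ∀ v, w v ≤ B) (hh : 0 < h) (hNn : sampleSize p n = N)
    (hN : 0 < N) (hN4 : 4 * p ≤ N) {g : (Fin p → ℝ) → ℝ} {v τ η δ : ℝ}
    (hη : 0 < η) (hτη : τ ≤ η / 8) (hτδ : 12 * τ ≤ δ * η)
    (hmid : 2 * p * (B / h) ^ p / N ≤ τ) {y : ℤ → ℝ} {x : Fin p → ℝ} (hg : η ≤ g x)
    (h1 : |centredNumer κ w K h h₀ N v (p + 1) (t - 2 * p).toNat y x| < τ)
    (h2 : |centredNumer κ w K h h₀ N v (t + p + 1) (n + 1 - t - p).toNat y x| < τ)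
    (h3 : |centredDenom g w h N (p + 1) (t - 2 * p).toNat y x| < τ)
    (h4 : |centredDenom g w h N (t + p + 1) (n + 1 - t - p).toNat y x| < τ) :
    |condCDFEst p n w K h h₀ y (y (n + 1)) v x - (κ x).real (Set.Iic v)| ≤ δ := by
  have hW0 : ∀ u x : Fin p → ℝ, 0 ≤ prodWeight w h u x := prodWeight_nonneg hwK.w_nonneg hh
  have hWM : ∀ u x : Fin p → ℝ, prodWeight w h u x ≤ (B / h) ^ p :=
    prodWeight_le hwK.w_nonneg hB hh
  have haug : augment n y (y (n + 1)) = y := Function.update_eq_self _ _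
  obtain ⟨F, hF⟩ : ∃ F, F = (κ x).real (Set.Iic v) := ⟨_, rfl⟩
  have hF0 : 0 ≤ F := by rw [hF]; exact measureReal_nonneg
  have hF1 : F ≤ 1 := by rw [hF]; exact measureReal_le_one
  obtain ⟨a, ha⟩ : ∃ a : ℤ → ℝ, a = fun i => prodWeight w h (lagVec p y (i - 1)) x := ⟨_, rfl⟩
  obtain ⟨c, hc⟩ : ∃ c : ℤ → ℝ, c = fun i => a i * (K ((v - y i) / h₀) - F) := ⟨_, rfl⟩
  obtain ⟨num, hnum⟩ : ∃ r, r = (1 / N) * ∑ i ∈ Finset.Icc ((p : ℤ) + 1) (n + 1),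
    a i * K ((v - y i) / h₀) := ⟨_, rfl⟩
  obtain ⟨den, hden⟩ : ∃ r, r = (1 / N) * ∑ i ∈ Finset.Icc ((p : ℤ) + 1) (n + 1), a i := ⟨_, rfl⟩
  have hest : condCDFEst p n w K h h₀ y (y (n + 1)) v x = num / den := by
    rw [condCDFEst, haug, hNn, hnum, hden, ha]
  have ha0 : ∀ i, 0 ≤ a i := fun i => by rw [ha]; exact hW0 _ _
  have haM : ∀ i, a i ≤ (B / h) ^ p := fun i => by rw [ha]; exact hWM _ _
  have hcM : ∀ i, |c i| ≤ (B / h) ^ p := fun i => by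
    rw [hc, abs_mul, abs_of_nonneg (ha0 i)]
    refine (mul_le_of_le_one_right (ha0 i) ?_).trans (haM i)
    rw [abs_le]
    constructor <;> linarith [hwK.K_nonneg ((v - y i) / h₀), hwK.K_le_one ((v - y i) / h₀)]
  have hM0 : 0 ≤ (B / h) ^ p := (ha0 0).trans (haM 0)
  have hdiff : num - F * den = (1 / N) * ∑ i ∈ Finset.Icc ((p : ℤ) + 1) (n + 1), c i := by
    rw [hnum, hden, hc]
    simp only [mul_sub, Finset.sum_sub_distrib, ← Finset.sum_mul]
    ring
  have hnumle : |num - F * den| ≤ 3 * τ := by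
    obtain ⟨s, hs, hsum⟩ := Icc_split hpt htn c
    have hss : |(1 / N) * ∑ i ∈ s, c i| ≤ τ := by
      rw [abs_mul, abs_of_pos (by positivity : 0 < 1 / N)]
      calc 1 / N * |∑ i ∈ s, c i| ≤ 1 / N * (2 * p * (B / h) ^ p) := by
            gcongr
            calc |∑ i ∈ s, c i| ≤ ∑ i ∈ s, |c i| := Finset.abs_sum_le_sum_abs _ _
              _ ≤ ∑ _i ∈ s, (B / h) ^ p := Finset.sum_le_sum fun i _ => hcM i
              _ = s.card * (B / h) ^ p := by rw [Finset.sum_const, nsmul_eq_mul]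
              _ ≤ 2 * p * (B / h) ^ p := by gcongr
        _ = 2 * p * (B / h) ^ p / N := by ring
        _ ≤ τ := hmid
    have e1 : centredNumer κ w K h h₀ N v (p + 1) (t - 2 * p).toNat y x =
        (1 / N) * ∑ j ∈ Finset.range (t - 2 * p).toNat, c (p + 1 + j) := by
      rw [hc, ha, hF]; rfl
    have e2 : centredNumer κ w K h h₀ N v (t + p + 1) (n + 1 - t - p).toNat y x =
        (1 / N) * ∑ j ∈ Finset.range (n + 1 - t - p).toNat, c (t + p + 1 + j) := by
      rw [hc, ha, hF]; rfl
    rw [hdiff, hsum, mul_add, mul_add, ← e1, ← e2]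
    have := abs_lt.1 h1
    have := abs_lt.1 h2
    have := abs_le.1 hss
    rw [abs_le]
    constructor <;> linarith
  have hdenle : η / 4 ≤ den := by
    obtain ⟨s, hs, hsum⟩ := Icc_split hpt htn a
    have hss : 0 ≤ (1 / N) * ∑ i ∈ s, a i :=
      mul_nonneg (by positivity) (Finset.sum_nonneg fun i _ => ha0 i)
    have e1 : centredDenom g w h N (p + 1) (t - 2 * p).toNat y x =
        (1 / N) * ∑ j ∈ Finset.range (t - 2 * p).toNat, a (p + 1 + j) -
          (((t - 2 * p).toNat : ℕ) / N) * g x := by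
      rw [ha]; rfl
    have e2 : centredDenom g w h N (t + p + 1) (n + 1 - t - p).toNat y x =
        (1 / N) * ∑ j ∈ Finset.range (n + 1 - t - p).toNat, a (t + p + 1 + j) -
          (((n + 1 - t - p).toNat : ℕ) / N) * g x := by
      rw [ha]; rfl
    have hl : N - 2 * p ≤ ((t - 2 * p).toNat : ℝ) + ((n + 1 - t - p).toNat : ℝ) := by
      have : (n : ℤ) - p + 1 - 2 * p ≤ ((t - 2 * p).toNat : ℤ) + ((n + 1 - t - p).toNat : ℤ) := by
        omega
      rw [← hNn]
      simp only [sampleSize]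
      exact_mod_cast this
    have hl2 : 1 / 2 ≤ ((t - 2 * p).toNat : ℝ) / N + ((n + 1 - t - p).toNat : ℝ) / N := by
      rw [← add_div, le_div_iff₀ hN]
      linarith
    have h5 : g x / 2 ≤ (((t - 2 * p).toNat : ℝ) / N + ((n + 1 - t - p).toNat : ℝ) / N) * g x := by
      nlinarith
    rw [hden, hsum, mul_add, mul_add]
    have := abs_lt.1 h3
    have := abs_lt.1 h4
    linarith
  have hden0 : 0 < den := by linarith
  rw [hest, ← hF, show num / den - F = (num - F * den) / den by field_simp, abs_div,
    abs_of_pos hden0, div_le_iff₀ hden0]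
  have hδ : 0 ≤ δ := by
    have : 0 ≤ 3 * τ := (abs_nonneg _).trans hnumle
    by_contra hneg
    nlinarith
  nlinarith

/-- Continuity from above at time `0`, where the density is almost surely positive; stationarity
makes the threshold the same for every `t`. -/
lemma IsBlockDensity.exists_marginal_lt (hu : IsBlockDensity p D Q u) (hQ : PathLaw p κ D Q)
    (hD : MeasurableSet D) [IsFiniteMeasure (volume.restrict (cube p D))] {ε : ℝ≥0∞}
    (hε : 0 < ε) : ∃ η : ℝ, 0 < η ∧
      ∀ t, Q {y | marginalDensity p D Q u (lagVec p y t) < η} ≤ ε := by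
  have hgm := hu.measurable_marginal hD
  have hm : ∀ (η : ℝ) t, MeasurableSet {y | marginalDensity p D Q u (lagVec p y t) < η} :=
    fun η t => measurableSet_lt (hgm.comp (measurable_lagVec p t)) measurable_const
  have hlim : Tendsto (fun k : ℕ => Q {y | marginalDensity p D Q u (lagVec p y 0) < 1 / ((k : ℝ) + 1)})
      atTop (𝓝 (Q (⋂ k : ℕ, {y | marginalDensity p D Q u (lagVec p y 0) < 1 / ((k : ℝ) + 1)}))) := by
    refine tendsto_measure_iInter_atTop (fun k => (hm _ 0).nullMeasurableSet) ?_
      ⟨0, measure_ne_top _ _⟩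
    intro i j hij y hy
    refine lt_of_lt_of_le (show marginalDensity p D Q u (lagVec p y 0) < _ from hy) ?_
    gcongr
  have hzero : Q (⋂ k : ℕ, {y | marginalDensity p D Q u (lagVec p y 0) < 1 / ((k : ℝ) + 1)}) = 0 := by
    refine measure_mono_null (fun y hy => ?_) (hu.marginal_pos hQ hD)
    intro hpos
    obtain ⟨k, hk⟩ := exists_nat_one_div_lt (hpos 0)
    exact lt_asymm hk (Set.mem_iInter.1 hy k)
  rw [hzero] at hlim
  obtain ⟨k, hk⟩ := (ENNReal.tendsto_nhds_zero.1 hlim ε hε).exists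
  refine ⟨1 / ((k : ℝ) + 1), by positivity, fun t => ?_⟩
  have := (hQ.shift t).measure_preimage (hm (1 / ((k : ℝ) + 1)) 0).nullMeasurableSet
  rw [← this] at hk
  simpa [Set.preimage, lagVec_shiftSeq] using hk

/-- Consistency of the estimated conditional distribution function at a fixed argument. -/
lemma PathLaw.eventually_condCDFEst_le (hQ : PathLaw p κ D Q) (hwK : KernelConditions p w K)
    (hp : 1 ≤ p) (hD : MeasurableSet D) [IsFiniteMeasure (volume.restrict (cube p D))] {v : ℝ}
    (hcont : ContinuousOn (fun x => (κ x).real (Set.Iic v)) (cube p D))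
    (hLip : ∃ L : ℝ≥0, ∀ x ∈ cube p D, LipschitzWith L fun y => (κ x).real (Set.Iic y))
    {h h₀ : ℕ → ℝ} (hh : BandwidthConditions p h h₀) {δ : ℝ} (hδ : 0 < δ) {ε : ℝ≥0∞}
    (hε : 0 < ε) :
    ∀ᶠ n : ℕ in atTop, ∀ t : ℤ, p ≤ t → t ≤ n →
      Q {y | δ < |condCDFEst p n w K (h n) (h₀ n) y (y (n + 1)) v (lagVec p y t) -
        (κ (lagVec p y t)).real (Set.Iic v)|} ≤ ε := by
  obtain ⟨u, hu⟩ := hQ.exists_blockDensity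
  obtain ⟨B, hB0, hB⟩ := hwK.exists_bound
  -- Five exceptional events: numerator and denominator, each over past and future, and a small
  -- marginal density.
  have hε5 : 0 < ε / 5 := ENNReal.div_pos hε.ne' ENNReal.ofNat_ne_top
  obtain ⟨η, hη, hgη⟩ := hu.exists_marginal_lt hQ hD hε5
  -- This meets both requirements of `abs_condCDFEst_sub_le`: τ ≤ η/8 and 12τ ≤ δη.
  obtain ⟨τ, hτ⟩ : ∃ τ, τ = η * min δ 1 / 12 := ⟨_, rfl⟩
  have hmin : 0 < min δ 1 := lt_min hδ one_pos
  have hτ0 : 0 < τ := by rw [hτ]; positivity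
  have hτη : τ ≤ η / 8 := by rw [hτ]; nlinarith [min_le_right δ 1]
  have hτδ : 12 * τ ≤ δ * η := by rw [hτ]; nlinarith [min_le_left δ 1]
  obtain ⟨c, hc, htr⟩ := hQ.exists_transfer hτ0 hε5
  filter_upwards [(tendsto_sampleSize p).eventually_gt_atTop 0,
    (tendsto_sampleSize p).eventually_ge_atTop (4 * p),
    hh.tendsto_infty.eventually_ge_atTop (2 * p * B ^ p / τ),
    hQ.eventually_numerator_le hwK hp hD hcont hLip hh hc,
    hQ.eventually_denominator_le hu hwK hp hD hh hc] with n hN hN4 hNh hnum hden t hpt htn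
  have hgm := hu.measurable_marginal hD
  have hhn := hh.h_pos n
  obtain ⟨N, hNdef⟩ : ∃ N, N = sampleSize p n := ⟨_, rfl⟩
  rw [← hNdef] at hN hN4 hNh hnum hden
  have hmid : 2 * p * (B / h n) ^ p / N ≤ τ := by
    rw [div_le_iff₀ hτ0] at hNh
    rw [div_pow, mul_div_assoc', div_div, div_le_iff₀ (by positivity)]
    linarith
  have hl1 : ((t - 2 * p).toNat : ℝ) ≤ N := by
    have : ((t - 2 * p).toNat : ℤ) ≤ (n : ℤ) - p + 1 := by omega
    rw [hNdef, sampleSize]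
    exact_mod_cast this
  have hl2 : ((n + 1 - t - p).toNat : ℝ) ≤ N := by
    have : ((n + 1 - t - p).toNat : ℤ) ≤ (n : ℤ) - p + 1 := by omega
    rw [hNdef, sampleSize]
    exact_mod_cast this
  have hdep1 : (t - 2 * p).toNat ≠ 0 →
      Set.Ico ((p : ℤ) + 1 - p) (p + 1 + (t - 2 * p).toNat) ⊆ Set.Iic (t - p) := fun h0 k hk => by
    have := hk.2
    simp only [Set.mem_Iic]
    omega
  have hdep2 : (n + 1 - t - p).toNat ≠ 0 →
      Set.Ico (t + p + 1 - p) (t + p + 1 + (n + 1 - t - p).toNat) ⊆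
        Set.Ioc t (t + p + 1 + (n + 1 - t - p).toNat) := fun _ k hk =>
    ⟨by have := hk.1; omega, hk.2.le⟩
  obtain ⟨Z₁, hZ₁⟩ : ∃ Z, Z = centredNumer κ w K (h n) (h₀ n) N v (p + 1) (t - 2 * p).toNat :=
    ⟨_, rfl⟩
  obtain ⟨Z₂, hZ₂⟩ : ∃ Z, Z = centredNumer κ w K (h n) (h₀ n) N v (t + p + 1)
    (n + 1 - t - p).toNat := ⟨_, rfl⟩
  obtain ⟨Z₃, hZ₃⟩ : ∃ Z, Z = centredDenom (marginalDensity p D Q u) w (h n) N (p + 1)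
    (t - 2 * p).toNat := ⟨_, rfl⟩
  obtain ⟨Z₄, hZ₄⟩ : ∃ Z, Z = centredDenom (marginalDensity p D Q u) w (h n) N (t + p + 1)
    (n + 1 - t - p).toNat := ⟨_, rfl⟩
  have b1 : Q {y | τ ≤ |Z₁ y (lagVec p y t)|} ≤ ε / 5 := by
    rw [hZ₁]
    exact htr t _ (measurable_centredNumer hwK hp _ _ _ _ _ _)
      (Or.inl fun x => dependsOn_centredNumer _ _ _ _ _ _ x hdep1) (hnum _ _ hl1)
  have b2 : Q {y | τ ≤ |Z₂ y (lagVec p y t)|} ≤ ε / 5 := by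
    rw [hZ₂]
    exact htr t _ (measurable_centredNumer hwK hp _ _ _ _ _ _)
      (Or.inr ⟨_, fun x => dependsOn_centredNumer _ _ _ _ _ _ x hdep2⟩) (hnum _ _ hl2)
  have b3 : Q {y | τ ≤ |Z₃ y (lagVec p y t)|} ≤ ε / 5 := by
    rw [hZ₃]
    exact htr t _ (measurable_centredDenom hwK hp hgm _ _ _ _)
      (Or.inl fun x => dependsOn_centredDenom _ _ _ _ _ x hdep1) (hden _ _ hl1)
  have b4 : Q {y | τ ≤ |Z₄ y (lagVec p y t)|} ≤ ε / 5 := by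
    rw [hZ₄]
    exact htr t _ (measurable_centredDenom hwK hp hgm _ _ _ _)
      (Or.inr ⟨_, fun x => dependsOn_centredDenom _ _ _ _ _ x hdep2⟩) (hden _ _ hl2)
  have hsub : {y | δ < |condCDFEst p n w K (h n) (h₀ n) y (y (n + 1)) v (lagVec p y t) -
        (κ (lagVec p y t)).real (Set.Iic v)|} ⊆
      {y | τ ≤ |Z₁ y (lagVec p y t)|} ∪ ({y | τ ≤ |Z₂ y (lagVec p y t)|} ∪
        ({y | τ ≤ |Z₃ y (lagVec p y t)|} ∪ ({y | τ ≤ |Z₄ y (lagVec p y t)|} ∪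
          {y | marginalDensity p D Q u (lagVec p y t) < η}))) := by
    intro y hy
    by_contra hcon
    simp only [Set.mem_union, Set.mem_ofPred_eq, not_or, not_le, not_lt] at hcon hy
    obtain ⟨g1, g2, g3, g4, g5⟩ := hcon
    rw [hZ₁] at g1
    rw [hZ₂] at g2
    rw [hZ₃] at g3
    rw [hZ₄] at g4
    exact absurd (abs_condCDFEst_sub_le hwK hpt htn hB hhn hNdef.symm hN hN4 hη hτη hτδ hmid g5
      g1 g2 g3 g4) (not_le.2 hy)
  calc _ ≤ ε / 5 + (ε / 5 + (ε / 5 + (ε / 5 + ε / 5))) :=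
        (measure_mono hsub).trans ((measure_union_le _ _).trans (add_le_add b1
          ((measure_union_le _ _).trans (add_le_add b2 ((measure_union_le _ _).trans
            (add_le_add b3 ((measure_union_le _ _).trans (add_le_add b4 (hgη t)))))))))
    _ = 5 * (ε / 5) := by ring
    _ = ε := ENNReal.mul_div_cancel (by norm_num) ENNReal.ofNat_ne_top

end

end MDCP

end

/-! ### Uniformity in the argument, estimated ranks, and the probability integral transform -/

noncomputable section

set_option linter.unusedSectionVars false

namespace MDCP

section

variable {p : ℕ} {κ : Kernel (Fin p → ℝ) ℝ} [IsMarkovKernel κ] {D : Set ℝ}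
  {Q : Measure (ℤ → ℝ)} [IsProbabilityMeasure Q] {w K : ℝ → ℝ}

/-- Pointwise closeness on a grid of a monotone function to a Lipschitz one gives uniform
closeness. -/
lemma abs_sub_le_of_grid {G F : ℝ → ℝ} (hG : Monotone G) {L : ℝ≥0} (hF : LipschitzWith L F)
    {a s δ : ℝ} (hs : 0 < s) {k : ℕ} (hgrid : ∀ i ≤ k + 1, |G (a + i * s) - F (a + i * s)| ≤ δ)
    {v : ℝ} (hv : v ∈ Set.Icc a (a + k * s)) : |G v - F v| ≤ δ + L * s := by
  obtain ⟨i, hi⟩ : ∃ i : ℕ, i = ⌊(v - a) / s⌋₊ := ⟨_, rfl⟩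
  have h0 : 0 ≤ (v - a) / s := div_nonneg (sub_nonneg.2 hv.1) hs.le
  have h1 : (i : ℝ) * s ≤ v - a := by
    rw [← le_div_iff₀ hs, hi]
    exact Nat.floor_le h0
  have h2 : v - a < (i + 1 : ℝ) * s := by
    rw [← div_lt_iff₀ hs, hi]
    exact Nat.lt_floor_add_one _
  have hik : i ≤ k := by
    have : (i : ℝ) * s ≤ k * s := by linarith [hv.2]
    exact_mod_cast le_of_mul_le_mul_right this hs
  have g1 := abs_le.1 (hgrid i (by omega))
  have g2 := abs_le.1 (hgrid (i + 1) (by omega))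
  push_cast at g2
  have m1 : G (a + i * s) ≤ G v := hG (by linarith)
  have m2 : G v ≤ G (a + (i + 1) * s) := hG (by linarith)
  have l1 := hF.dist_le_mul v (a + i * s)
  have l2 := hF.dist_le_mul (a + (i + 1) * s) v
  rw [Real.dist_eq, Real.dist_eq] at l1 l2
  have l1' : |v - (a + i * s)| ≤ s := by rw [abs_le]; constructor <;> linarith
  have l2' : |a + (i + 1) * s - v| ≤ s := by rw [abs_le]; constructor <;> linarith
  have l1'' := abs_le.1 (l1.trans (mul_le_mul_of_nonneg_left l1' L.2))
  have l2'' := abs_le.1 (l2.trans (mul_le_mul_of_nonneg_left l2' L.2))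
  rw [abs_le]
  constructor <;> linarith

/-- Monotonicity lets finitely many arguments control all of them, as needed to insert the random
argument Y_t. It holds even for a vanishing denominator, where the quotient is `0` by convention. -/
lemma monotone_condCDFEst (hwK : KernelConditions p w K) {h h₀ : ℝ} (hh : 0 < h) (hh₀ : 0 < h₀)
    {n : ℕ} (hN : 0 ≤ sampleSize p n) (y : ℤ → ℝ) (c : ℝ) (x : Fin p → ℝ) :
    Monotone fun v => condCDFEst p n w K h h₀ y c v x := by
  intro v v' hv
  have hW0 : ∀ u x : Fin p → ℝ, 0 ≤ prodWeight w h u x := prodWeight_nonneg hwK.w_nonneg hh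
  simp only [condCDFEst]
  refine div_le_div_of_nonneg_right ?_ (mul_nonneg (by positivity)
    (Finset.sum_nonneg fun i _ => hW0 _ _))
  refine mul_le_mul_of_nonneg_left (Finset.sum_le_sum fun i _ => ?_) (by positivity)
  refine mul_le_mul_of_nonneg_left (hwK.K_mono ?_) (hW0 _ _)
  gcongr

/-- The rank of the value at time `t` in its conditional distribution. -/
def rank (κ : Kernel (Fin p → ℝ) ℝ) (y : ℤ → ℝ) (t : ℤ) : ℝ :=
  (κ (lagVec p y (t - 1))).real (Set.Iic (y t))

/-- The estimated ranks are consistent. -/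
lemma PathLaw.eventually_rankEst_le (hQ : PathLaw p κ D Q) (hwK : KernelConditions p w K)
    (hp : 1 ≤ p) (hD : MeasurableSet D) [IsFiniteMeasure (volume.restrict (cube p D))]
    {C : ℝ} (hC : 0 < C) (hDC : D ⊆ Set.Icc (-C) C)
    (hcont : ∀ v, ContinuousOn (fun x => (κ x).real (Set.Iic v)) (cube p D))
    (hLip : ∃ L : ℝ≥0, ∀ x ∈ cube p D, LipschitzWith L fun y => (κ x).real (Set.Iic y))
    {h h₀ : ℕ → ℝ} (hh : BandwidthConditions p h h₀) {δ : ℝ} (hδ : 0 < δ) {ε : ℝ≥0∞}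
    (hε : 0 < ε) :
    ∀ᶠ n : ℕ in atTop, ∀ t : ℤ, p + 1 ≤ t → t ≤ n + 1 →
      Q {y | δ < |rankEst p n w K (h n) (h₀ n) y (y (n + 1)) t - rank κ y t|} ≤ ε := by
  obtain ⟨L, hL⟩ := hLip
  -- Chosen so that the mesh 2C/k satisfies L · mesh ≤ δ/2. The grid has k + 2 points, one beyond C,
  -- so that each value in [-C, C] has a grid point strictly to its right.
  obtain ⟨k, hk⟩ := exists_nat_gt (4 * C * (L + 1) / δ)
  have hk0 : (0 : ℝ) < k := lt_trans (by positivity) hk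
  obtain ⟨s, hs⟩ : ∃ s, s = 2 * C / k := ⟨_, rfl⟩
  have hs0 : 0 < s := by rw [hs]; positivity
  have hks : k * s = 2 * C := by rw [hs]; field_simp
  have hLs : L * s ≤ δ / 2 := by
    rw [div_lt_iff₀ hδ] at hk
    rw [hs, mul_div_assoc', div_le_iff₀ hk0]
    nlinarith [L.2]
  obtain ⟨ε', hε'⟩ : ∃ ε', ε' = ε / (k + 2 : ℕ) := ⟨_, rfl⟩
  have hε'0 : 0 < ε' := by
    rw [hε']; exact ENNReal.div_pos hε.ne' (ENNReal.natCast_ne_top _)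
  have hall : ∀ᶠ n : ℕ in atTop, ∀ i ∈ Finset.range (k + 2), ∀ t : ℤ, p ≤ t → t ≤ n →
      Q {y | δ / 2 < |condCDFEst p n w K (h n) (h₀ n) y (y (n + 1)) (-C + i * s) (lagVec p y t) -
        (κ (lagVec p y t)).real (Set.Iic (-C + i * s))|} ≤ ε' :=
    (eventually_all_finset _).2 fun i _ =>
      hQ.eventually_condCDFEst_le hwK hp hD (hcont _) ⟨L, hL⟩ hh (half_pos hδ) hε'0
  filter_upwards [hall, (tendsto_sampleSize p).eventually_ge_atTop 0] with n hn hN t hpt htn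
  have hbad : Q (⋃ i ∈ Finset.range (k + 2), {y | δ / 2 < |condCDFEst p n w K (h n) (h₀ n) y
      (y (n + 1)) (-C + i * s) (lagVec p y (t - 1)) -
        (κ (lagVec p y (t - 1))).real (Set.Iic (-C + i * s))|}) ≤ ε := by
    refine (measure_biUnion_finset_le _ _).trans ?_
    -- The rank at time t conditions on the lag vector at t - 1, which lies in the range covered by
    -- pointwise consistency.
    refine (Finset.sum_le_sum fun i hi => hn i hi (t - 1) (by omega) (by omega)).trans ?_
    rw [Finset.sum_const, Finset.card_range, nsmul_eq_mul, hε']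
    exact ENNReal.mul_div_le
  refine (measure_mono_ae ?_).trans hbad
  filter_upwards [hQ.mem, hQ.lagVec_mem] with y hyD hyc hy
  by_contra hcon
  have haug : augment n y (y (n + 1)) = y := Function.update_eq_self _ _
  have h1 := abs_sub_le_of_grid (monotone_condCDFEst hwK (hh.h_pos n) (hh.h₀_pos n) hN y
    (y (n + 1)) (lagVec p y (t - 1))) (hL _ (hyc (t - 1))) hs0 (a := -C) (k := k) (δ := δ / 2)
    (fun i hi => not_lt.1 fun hlt => hcon (Set.mem_iUnion₂.2
      ⟨i, Finset.mem_range.2 (by omega), hlt⟩)) (v := y t) (by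
      have := hDC (hyD t)
      exact ⟨this.1, by linarith [this.2]⟩)
  have h2 : δ < |rankEst p n w K (h n) (h₀ n) y (y (n + 1)) t - rank κ y t| := hy
  simp only [rankEst, haug, rank] at h2
  linarith

/-- The distribution function of a law without atoms is uniformly distributed under it. -/
lemma measureReal_cdf_lt_le {μ : Measure ℝ} [IsProbabilityMeasure μ]
    (hc : Continuous fun z => μ.real (Set.Iic z)) {r : ℝ} (hr : 0 < r) :
    μ.real {z | μ.real (Set.Iic z) < r} ≤ r := by
  rcases le_or_gt 1 r with h1 | h1
  · exact measureReal_le_one.trans h1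
  · obtain ⟨z, hz⟩ : ∃ z, μ.real (Set.Iic z) = r := by
      have hb := (tendsto_cdf_atBot μ).eventually (gt_mem_nhds hr)
      have ht := (tendsto_cdf_atTop μ).eventually (lt_mem_nhds h1)
      obtain ⟨a, ha⟩ := hb.exists
      obtain ⟨b, hb⟩ := ht.exists
      rw [cdf_eq_real] at ha hb
      exact mem_range_of_exists_le_of_exists_ge hc ⟨a, ha.le⟩ ⟨b, hb.le⟩
    rw [← hz]
    refine measureReal_mono fun z' hz' => ?_
    by_contra hcon
    exact absurd (measureReal_mono (Set.Iic_subset_Iic.2 (not_le.1 hcon).le) : μ.real _ ≤ _)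
      (not_le.2 hz')

lemma le_measureReal_cdf_le {μ : Measure ℝ} [IsProbabilityMeasure μ]
    (hc : Continuous fun z => μ.real (Set.Iic z)) {r : ℝ} (hr : r < 1) :
    r ≤ μ.real {z | μ.real (Set.Iic z) ≤ r} := by
  rcases le_or_gt r 0 with h0 | h0
  · exact h0.trans measureReal_nonneg
  · obtain ⟨z, hz⟩ : ∃ z, μ.real (Set.Iic z) = r := by
      have hb := (tendsto_cdf_atBot μ).eventually (gt_mem_nhds h0)
      have ht := (tendsto_cdf_atTop μ).eventually (lt_mem_nhds hr)
      obtain ⟨a, ha⟩ := hb.exists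
      obtain ⟨b, hb⟩ := ht.exists
      rw [cdf_eq_real] at ha hb
      exact mem_range_of_exists_le_of_exists_ge hc ⟨a, ha.le⟩ ⟨b, hb.le⟩
    calc r = μ.real (Set.Iic z) := hz.symm
      _ ≤ _ := measureReal_mono fun z' hz' =>
        (measureReal_mono (Set.Iic_subset_Iic.2 hz') : μ.real _ ≤ _).trans hz.le

/-- The rank under a continuous distribution function is uniform on [0, 1], and the event says that
it lies in an open interval of length 2a around 1/2. -/
lemma measureReal_abs_cdf_sub_half_lt {μ : Measure ℝ} [IsProbabilityMeasure μ]
    (hc : Continuous fun z => μ.real (Set.Iic z)) {a : ℝ} (ha0 : 0 < a) (ha : a ≤ 1 / 2) :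
    μ.real {z | |μ.real (Set.Iic z) - 1 / 2| < a} = 2 * a := by
  have h1 : μ.real {z | μ.real (Set.Iic z) < 1 / 2 + a} = 1 / 2 + a := by
    -- Approximation by levels strictly below 1/2 + a passes from `≤` to `<`, and also covers a =
    -- 1/2, where the level reaches 1.
    refine le_antisymm (measureReal_cdf_lt_le hc (by linarith)) (le_of_forall_lt_imp_le_of_dense
      fun c hcr => (le_measureReal_cdf_le hc (by linarith)).trans (measureReal_mono fun z hz => ?_))
    exact lt_of_le_of_lt hz hcr
  have h2 : μ.real {z | μ.real (Set.Iic z) ≤ 1 / 2 - a} = 1 / 2 - a := by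
    refine le_antisymm (le_of_forall_gt_imp_ge_of_dense fun c hcr => le_trans (measureReal_mono
      fun z hz => ?_) (measureReal_cdf_lt_le hc (r := c) (by linarith)))
      (le_measureReal_cdf_le hc (by linarith))
    exact lt_of_le_of_lt hz hcr
  have h3 : {z | |μ.real (Set.Iic z) - 1 / 2| < a} =
      {z | μ.real (Set.Iic z) < 1 / 2 + a} \ {z | μ.real (Set.Iic z) ≤ 1 / 2 - a} := by
    ext z
    simp only [Set.mem_ofPred_eq, Set.mem_sdiff, abs_lt, not_le]
    constructor
    · rintro ⟨h, h'⟩; constructor <;> linarith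
    · rintro ⟨h, h'⟩; constructor <;> linarith
  rw [h3, measureReal_sdiff (fun z hz => ?_) (measurableSet_le hc.measurable measurable_const),
    h1, h2]
  · ring
  · simp only [Set.mem_ofPred_eq] at hz ⊢
    linarith

end

end MDCP

end

/-! ### The scores based on the true conditional distribution function -/

noncomputable section

set_option linter.unusedSectionVars false

namespace MDCP

section

variable {p : ℕ} {κ : Kernel (Fin p → ℝ) ℝ} [IsMarkovKernel κ] {D : Set ℝ}
  {Q : Measure (ℤ → ℝ)} [IsProbabilityMeasure Q] {w K : ℝ → ℝ}

lemma measurable_condCDF_prod :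
    Measurable fun a : (Fin p → ℝ) × ℝ => (κ a.1).real (Set.Iic a.2) := by
  have hs : MeasurableSet {b : ((Fin p → ℝ) × ℝ) × ℝ | b.2 ≤ b.1.2} :=
    measurableSet_le measurable_snd (measurable_snd.comp measurable_fst)
  exact (Kernel.measurable_kernel_prodMk_left (κ := κ.comap Prod.fst measurable_fst)
    hs).ennreal_toReal

lemma measurable_rank (t : ℤ) : Measurable fun y => rank κ y t :=
  measurable_condCDF_prod.comp ((measurable_lagVec p (t - 1)).prodMk (measurable_pi_apply t))

lemma dependsOn_rank (t : ℤ) : DependsOn (fun y => rank κ y t) (Set.Iic t) := by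
  intro y y' hy
  simp only [rank]
  rw [hy t (Set.mem_Iic.2 le_rfl), show lagVec p y (t - 1) = lagVec p y' (t - 1) from
    dependsOn_lagVec p _ fun k hk => hy k (by have := hk.2; simp only [Set.mem_Iic]; omega)]

lemma lagVec_update (y : ℤ → ℝ) (t : ℤ) (z : ℝ) :
    lagVec p (Function.update y t z) (t - 1) = lagVec p y (t - 1) :=
  dependsOn_lagVec p _ fun k hk => Function.update_of_ne (by have := hk.2; omega) _ _

lemma rank_update (y : ℤ → ℝ) (t : ℤ) (z : ℝ) :
    rank κ (Function.update y t z) t = (κ (lagVec p y (t - 1))).real (Set.Iic z) := by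
  rw [rank, lagVec_update, Function.update_self]

/-- The event that the conformity score at time `t` is below `a`. -/
def lowScore (κ : Kernel (Fin p → ℝ) ℝ) (a : ℝ) (t : ℤ) : Set (ℤ → ℝ) :=
  {y | |rank κ y t - 1 / 2| < a}

lemma measurableSet_lowScore (a : ℝ) (t : ℤ) : MeasurableSet (lowScore κ a t) :=
  measurableSet_lt ((measurable_rank t).sub_const _).abs measurable_const

/-- The conformity score at time `t` is independent of the past. -/
lemma PathLaw.integral_mul_lowScore (hQ : PathLaw p κ D Q)
    (hLip : ∃ L : ℝ≥0, ∀ x ∈ cube p D, LipschitzWith L fun y => (κ x).real (Set.Iic y))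
    {a : ℝ} (ha0 : 0 < a) (ha : a ≤ 1 / 2) (t : ℤ) {φ : (ℤ → ℝ) → ℝ} (hφ : Measurable φ)
    (hφi : Integrable φ Q) (hdep : DependsOn φ (Set.Iic (t - 1))) :
    ∫ y, φ y * (lowScore κ a t).indicator (fun _ => (1 : ℝ)) y ∂Q = 2 * a * ∫ y, φ y ∂Q := by
  obtain ⟨L, hL⟩ := hLip
  have hm := measurableSet_lowScore (κ := κ) a t
  have hI : Measurable ((lowScore κ a t).indicator fun _ => (1 : ℝ)) :=
    measurable_const.indicator hm
  have hint : Integrable (fun y => φ y * (lowScore κ a t).indicator (fun _ => (1 : ℝ)) y) Q := by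
    refine hφi.mul_bdd (c := 1) hI.aestronglyMeasurable (Eventually.of_forall fun y => ?_)
    exact (norm_indicator_le_norm_self _ _).trans (by simp)
  -- Integrating out the value at `t` leaves `φ` untouched, and the inner probability of a low score
  -- is 2a whatever the past.
  rw [hQ.integral_markov t
    (Ψ := fun y => φ y * (lowScore κ a t).indicator (fun _ => (1 : ℝ)) y) (hφ.mul hI) hint, ← integral_const_mul]
  · refine integral_congr_ae ?_
    filter_upwards [hQ.lagVec_mem] with y hy
    have h1 : ∀ z, φ (Function.update y t z) = φ y := fun z =>
      hdep fun k hk => Function.update_of_ne (by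
        have : k ≤ t - 1 := hk
        omega) _ _
    have h2 : ∀ z, (lowScore κ a t).indicator (fun _ => (1 : ℝ)) (Function.update y t z) =
        {z | |(κ (lagVec p y (t - 1))).real (Set.Iic z) - 1 / 2| < a}.indicator
          (fun _ => (1 : ℝ)) z := fun z => by
      classical
      simp only [Set.indicator_apply, lowScore, Set.mem_ofPred_eq, rank_update]
    have hcF := (hL _ (hy (t - 1))).continuous
    have hms : MeasurableSet {z | |(κ (lagVec p y (t - 1))).real (Set.Iic z) - 1 / 2| < a} :=
      measurableSet_lt (hcF.measurable.sub_const _).abs measurable_const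
    simp only [h1, h2]
    rw [integral_const_mul, integral_indicator hms]
    simp only [integral_const, smul_eq_mul, mul_one, measureReal_restrict_apply_univ]
    rw [measureReal_abs_cdf_sub_half_lt hcF ha0 ha]
    ring
  · intro y y' hy
    classical
    have h1 : φ y = φ y' := hdep fun k hk => hy k (by
      have : k ≤ t - 1 := hk
      simp only [Set.mem_Iic]
      omega)
    have h2 : rank κ y t = rank κ y' t := dependsOn_rank t hy
    simp only [h1, Set.indicator_apply, lowScore, Set.mem_ofPred_eq, h2]

lemma PathLaw.measureReal_lowScore (hQ : PathLaw p κ D Q)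
    (hLip : ∃ L : ℝ≥0, ∀ x ∈ cube p D, LipschitzWith L fun y => (κ x).real (Set.Iic y))
    {a : ℝ} (ha0 : 0 < a) (ha : a ≤ 1 / 2) (t : ℤ) : Q.real (lowScore κ a t) = 2 * a := by
  have h := hQ.integral_mul_lowScore hLip ha0 ha t (φ := fun _ => 1) measurable_const
    (integrable_const _) fun _ _ _ => rfl
  simp only [one_mul] at h
  rw [integral_indicator (measurableSet_lowScore a t)] at h
  simpa using h

/-- The average of indicators over the sample times. -/
def freq (p n : ℕ) (A : ℤ → Set (ℤ → ℝ)) (y : ℤ → ℝ) : ℝ :=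
  (1 / sampleSize p n) * ∑ t ∈ Finset.Icc ((p : ℤ) + 1) (n + 1),
    (A t).indicator (fun _ => (1 : ℝ)) y

lemma sampleSize_eq_natCast {p n : ℕ} (h : p ≤ n) : sampleSize p n = ((n + 1 - p : ℕ) : ℝ) := by
  rw [Nat.cast_sub (by omega), sampleSize]
  push_cast
  ring

/-- The law of large numbers for the conformity scores. -/
lemma PathLaw.eventually_freq_lowScore_le (hQ : PathLaw p κ D Q)
    (hLip : ∃ L : ℝ≥0, ∀ x ∈ cube p D, LipschitzWith L fun y => (κ x).real (Set.Iic y))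
    {a : ℝ} (ha0 : 0 < a) (ha : a ≤ 1 / 2) {δ ε : ℝ} (hδ : 0 < δ) (hε : 0 < ε) :
    ∀ᶠ n : ℕ in atTop, Q.real {y | δ ≤ |freq p n (lowScore κ a) y - 2 * a|} ≤ ε := by
  filter_upwards [eventually_ge_atTop p, (tendsto_sampleSize p).eventually_gt_atTop 0,
    (tendsto_sampleSize p).eventually_ge_atTop (2 / (δ ^ 2 * ε))] with n hpn hN hNε
  have hNn := sampleSize_eq_natCast hpn
  obtain ⟨l, hl⟩ : ∃ l, l = n + 1 - p := ⟨_, rfl⟩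
  rw [← hl] at hNn
  obtain ⟨I, hI⟩ : ∃ I : ℤ → (ℤ → ℝ) → ℝ,
    I = fun t => (lowScore κ a t).indicator fun _ => (1 : ℝ) := ⟨_, rfl⟩
  have hIm : ∀ t, Measurable (I t) := fun t => by
    rw [hI]; exact measurable_const.indicator (measurableSet_lowScore a t)
  have hI01 : ∀ t y, 0 ≤ I t y ∧ I t y ≤ 1 := fun t y => by
    rw [hI]
    exact ⟨Set.indicator_nonneg (fun _ _ => zero_le_one) _,
      Set.indicator_le_self' (fun _ _ => zero_le_one) _⟩
  obtain ⟨ξ, hξ⟩ : ∃ ξ : ℕ → (ℤ → ℝ) → ℝ, ξ = fun (i : ℕ) y => I (p + 1 + i) y - 2 * a := ⟨_, rfl⟩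
  have hξm : ∀ i, Measurable (ξ i) := fun i => by rw [hξ]; exact (hIm _).sub_const _
  have hξ1 : ∀ i y, |ξ i y| ≤ 1 := fun i y => by
    rw [hξ, abs_le]
    constructor <;> linarith [(hI01 (p + 1 + i) y).1, (hI01 (p + 1 + i) y).2]
  have hξmem : ∀ i, MemLp (ξ i) 2 Q := fun i =>
    MemLp.of_bound (hξm i).aestronglyMeasurable 1 (Eventually.of_forall (hξ1 i))
  have hξi : ∀ i, Integrable (ξ i) Q := fun i => (hξmem i).integrable one_le_two
  have hdepI : ∀ t, DependsOn (I t) (Set.Iic t) := fun t y y' hy => by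
    classical
    have h2 : rank κ y t = rank κ y' t := dependsOn_rank t hy
    simp only [hI, Set.indicator_apply, lowScore, Set.mem_ofPred_eq, h2]
  -- The centred indicators are orthogonal at lag one because each is centred given its past; the
  -- variance of the sum is at most 2l, so Chebyshev's inequality asks for N ≥ 2/(δ²ε).
  have hsq := integral_sum_sq_le hξmem (q := 1) (v := 1) zero_le_one
    (fun i => by
      calc ∫ y, ξ i y ^ 2 ∂Q ≤ ∫ _, (1 : ℝ) ∂Q := by
            refine integral_mono (hξmem i).integrable_sq (integrable_const _) fun y => ?_
            rw [← sq_abs]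
            exact pow_le_one₀ (abs_nonneg _) (hξ1 i y)
        _ = 1 := by simp)
    (fun i j hij => by
      have hdep : DependsOn (ξ i) (Set.Iic ((p : ℤ) + 1 + j - 1)) := fun y y' hy => by
        rw [hξ]
        exact congrArg (· - 2 * a) (hdepI _ fun k hk => hy k (by
          simp only [Set.mem_Iic] at hk ⊢
          omega))
      have h1 := hQ.integral_mul_lowScore hLip ha0 ha (p + 1 + j) (hξm i) (hξi i) hdep
      have h2 : ∀ y, ξ i y * ξ j y = ξ i y * I (p + 1 + j) y - ξ i y * (2 * a) := fun y => by
        have : ξ j y = I (p + 1 + j) y - 2 * a := by rw [hξ]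
        rw [this, mul_sub]
      have h3 : Integrable (fun y => ξ i y * I (p + 1 + j) y) Q :=
        (hξi i).mul_bdd (c := 1) (hIm _).aestronglyMeasurable (Eventually.of_forall fun y => by
          rw [Real.norm_of_nonneg (hI01 _ _).1]; exact (hI01 _ _).2)
      simp only [h2]
      rw [integral_sub h3 ((hξi i).mul_const _), integral_mul_const]
      rw [hI]
      rw [h1]
      ring) l
  have hfreq : ∀ y, freq p n (lowScore κ a) y - 2 * a =
      (∑ i ∈ Finset.range l, ξ i y) / sampleSize p n := fun y => by
    have e1 : ∑ i ∈ Finset.range l, ξ i y =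
        ∑ i ∈ Finset.range l, I (p + 1 + i) y - l * (2 * a) := by
      rw [hξ]
      simp [Finset.sum_sub_distrib]
    rw [freq, sum_Icc_eq_sum_range, e1, hNn,
      show ((n : ℤ) + 1 + 1 - (p + 1)).toNat = l by omega, hI]
    have : (l : ℝ) ≠ 0 := by rw [← hNn]; exact hN.ne'
    field_simp
  have hSi : Integrable (fun y => (∑ i ∈ Finset.range l, ξ i y) ^ 2) Q :=
    (memLp_finsetSum _ fun i _ => hξmem i).integrable_sq
  have hcheb := mul_meas_ge_le_integral_of_nonneg (μ := Q)
    (Eventually.of_forall fun y => sq_nonneg (∑ i ∈ Finset.range l, ξ i y)) hSi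
    ((δ * sampleSize p n) ^ 2)
  have hset : {y | δ ≤ |freq p n (lowScore κ a) y - 2 * a|} ⊆
      {y | (δ * sampleSize p n) ^ 2 ≤ (∑ i ∈ Finset.range l, ξ i y) ^ 2} := by
    intro y hy
    have hy' : δ ≤ |freq p n (lowScore κ a) y - 2 * a| := hy
    rw [hfreq, abs_div, abs_of_pos hN, le_div_iff₀ hN] at hy'
    show (δ * sampleSize p n) ^ 2 ≤ (∑ i ∈ Finset.range l, ξ i y) ^ 2
    rw [← sq_abs (∑ i ∈ Finset.range l, ξ i y)]
    gcongr
  refine (measureReal_mono hset).trans ?_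
  have h5 := hcheb.trans hsq
  rw [← hNn] at h5
  rw [div_le_iff₀ (by positivity)] at hNε
  have hN2 : 0 < (δ * sampleSize p n) ^ 2 := by positivity
  refine le_of_mul_le_mul_left (h5.trans ?_) hN2
  push_cast
  nlinarith

/-- The average of events of small probability is small in probability. -/
lemma measureReal_freq_le {p n : ℕ} (hpn : p ≤ n) {A : ℤ → Set (ℤ → ℝ)}
    (hA : ∀ t, MeasurableSet (A t)) {ε γ : ℝ} (hγ : 0 < γ)
    (hε : ∀ t : ℤ, p + 1 ≤ t → t ≤ n + 1 → Q.real (A t) ≤ ε) :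
    Q.real {y | γ ≤ freq p n A y} ≤ ε / γ := by
  have hNn := sampleSize_eq_natCast hpn
  have hN : 0 < sampleSize p n := by
    rw [hNn]; exact_mod_cast (by omega : 0 < n + 1 - p)
  have hi : ∀ t, Integrable ((A t).indicator fun _ => (1 : ℝ)) Q := fun t =>
    (integrable_const _).indicator (hA t)
  have hint : Integrable (freq p n A) Q :=
    (integrable_finsetSum _ fun t _ => hi t).const_mul _
  have hnn : ∀ y, 0 ≤ freq p n A y := fun y =>
    mul_nonneg (by positivity)
      (Finset.sum_nonneg fun t _ => Set.indicator_nonneg (fun _ _ => zero_le_one) _)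
  -- Markov's inequality: the mean of the frequency is at most `ε`, with no assumption on the
  -- dependence between the events.
  have h1 := mul_meas_ge_le_integral_of_nonneg (Eventually.of_forall hnn) hint γ
  rw [le_div_iff₀ hγ, mul_comm]
  refine h1.trans ?_
  simp only [freq]
  rw [integral_const_mul, integral_finsetSum _ fun t _ => hi t]
  have h2 : ∀ t, ∫ y, (A t).indicator (fun _ => (1 : ℝ)) y ∂Q = Q.real (A t) := fun t => by
    rw [integral_indicator (hA t)]; simp
  simp only [h2]
  calc 1 / sampleSize p n * ∑ t ∈ Finset.Icc ((p : ℤ) + 1) (n + 1), Q.real (A t)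
      ≤ 1 / sampleSize p n * ∑ t ∈ Finset.Icc ((p : ℤ) + 1) (n + 1), ε := by
        gcongr with t ht
        exact hε t (Finset.mem_Icc.1 ht).1 (Finset.mem_Icc.1 ht).2
    _ = ε := by
        rw [Finset.sum_const, nsmul_eq_mul, Int.card_Icc,
          show ((n : ℤ) + 1 + 1 - (p + 1)).toNat = n + 1 - p by omega, ← hNn]
        field_simp

end

end MDCP

end

/-! ### The conformal p-value against the true score -/

noncomputable section

set_option linter.unusedSectionVars false

namespace MDCP

section

variable {p : ℕ} {κ : Kernel (Fin p → ℝ) ℝ} [IsMarkovKernel κ] {D : Set ℝ}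
  {Q : Measure (ℤ → ℝ)} [IsProbabilityMeasure Q] {w K : ℝ → ℝ}

lemma measurable_rankEst (hwK : KernelConditions p w K) (hp : 1 ≤ p) (n : ℕ) (h h₀ : ℝ) (t : ℤ) :
    Measurable fun y : ℤ → ℝ => rankEst p n w K h h₀ y (y (n + 1)) t := by
  have haug : ∀ y : ℤ → ℝ, augment n y (y (n + 1)) = y := fun y => Function.update_eq_self _ _
  have hW : ∀ i : ℤ, Measurable fun y : ℤ → ℝ =>
      prodWeight w h (lagVec p y (i - 1)) (lagVec p y (t - 1)) := fun i =>
    (measurable_prodWeight (hwK.continuous_w hp).measurable h).comp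
      ((measurable_lagVec p (i - 1)).prodMk (measurable_lagVec p (t - 1)))
  have hK : ∀ i : ℤ, Measurable fun y : ℤ → ℝ => K ((y t - y i) / h₀) := fun i =>
    hwK.measurable_K.comp
      (((measurable_pi_apply t).sub (measurable_pi_apply i)).div_const _)
  simp only [rankEst, condCDFEst, haug]
  exact ((Finset.measurable_fun_sum _ fun i _ => (hW i).mul (hK i)).const_mul _).div
    ((Finset.measurable_fun_sum _ fun i _ => hW i).const_mul _)

lemma measurable_pValue (hwK : KernelConditions p w K) (hp : 1 ≤ p) (n : ℕ) (h h₀ : ℝ) :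
    Measurable fun y : ℤ → ℝ => pValue p n w K h h₀ y (y (n + 1)) := by
  have hs : ∀ t, Measurable fun y : ℤ → ℝ => score p n w K h h₀ y (y (n + 1)) t := fun t =>
    ((measurable_rankEst hwK hp n h h₀ t).sub_const _).abs
  unfold pValue
  refine (Finset.measurable_fun_sum _ fun t _ => ?_).const_mul _
  exact Measurable.ite (measurableSet_le (hs _) (hs t)) measurable_const measurable_const

/-- The p-value exceeds the level exactly if the true conformity score is small, as soon as the
estimated ranks and the empirical frequencies are accurate. -/
lemma lt_pValue_iff {n : ℕ} (hpn : p ≤ n) {h h₀ α δ : ℝ} (hδ : 0 < δ) {y : ℤ → ℝ}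
    (h1 : |rankEst p n w K h h₀ y (y (n + 1)) (n + 1) - rank κ y (n + 1)| ≤ δ)
    (h2 : freq p n (fun t => {y | δ < |rankEst p n w K h h₀ y (y (n + 1)) t - rank κ y t|}) y < δ)
    (h3 : |freq p n (lowScore κ ((1 - α) / 2 - δ)) y - 2 * ((1 - α) / 2 - δ)| < δ)
    (h4 : |freq p n (lowScore κ ((1 - α) / 2 + δ)) y - 2 * ((1 - α) / 2 + δ)| < δ)
    (h5 : y ∈ lowScore κ ((1 - α) / 2 + 3 * δ) (n + 1) →
      y ∈ lowScore κ ((1 - α) / 2 - 3 * δ) (n + 1)) :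
    α < pValue p n w K h h₀ y (y (n + 1)) ↔ y ∈ lowScore κ ((1 - α) / 2) (n + 1) := by
  classical
  have hNn := sampleSize_eq_natCast hpn
  have hN : 0 < sampleSize p n := by
    rw [hNn]; exact_mod_cast (by omega : 0 < n + 1 - p)
  obtain ⟨e, he⟩ : ∃ e, e = fun t => score p n w K h h₀ y (y (n + 1)) t := ⟨_, rfl⟩
  obtain ⟨V, hV⟩ : ∃ V : ℤ → ℝ, V = fun t => |rank κ y t - 1 / 2| := ⟨_, rfl⟩
  obtain ⟨bad, hbad⟩ : ∃ bad : ℤ → ℝ, bad = fun t =>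
    {y | δ < |rankEst p n w K h h₀ y (y (n + 1)) t - rank κ y t|}.indicator (fun _ => (1 : ℝ)) y :=
    ⟨_, rfl⟩
  have hbad0 : ∀ t, 0 ≤ bad t := fun t => by
    rw [hbad]; exact Set.indicator_nonneg (fun _ _ => zero_le_one) _
  have hclose : ∀ t, |rankEst p n w K h h₀ y (y (n + 1)) t - rank κ y t| ≤ δ →
      |e t - V t| ≤ δ := fun t ht => by
    rw [he, hV]
    simp only [score]
    refine (abs_abs_sub_abs_le_abs_sub _ _).trans ?_
    rwa [sub_sub_sub_cancel_right]
  have hgood : ∀ t, bad t = 1 ∨ |e t - V t| ≤ δ := fun t => by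
    by_cases ht : δ < |rankEst p n w K h h₀ y (y (n + 1)) t - rank κ y t|
    · left
      rw [hbad]
      exact Set.indicator_of_mem (s := {y | δ < |rankEst p n w K h h₀ y (y (n + 1)) t -
        rank κ y t|}) ht _
    · exact Or.inr (hclose t (not_lt.1 ht))
  have hcl := abs_le.1 (hclose _ h1)
  -- In terms of strict inequalities: the p-value exceeds `α` exactly when the fraction of scores
  -- strictly below the last one is less than 1 - α.
  have hpv : pValue p n w K h h₀ y (y (n + 1)) = 1 - (1 / sampleSize p n) *
      ∑ t ∈ Finset.Icc ((p : ℤ) + 1) (n + 1), if e t < e (n + 1) then (1 : ℝ) else 0 := by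
    have h6 : ∀ t, (if score p n w K h h₀ y (y (n + 1)) (n + 1) ≤
        score p n w K h h₀ y (y (n + 1)) t then (1 : ℝ) else 0) =
        1 - if e t < e (n + 1) then (1 : ℝ) else 0 := fun t => by
      rw [he]
      by_cases hle : score p n w K h h₀ y (y (n + 1)) (n + 1) ≤ score p n w K h h₀ y (y (n + 1)) t
      · simp [hle, not_lt.2 hle]
      · simp [hle, not_le.1 hle]
    simp only [pValue]
    simp only [h6]
    rw [Finset.sum_sub_distrib, Finset.sum_const, Int.card_Icc,
      show ((n : ℤ) + 1 + 1 - (p + 1)).toNat = n + 1 - p by omega, nsmul_eq_mul, mul_one, ← hNn,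
      mul_sub, one_div_mul_cancel hN.ne']
  have hlow : ∀ a, freq p n (lowScore κ a) y = (1 / sampleSize p n) *
      ∑ t ∈ Finset.Icc ((p : ℤ) + 1) (n + 1), if V t < a then (1 : ℝ) else 0 := fun a => by
    rw [freq, hV]
    rfl
  have hfb : freq p n (fun t => {y | δ < |rankEst p n w K h h₀ y (y (n + 1)) t - rank κ y t|}) y =
      (1 / sampleSize p n) * ∑ t ∈ Finset.Icc ((p : ℤ) + 1) (n + 1), bad t := by
    rw [freq, hbad]
  have hmemV : ∀ a, y ∈ lowScore κ a (n + 1) ↔ V (n + 1) < a := fun a => by rw [hV]; rfl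
  rw [hmemV, hmemV] at h5
  rw [hmemV, hpv]
  rw [hlow] at h3 h4
  rw [hfb] at h2
  have h3' := abs_lt.1 h3
  have h4' := abs_lt.1 h4
  have hmono : ∀ F G : ℤ → ℝ, (∀ t, F t ≤ G t + bad t) →
      (1 / sampleSize p n) * ∑ t ∈ Finset.Icc ((p : ℤ) + 1) (n + 1), F t ≤
        (1 / sampleSize p n) * ∑ t ∈ Finset.Icc ((p : ℤ) + 1) (n + 1), G t +
        (1 / sampleSize p n) * ∑ t ∈ Finset.Icc ((p : ℤ) + 1) (n + 1), bad t := fun F G hFG => by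
    rw [← mul_add, ← Finset.sum_add_distrib]
    gcongr with t ht
    exact hFG t
  -- At a good time the estimated and true scores differ by at most `δ`, as they do at n + 1. So an
  -- estimated score below the last one forces V_t < (1 - α)/2 - δ, and the fraction stays below (1
  -- - α - 2δ) + δ + δ.
  by_cases hB : V (n + 1) < (1 - α) / 2 - 3 * δ
  · have h7 := hmono (fun t => if e t < e (n + 1) then (1 : ℝ) else 0)
      (fun t => if V t < (1 - α) / 2 - δ then (1 : ℝ) else 0) fun t => by
      rcases hgood t with hb | hg
      · rw [hb]; split_ifs <;> norm_num
      · have hg' := abs_le.1 hg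
        have hb := hbad0 t
        split_ifs
        · linarith
        · exfalso; linarith
        · linarith
        · linarith
    constructor
    · intro _; linarith
    · intro _; linarith
  -- Hypothesis `h5` excludes the window around (1 - α)/2. Above it, every good time with V_t < (1 -
  -- α)/2 + δ counts, so the fraction exceeds (1 - α + 2δ) - δ - δ.
  · have hB' : ¬ V (n + 1) < (1 - α) / 2 + 3 * δ := fun hlt => hB (h5 hlt)
    have h7 := hmono (fun t => if V t < (1 - α) / 2 + δ then (1 : ℝ) else 0)
      (fun t => if e t < e (n + 1) then (1 : ℝ) else 0) fun t => by
      rcases hgood t with hb | hg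
      · rw [hb]; split_ifs <;> norm_num
      · have hg' := abs_le.1 hg
        have hb := hbad0 t
        split_ifs
        · linarith
        · exfalso; linarith
        · linarith
        · linarith
    constructor
    · intro hlt; exfalso; linarith
    · intro hlt; exfalso; linarith

/-- Asymptotically the prediction set consists of the values with a small conformity score. -/
lemma PathLaw.eventually_lt_pValue_iff (hQ : PathLaw p κ D Q) (hwK : KernelConditions p w K)
    (hp : 1 ≤ p) (hD : MeasurableSet D) [IsFiniteMeasure (volume.restrict (cube p D))]
    {C : ℝ} (hC : 0 < C) (hDC : D ⊆ Set.Icc (-C) C)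
    (hcont : ∀ v, ContinuousOn (fun x => (κ x).real (Set.Iic v)) (cube p D))
    (hLip : ∃ L : ℝ≥0, ∀ x ∈ cube p D, LipschitzWith L fun y => (κ x).real (Set.Iic y))
    {h h₀ : ℕ → ℝ} (hh : BandwidthConditions p h h₀) {α : ℝ} (hα : α ∈ Set.Ioo (0 : ℝ) 1)
    {ε : ℝ} (hε : 0 < ε) :
    ∀ᶠ n : ℕ in atTop, Q.real {y | ¬ (α < pValue p n w K (h n) (h₀ n) y (y (n + 1)) ↔
      y ∈ lowScore κ ((1 - α) / 2) (n + 1))} ≤ ε := by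
  -- The window of half-width 3δ has probability 12δ ≤ ε/5; the other two bounds keep its endpoints
  -- inside (0, 1/2].
  obtain ⟨δ, hδ⟩ : ∃ δ, δ = min (ε / 60) (min ((1 - α) / 12) (α / 12)) := ⟨_, rfl⟩
  have hα0 := hα.1
  have hα1 := hα.2
  have hδ0 : 0 < δ := by
    rw [hδ]
    exact lt_min (by linarith) (lt_min (by linarith) (by linarith))
  have hδ1 : δ ≤ ε / 60 := by rw [hδ]; exact min_le_left _ _
  have hδ2 : δ ≤ (1 - α) / 12 := by rw [hδ]; exact (min_le_right _ _).trans (min_le_left _ _)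
  have hδ3 : δ ≤ α / 12 := by rw [hδ]; exact (min_le_right _ _).trans (min_le_right _ _)
  have hε5 : 0 < ε / 5 := by linarith
  -- The extra factor `δ` compensates for Markov's inequality applied to the frequency of badly
  -- estimated ranks at level `δ`.
  have hδε : 0 < δ * (ε / 5) := by positivity
  filter_upwards [eventually_ge_atTop p,
    hQ.eventually_rankEst_le hwK hp hD hC hDC hcont hLip hh hδ0 (ENNReal.ofReal_pos.2 hε5),
    hQ.eventually_rankEst_le hwK hp hD hC hDC hcont hLip hh hδ0 (ENNReal.ofReal_pos.2 hδε),
    hQ.eventually_freq_lowScore_le hLip (a := (1 - α) / 2 - δ) (by linarith) (by linarith) hδ0 hε5,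
    hQ.eventually_freq_lowScore_le hLip (a := (1 - α) / 2 + δ) (by linarith) (by linarith) hδ0 hε5]
    with n hpn g1 g2 g3 g4
  obtain ⟨A, hA⟩ : ∃ A : ℤ → Set (ℤ → ℝ), A = fun t =>
    {y | δ < |rankEst p n w K (h n) (h₀ n) y (y (n + 1)) t - rank κ y t|} := ⟨_, rfl⟩
  have hAm : ∀ t, MeasurableSet (A t) := fun t => by
    rw [hA]
    exact measurableSet_lt measurable_const
      ((measurable_rankEst hwK hp n _ _ t).sub (measurable_rank t)).abs
  have b1 : Q.real (A (n + 1)) ≤ ε / 5 := by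
    refine ENNReal.toReal_le_of_le_ofReal hε5.le ?_
    rw [hA]
    exact g1 (n + 1) (by omega) le_rfl
  have b2 : Q.real {y | δ ≤ freq p n A y} ≤ ε / 5 := by
    have := measureReal_freq_le (Q := Q) hpn hAm hδ0 (ε := δ * (ε / 5)) fun t ht1 ht2 => by
      refine ENNReal.toReal_le_of_le_ofReal hδε.le ?_
      rw [hA]
      exact g2 t ht1 ht2
    rwa [mul_div_cancel_left₀ _ hδ0.ne'] at this
  have b5 : Q.real (lowScore κ ((1 - α) / 2 + 3 * δ) (n + 1) \
      lowScore κ ((1 - α) / 2 - 3 * δ) (n + 1)) ≤ ε / 5 := by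
    rw [measureReal_sdiff (fun y hy => ?_) (measurableSet_lowScore _ _),
      hQ.measureReal_lowScore hLip (by linarith) (by linarith),
      hQ.measureReal_lowScore hLip (by linarith) (by linarith)]
    · linarith
    · exact lt_of_lt_of_le (show |rank κ y (n + 1) - 1 / 2| < _ from hy) (by linarith)
  have hsub : {y | ¬ (α < pValue p n w K (h n) (h₀ n) y (y (n + 1)) ↔
      y ∈ lowScore κ ((1 - α) / 2) (n + 1))} ⊆
      A (n + 1) ∪ ({y | δ ≤ freq p n A y} ∪
        ({y | δ ≤ |freq p n (lowScore κ ((1 - α) / 2 - δ)) y - 2 * ((1 - α) / 2 - δ)|} ∪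
        ({y | δ ≤ |freq p n (lowScore κ ((1 - α) / 2 + δ)) y - 2 * ((1 - α) / 2 + δ)|} ∪
        (lowScore κ ((1 - α) / 2 + 3 * δ) (n + 1) \
          lowScore κ ((1 - α) / 2 - 3 * δ) (n + 1))))) := by
    intro y hy
    by_contra hcon
    simp only [Set.mem_union, not_or] at hcon
    obtain ⟨c1, c2, c3, c4, c5⟩ := hcon
    rw [hA] at c1 c2
    refine hy (lt_pValue_iff hpn hδ0 (not_lt.1 c1) (not_le.1 c2) (not_le.1 c3) (not_le.1 c4) ?_)
    intro hmem
    by_contra hnot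
    exact c5 ⟨hmem, hnot⟩
  calc _ ≤ ε / 5 + (ε / 5 + (ε / 5 + (ε / 5 + ε / 5))) :=
        (measureReal_mono hsub).trans ((measureReal_union_le _ _).trans (add_le_add b1
          ((measureReal_union_le _ _).trans (add_le_add b2 ((measureReal_union_le _ _).trans
            (add_le_add g3 ((measureReal_union_le _ _).trans (add_le_add g4 b5))))))))
    _ = ε := by ring

end

end MDCP

end

/-! ### From the given process to its law on path space -/

noncomputable section

set_option linter.unusedSectionVars false

namespace MDCP

section

variable {Ω S : Type*} [MeasurableSpace Ω] [MeasurableSpace S] {P : Measure Ω}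
  [IsProbabilityMeasure P] {p : ℕ} {f : (ℕ → S) → ℝ} {ε : ℤ → Ω → S} {ε' : ℤ → ℤ → Ω → S}
  {Y : ℤ → Ω → ℝ} {κ : Kernel (Fin p → ℝ) ℝ} [IsMarkovKernel κ] {D : Set ℝ}

/-- The causal filter `e ↦ (f(e_t, e_{t-1}, …))_t`. -/
def causalFilter (f : (ℕ → S) → ℝ) (e : ℤ → S) (t : ℤ) : ℝ := f fun j => e (t - j)

lemma measurable_causalFilter (hf : Measurable f) : Measurable (causalFilter f) :=
  measurable_pi_lambda _ fun _ => hf.comp (measurable_pi_lambda _ fun _ => measurable_pi_apply _)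

lemma causalFilter_shiftSeq (i : ℤ) (e : ℤ → S) :
    causalFilter f (shiftSeq i e) = shiftSeq i (causalFilter f e) := by
  funext t
  simp only [causalFilter, shiftSeq]
  congr 1
  funext j
  congr 1
  ring

lemma IsL2MApproximable.measurable_path (hY : IsL2MApproximable P f ε ε' Y) :
    Measurable fun ω => fun s => Y s ω := by
  have : (fun ω => fun s => Y s ω) = causalFilter f ∘ fun ω k => ε k ω := by
    funext ω s
    exact hY.repr s ω
  rw [this]
  exact (measurable_causalFilter hY.measurable_fun).comp
    (measurable_pi_lambda _ fun k => hY.measurable_innov k)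

/-- The law of the series is the image of a product measure under the causal filter. -/
lemma IsL2MApproximable.measurePreserving_causalFilter (hY : IsL2MApproximable P f ε ε' Y) :
    MeasurePreserving (causalFilter f) (Measure.infinitePi fun _ : ℤ => P.map (ε 0))
      (P.map fun ω => fun s => Y s ω) := by
  have hE : Measurable fun ω => fun k => ε k ω :=
    measurable_pi_lambda _ fun k => hY.measurable_innov k
  -- Only the original innovations are needed to describe the law of the series.
  have hind : iIndepFun ε P := iIndepFun.precomp (g := (Sum.inl : ℤ → ℤ ⊕ ℤ × ℤ)) Sum.inl_injective hY.indep
  have hmap := hind.map_fun_eq_infinitePi_map₀ hE.aemeasurable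
  have hid : (fun k => P.map (ε k)) = fun _ => P.map (ε 0) :=
    funext fun k => (hY.identDistrib_innov k).map_eq
  rw [hid] at hmap
  refine ⟨measurable_causalFilter hY.measurable_fun, ?_⟩
  rw [← hmap, Measure.map_map (measurable_causalFilter hY.measurable_fun) hE]
  congr 1
  funext ω s
  exact (hY.repr s ω).symm

lemma isFiniteMeasure_restrict_cube (p : ℕ) {C : ℝ} (hDC : D ⊆ Set.Icc (-C) C) :
    IsFiniteMeasure (volume.restrict (cube p D)) := by
  have : IsFiniteMeasure (volume.restrict D) :=
    ⟨by rw [Measure.restrict_apply_univ]; exact (measure_mono hDC).trans_lt measure_Icc_lt_top⟩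
  rw [volume_restrict_cube]
  infer_instance

/-- Turns the conditional expectation form of the Markov property into a disintegration on path
space. The assumption concerns half-lines only; these determine the law of the present on each event
of the past. -/
lemma map_truncSeq_eq_compProd (hYm : Measurable fun ω => fun s => Y s ω)
    (hMarkov : IsMarkovOfOrder p P κ Y) (t : ℤ) :
    (P.map fun ω => fun s => Y s ω).map (fun y => (truncSeq (t - 1) y, y t)) =
      ((P.map fun ω => fun s => Y s ω).map (truncSeq (t - 1))) ⊗ₘ (lagKernel κ (t - 1)) := by
  have htr := measurable_truncSeq (t - 1)
  have hpm : Measurable fun y : ℤ → ℝ => (truncSeq (t - 1) y, y t) :=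
    htr.prodMk (measurable_pi_apply t)
  have hYt : ∀ s, Measurable (Y s) := fun s => (measurable_pi_apply s).comp hYm
  rw [Measure.map_map hpm hYm, Measure.map_map htr hYm]
  have i1 : IsProbabilityMeasure
      (P.map ((fun y : ℤ → ℝ => (truncSeq (t - 1) y, y t)) ∘ fun ω s => Y s ω)) :=
    Measure.isProbabilityMeasure_map (hpm.comp hYm).aemeasurable
  have i2 : IsProbabilityMeasure (P.map (truncSeq (t - 1) ∘ fun ω s => Y s ω)) :=
    Measure.isProbabilityMeasure_map (htr.comp hYm).aemeasurable
  have hIic : ∀ (A : Set (ℤ → ℝ)) (v : ℝ), MeasurableSet A →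
      P.map ((fun y : ℤ → ℝ => (truncSeq (t - 1) y, y t)) ∘ fun ω s => Y s ω) (A ×ˢ Set.Iic v) =
      (P.map (truncSeq (t - 1) ∘ fun ω s => Y s ω) ⊗ₘ lagKernel κ (t - 1)) (A ×ˢ Set.Iic v) := by
    intro A v hA
    rw [Measure.map_apply (hpm.comp hYm) (hA.prod measurableSet_Iic),
      Measure.compProd_apply_prod hA measurableSet_Iic,
      setLIntegral_map hA ((lagKernel κ (t - 1)).measurable_coe measurableSet_Iic)
        (htr.comp hYm)]
    have hm : (⨆ s : Set.Iio t, MeasurableSpace.comap (Y s) inferInstance) ≤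
        (inferInstance : MeasurableSpace Ω) := iSup_le fun s => (hYt s).comap_le
    -- Each coordinate of the truncated sequence is either a past value or the constant `0`, so it
    -- is measurable for the σ-algebra of the past.
    have hE : MeasurableSet[⨆ s : Set.Iio t, MeasurableSpace.comap (Y s) inferInstance]
        ((truncSeq (t - 1) ∘ fun ω s => Y s ω) ⁻¹' A) := by
      have : Measurable[⨆ s : Set.Iio t, MeasurableSpace.comap (Y s) inferInstance]
          (truncSeq (t - 1) ∘ fun ω s => Y s ω) := by
        refine @measurable_pi_lambda _ _ _ (_) _ _ fun s => ?_
        by_cases hs : s ≤ t - 1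
        · have h1 : (fun ω => (truncSeq (t - 1) ∘ fun ω s => Y s ω) ω s) = Y s := by
            funext ω
            exact truncSeq_of_le hs _
          rw [h1]
          have hle : MeasurableSpace.comap (Y s) inferInstance ≤
              ⨆ s : Set.Iio t, MeasurableSpace.comap (Y s) inferInstance :=
            le_iSup (fun s : Set.Iio t => MeasurableSpace.comap (Y s) inferInstance)
              ⟨s, by simp only [Set.mem_Iio]; omega⟩
          exact (comap_measurable (Y s)).mono hle le_rfl
        · have h1 : (fun ω => (truncSeq (t - 1) ∘ fun ω s => Y s ω) ω s) = fun _ => 0 := by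
            funext ω
            exact if_neg hs
          rw [h1]
          exact @measurable_const _ _ _ (_) _
      exact this hA
    have hE' := hm _ hE
    have hB : MeasurableSet {ω | Y t ω ≤ v} := measurableSet_le (hYt t) measurable_const
    have h1 := setIntegral_condExp (μ := P) hm
      (f := {ω | Y t ω ≤ v}.indicator fun _ => (1 : ℝ)) ((integrable_const 1).indicator hB) hE
    rw [setIntegral_congr_ae hE' ((hMarkov t v).mono fun ω hω _ => hω)] at h1
    rw [setIntegral_indicator hB] at h1
    simp only [integral_const, smul_eq_mul, mul_one, measureReal_restrict_apply_univ] at h1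
    have h2 : ∀ ω, (κ (lagVec p (fun s => Y s ω) (t - 1))).real (Set.Iic v) =
        (lagKernel κ (t - 1) ((truncSeq (t - 1) ∘ fun ω s => Y s ω) ω) (Set.Iic v)).toReal := by
      intro ω
      rw [lagKernel_apply, Function.comp_apply, lagVec_truncSeq, Measure.real]
    simp only [h2] at h1
    have hkm : Measurable fun ω =>
        lagKernel κ (t - 1) ((truncSeq (t - 1) ∘ fun ω s => Y s ω) ω) (Set.Iic v) :=
      ((lagKernel κ (t - 1)).measurable_coe measurableSet_Iic).comp (htr.comp hYm)
    rw [integral_toReal hkm.aemeasurable (Eventually.of_forall fun ω => measure_lt_top _ _)] at h1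
    have hfin : ∫⁻ ω in (truncSeq (t - 1) ∘ fun ω s => Y s ω) ⁻¹' A,
        lagKernel κ (t - 1) ((truncSeq (t - 1) ∘ fun ω s => Y s ω) ω) (Set.Iic v) ∂P ≠ ∞ := by
      refine ne_top_of_le_ne_top (measure_ne_top P ((truncSeq (t - 1) ∘ fun ω s => Y s ω) ⁻¹' A)) ?_
      calc _ ≤ ∫⁻ _ in (truncSeq (t - 1) ∘ fun ω s => Y s ω) ⁻¹' A, 1 ∂P :=
            lintegral_mono fun ω => prob_le_one
        _ = _ := by simp
    exact ((ENNReal.toReal_eq_toReal_iff' hfin (measure_ne_top _ _)).1 h1).symm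
  refine Measure.ext_prod fun {A B} hA hB => ?_
  -- With the event `A` of the past fixed, both sides become finite measures on the line that agree
  -- on half-lines.
  have hμ : ∀ (μ : Measure ((ℤ → ℝ) × ℝ)) {B : Set ℝ}, MeasurableSet B →
      ((μ.restrict (A ×ˢ Set.univ)).map Prod.snd) B = μ (A ×ˢ B) := fun μ B hB => by
    rw [Measure.map_apply measurable_snd hB, Measure.restrict_apply (measurable_snd hB)]
    congr 1
    ext z
    simp [and_comm]
  rw [← hμ _ hB, ← hμ _ hB]
  congr 1
  refine Measure.ext_of_Iic _ _ fun v => ?_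
  rw [hμ _ measurableSet_Iic, hμ _ measurableSet_Iic]
  exact hIic A v hA

/-- The law of the series on path space. -/
lemma IsL2MApproximable.pathLaw (hY : IsL2MApproximable P f ε ε' Y)
    (hMarkov : IsMarkovOfOrder p P κ Y) (hDm : MeasurableSet D)
    [IsFiniteMeasure (volume.restrict (cube p D))] (hYD : ∀ t, ∀ᵐ ω ∂P, Y t ω ∈ D)
    (hLaws : RegularLaws p P D κ Y) : PathLaw p κ D (P.map fun ω => fun s => Y s ω) := by
  have hYm := hY.measurable_path
  have hΓ := hY.measurePreserving_causalFilter
  have hν : IsProbabilityMeasure (P.map (ε 0)) :=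
    Measure.isProbabilityMeasure_map (hY.measurable_innov 0).aemeasurable
  have hcube : MeasurableSet (cube p D) := MeasurableSet.univ_pi fun _ => hDm
  have hQp : IsProbabilityMeasure (P.map fun ω => fun s => Y s ω) :=
    Measure.isProbabilityMeasure_map hYm.aemeasurable
  have hlag : ∀ t, (P.map fun ω => fun s => Y s ω).map (fun y => lagVec p y t) =
      P.map fun ω => lagVec p (fun s => Y s ω) t := fun t =>
    Measure.map_map (measurable_lagVec p t) hYm
  obtain ⟨g, hg0, hgc, hg⟩ := hLaws.marginal_density
  refine ⟨fun i => ⟨measurable_shiftSeq i, ?_⟩, map_truncSeq_eq_compProd hYm hMarkov,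
    fun u hum hui => ?_, ?_, fun x hx => ?_, fun t => ?_, fun t => ?_⟩
  · have h1 := ((hΓ.comp (measurePreserving_shiftSeq (P.map (ε 0)) i)).map_eq)
    -- The filter commutes with shifts, so stationarity, and below also the ergodic theorem, descend
    -- from the product measure of the innovations.
    have h2 : causalFilter f ∘ shiftSeq i = shiftSeq i ∘ causalFilter f :=
      funext fun e => causalFilter_shiftSeq i e
    rw [h2, ← Measure.map_map (measurable_shiftSeq i) hΓ.measurable, hΓ.map_eq] at h1
    exact h1
  · have hprod := hΓ.prod (MeasurePreserving.id (volume.restrict (cube p D)))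
    have hui' := hprod.integrable_comp_of_integrable hui
    have hav := avgTendsto_shiftSeq (P.map (ε 0)) (volume.restrict (cube p D)) hui'
    have hmeas : ∀ N, Measurable (avgDev (P.map fun ω => fun s => Y s ω)
        (fun i : ℕ => shiftSeq (i : ℤ)) u N) := fun N =>
      ((Finset.measurable_fun_sum (Finset.range N) fun (i : ℕ) _ => hum.comp
        (((measurable_shiftSeq (i : ℤ)).comp measurable_fst).prodMk measurable_snd)).const_mul
          (1 / (N : ℝ))).sub
        ((hum.stronglyMeasurable.integral_prod_left'.measurable).comp measurable_snd)
    refine hav.congr fun N => ?_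
    rw [← hprod.lintegral_comp (hmeas N).enorm]
    refine lintegral_congr fun z => ?_
    congr 1
    simp only [avgDev, Function.comp_apply, Prod.map, id, causalFilter_shiftSeq]
    congr 1
    have huz : Measurable fun e => u (e, z.2) := hum.comp measurable_prodMk_right
    rw [← hΓ.map_eq, integral_map hΓ.measurable.aemeasurable huz.aestronglyMeasurable]
  · rw [ae_all_iff]
    intro t
    rw [ae_map_iff hYm.aemeasurable (measurable_pi_apply t hDm)]
    exact hYD t
  · obtain ⟨φ, hφ⟩ := hLaws.cond_density
    rw [(hφ x hx).2.2]
    exact withDensity_absolutelyContinuous _ _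
  · rw [hlag, hg]
    exact withDensity_absolutelyContinuous _ _
  · rw [hlag, hg]
    -- Positivity of the density on the whole cube gives the reverse absolute continuity, which the
    -- transfer to future values relies on.
    refine withDensity_absolutelyContinuous'
      (hgc.continuousOn.aemeasurable hcube).ennreal_ofReal ?_
    filter_upwards [ae_restrict_mem hcube] with x hx
    exact (ENNReal.ofReal_pos.2 (hg0 x hx)).ne'

/-- The conformity score at time `n + 1` is independent of the lag vector at time `n`. -/
lemma condExp_lowScore (hYm : Measurable fun ω => fun s => Y s ω)
    (hQ : PathLaw p κ D (P.map fun ω => fun s => Y s ω))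
    (hLip : ∃ L : ℝ≥0, ∀ x ∈ cube p D, LipschitzWith L fun y => (κ x).real (Set.Iic y))
    {a : ℝ} (ha0 : 0 < a) (ha : a ≤ 1 / 2) (n : ℤ) :
    P⟦(fun ω => fun s => Y s ω) ⁻¹' lowScore κ a (n + 1) |
      MeasurableSpace.comap (fun ω => lagVec p (fun s => Y s ω) n) inferInstance⟧ =ᵐ[P]
      fun _ => 2 * a := by
  have hQp : IsProbabilityMeasure (P.map fun ω => fun s => Y s ω) :=
    Measure.isProbabilityMeasure_map hYm.aemeasurable
  have hX : Measurable fun ω => lagVec p (fun s => Y s ω) n := (measurable_lagVec p n).comp hYm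
  have hlow := measurableSet_lowScore (κ := κ) a (n + 1)
  have hB := hYm hlow
  refine (ae_eq_condExp_of_forall_setIntegral_eq hX.comap_le
    ((integrable_const (1 : ℝ)).indicator hB) (fun s _ _ => (integrable_const _).integrableOn)
    ?_ aestronglyMeasurable_const).symm
  rintro s ⟨A, hA, rfl⟩ -
  obtain ⟨φ, hφ⟩ : ∃ φ : (ℤ → ℝ) → ℝ,
      φ = fun y => A.indicator (fun _ => (1 : ℝ)) (lagVec p y n) := ⟨_, rfl⟩
  have hφm : Measurable φ := by
    rw [hφ]; exact (measurable_const.indicator hA).comp (measurable_lagVec p n)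
  have hφi : Integrable φ (P.map fun ω => fun s => Y s ω) :=
    Integrable.of_bound hφm.aestronglyMeasurable 1 (Eventually.of_forall fun y => by
      rw [hφ]; exact (norm_indicator_le_norm_self _ _).trans (by simp))
  have hdep : DependsOn φ (Set.Iic (n + 1 - 1)) := fun y y' hy => by
    rw [hφ]
    exact congrArg (A.indicator fun _ => (1 : ℝ)) (dependsOn_lagVec p n fun k hk =>
      hy k (by have := hk.2; simp only [Set.mem_Iic]; omega))
  have h1 := hQ.integral_mul_lowScore hLip ha0 ha (n + 1) hφm hφi hdep
  have hprod : Measurable fun y =>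
      φ y * (lowScore κ a (n + 1)).indicator (fun _ => (1 : ℝ)) y :=
    hφm.mul (measurable_const.indicator hlow)
  rw [integral_map hYm.aemeasurable hprod.aestronglyMeasurable, integral_map hYm.aemeasurable hφm.aestronglyMeasurable] at h1
  have hXA := hX hA
  rw [← integral_indicator hXA, ← integral_indicator hXA]
  have e1 : ∀ ω, ((fun ω => lagVec p (fun s => Y s ω) n) ⁻¹' A).indicator (fun _ => 2 * a) ω =
      2 * a * φ fun s => Y s ω := fun ω => by
    classical
    simp only [Set.indicator_apply, hφ, Set.mem_preimage]
    split_ifs <;> simp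
  have e2 : ∀ ω, ((fun ω => lagVec p (fun s => Y s ω) n) ⁻¹' A).indicator
      (((fun ω => fun s => Y s ω) ⁻¹' lowScore κ a (n + 1)).indicator fun _ => (1 : ℝ)) ω =
      φ (fun s => Y s ω) * (lowScore κ a (n + 1)).indicator (fun _ => (1 : ℝ)) fun s => Y s ω :=
    fun ω => by
    classical
    simp only [Set.indicator_apply, hφ, Set.mem_preimage]
    split_ifs <;> simp
  simp only [e1, e2]
  rw [integral_const_mul]
  exact h1.symm

end

end MDCP

end

/-! ### Conditional coverage -/

theorem theorem2 {Ω S : Type*} [MeasurableSpace Ω] [MeasurableSpace S]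
    (P : Measure Ω) [IsProbabilityMeasure P]
    (p : ℕ) (hp : 1 ≤ p)
    -- the series, its innovations and the independent copies of these
    (f : (ℕ → S) → ℝ) (ε : ℤ → Ω → S) (ε' : ℤ → ℤ → Ω → S) (Y : ℤ → Ω → ℝ)
    (hY : MDCP.IsL2MApproximable P f ε ε' Y)
    -- the Markov property, with transition kernel `κ`
    (κ : Kernel (Fin p → ℝ) ℝ) [IsMarkovKernel κ]
    (hMarkov : MDCP.IsMarkovOfOrder p P κ Y)
    -- the bounded domain `D` of the series
    (D : Set ℝ) (hD : D.OrdConnected) (C_M : ℝ) (hC : 0 < C_M)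
    (hDC : D ⊆ Set.Icc (-C_M) C_M) (hYD : ∀ t, ∀ᵐ ω ∂P, Y t ω ∈ D)
    (hLaws : MDCP.RegularLaws p P D κ Y)
    -- kernels, bandwidths and approximation order
    (w K : ℝ → ℝ) (hwK : MDCP.KernelConditions p w K)
    (h h₀ : ℕ → ℝ) (hh : MDCP.BandwidthConditions p h h₀)
    (m : ℕ → ℕ) (hm : MDCP.ApproximationRate p h (MDCP.approxError P f ε ε' Y) m)
    -- the candidate values and the level
    (trial : Set ℝ) (hTrial : D ⊆ trial)
    (α : ℝ) (hα : α ∈ Set.Ioo (0 : ℝ) 1) :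
    TendstoInMeasure P
      (fun (n : ℕ) (ω : Ω) =>
        |(P⟦{ω' | Y ((n : ℤ) + 1) ω' ∈
              MDCP.predSet p n w K (h n) (h₀ n) α trial (fun s => Y s ω')} |
            MeasurableSpace.comap (fun ω' => MDCP.lagVec p (fun s => Y s ω') (n : ℤ))
              inferInstance⟧) ω - (1 - α)|)
      atTop (fun _ => 0) := by
  classical
  have hDm : MeasurableSet D := hD.measurableSet
  have hfin := MDCP.isFiniteMeasure_restrict_cube p hDC
  have hYm := hY.measurable_path
  have hYt : ∀ s, Measurable (Y s) := fun s => (measurable_pi_apply s).comp hYm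
  have hQp : IsProbabilityMeasure (P.map fun ω => fun s => Y s ω) :=
    Measure.isProbabilityMeasure_map hYm.aemeasurable
  have hQ := hY.pathLaw hMarkov hDm hYD hLaws
  have hα0 := hα.1
  have hα1 := hα.2
  -- `A n` is coverage without the restriction to trial values, `B n` its counterpart for the true
  -- score. The restriction is harmless: Y_{n+1} lies in D, hence in `trial`, almost surely.
  obtain ⟨A, hA⟩ : ∃ A : ℕ → Set Ω, A = fun (n : ℕ) => (fun ω => fun s => Y s ω) ⁻¹'
      {y | α < MDCP.pValue p n w K (h n) (h₀ n) y (y (n + 1))} := ⟨_, rfl⟩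
  obtain ⟨B, hB⟩ : ∃ B : ℕ → Set Ω, B = fun (n : ℕ) => (fun ω => fun s => Y s ω) ⁻¹'
      MDCP.lowScore κ ((1 - α) / 2) (n + 1) := ⟨_, rfl⟩
  have hAm : ∀ n, MeasurableSet (A n) := fun n => by
    rw [hA]
    exact hYm (measurableSet_lt measurable_const (MDCP.measurable_pValue hwK hp n _ _))
  have hBm : ∀ n, MeasurableSet (B n) := fun n => by
    rw [hB]
    exact hYm (MDCP.measurableSet_lowScore _ _)
  obtain ⟨X, hX⟩ : ∃ X : ℕ → MeasurableSpace Ω, X = fun (n : ℕ) => MeasurableSpace.comap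
      (fun ω' => MDCP.lagVec p (fun s => Y s ω') (n : ℤ)) inferInstance := ⟨_, rfl⟩
  have hcover : ∀ n, P⟦{ω' | Y ((n : ℤ) + 1) ω' ∈
      MDCP.predSet p n w K (h n) (h₀ n) α trial (fun s => Y s ω')} | X n⟧ =ᵐ[P]
        P⟦A n | X n⟧ := fun n => by
    refine condExp_congr_ae ?_
    filter_upwards [hYD (n + 1)] with ω hω
    have hiff : (ω ∈ {ω' | Y ((n : ℤ) + 1) ω' ∈
        MDCP.predSet p n w K (h n) (h₀ n) α trial (fun s => Y s ω')}) ↔ ω ∈ A n := by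
      rw [hA]
      exact ⟨fun hmem => hmem.2, fun hmem => ⟨hTrial hω, hmem⟩⟩
    simp only [Set.indicator_apply, hiff]
  have hlevel : ∀ n, P⟦B n | X n⟧ =ᵐ[P] fun _ => 1 - α := fun n => by
    have := MDCP.condExp_lowScore hYm hQ hLaws.lipschitz_cdf
      (a := (1 - α) / 2) (by linarith) (by linarith) n
    rw [hB, hX]
    refine this.trans (Eventually.of_forall fun _ => ?_)
    ring
  have hdiff : ∀ n, (fun ω => |(P⟦{ω' | Y ((n : ℤ) + 1) ω' ∈
      MDCP.predSet p n w K (h n) (h₀ n) α trial (fun s => Y s ω')} | X n⟧) ω - (1 - α)|) =ᵐ[P]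
        fun ω => |(P[(A n).indicator (fun _ => (1 : ℝ)) - (B n).indicator (fun _ => (1 : ℝ)) |
          X n]) ω| := fun n => by
    have hsub := condExp_sub (μ := P) ((integrable_const (1 : ℝ)).indicator (hAm n))
      ((integrable_const (1 : ℝ)).indicator (hBm n)) (X n)
    filter_upwards [hcover n, hlevel n, hsub] with ω h1 h2 h3
    rw [h1, h3, Pi.sub_apply, h2]
  have hbound : ∀ n, eLpNorm (fun ω => |(P⟦{ω' | Y ((n : ℤ) + 1) ω' ∈
      MDCP.predSet p n w K (h n) (h₀ n) α trial (fun s => Y s ω')} | X n⟧) ω - (1 - α)|) 1 P ≤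
        (P.map fun ω => fun s => Y s ω) {y | ¬ (α < MDCP.pValue p n w K (h n) (h₀ n) y
          (y (n + 1)) ↔ y ∈ MDCP.lowScore κ ((1 - α) / 2) (n + 1))} := fun n => by
    rw [eLpNorm_congr_ae (hdiff n)]
    have h1 : eLpNorm (fun ω => |(P[(A n).indicator (fun _ => (1 : ℝ)) -
        (B n).indicator (fun _ => (1 : ℝ)) | X n]) ω|) 1 P =
        eLpNorm (P[(A n).indicator (fun _ => (1 : ℝ)) -
        (B n).indicator (fun _ => (1 : ℝ)) | X n]) 1 P :=
      eLpNorm_norm (P[(A n).indicator (fun _ => (1 : ℝ)) -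
        (B n).indicator (fun _ => (1 : ℝ)) | X n])
    rw [h1]
    -- The conditional probability of `B n` is exactly 1 - α, so the error is the conditional
    -- expectation of a difference of indicators, and contraction in L¹ bounds it by the probability
    -- of the symmetric difference.
    refine (eLpNorm_condExp_le_eLpNorm _ le_rfl).trans ?_
    rw [eLpNorm_one_eq_lintegral_enorm]
    have h2 : ∀ ω, ‖((A n).indicator (fun _ => (1 : ℝ)) - (B n).indicator (fun _ => (1 : ℝ))) ω‖ₑ ≤
        {ω | ¬ (ω ∈ A n ↔ ω ∈ B n)}.indicator 1 ω := fun ω => by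
      simp only [Pi.sub_apply, Set.indicator_apply, Set.mem_ofPred_eq]
      by_cases ha : ω ∈ A n <;> by_cases hb : ω ∈ B n <;> simp [ha, hb]
    have hm : MeasurableSet {ω | ¬ (ω ∈ A n ↔ ω ∈ B n)} := ((hAm n).iff (hBm n)).compl
    refine (lintegral_mono h2).trans ?_
    rw [lintegral_indicator_one hm]
    -- An inequality suffices here, and it needs no measurability of the exceptional set in path
    -- space.
    refine le_of_eq_of_le ?_ (Measure.le_map_apply hYm.aemeasurable _)
    rw [hA, hB]
    rfl
  refine tendstoInMeasure_of_tendsto_eLpNorm (p := 1) one_ne_zero (fun n => ?_)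
    aestronglyMeasurable_const ?_
  · exact ((integrable_condExp (μ := P)).1.sub
      (aestronglyMeasurable_const (b := 1 - α))).norm
  · rw [ENNReal.tendsto_nhds_zero]
    intro e he
    wlog hefin : e ≠ ∞ generalizing e
    · exact Eventually.of_forall fun n => by rw [not_not.1 hefin]; exact le_top
    filter_upwards [hQ.eventually_lt_pValue_iff hwK hp hDm hC hDC
      (fun v => (hLaws.contDiff_cdf v).continuousOn) hLaws.lipschitz_cdf hh hα
      (ENNReal.toReal_pos he.ne' hefin)] with n hn
    have hb := hbound n
    rw [hX] at hb
    have hz : ∀ φ : Ω → ℝ, φ - (fun _ => (0 : ℝ)) = φ := fun φ => sub_zero φ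
    rw [hz]
    refine hb.trans ?_
    rw [← ENNReal.ofReal_toReal hefin]
    exact (ENNReal.le_ofReal_iff_toReal_le (measure_ne_top _ _) ENNReal.toReal_nonneg).2 hn
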